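/- **Setting.** Let $A$ be a finite set and $X=(X_n)_{n\in\mathbb Z}\sim(A^{\mathbb Z},\mu)$ a stationary irreducible aperiodic Markov process of memory one in which every state has positive probability. Let $a\in A$ be a renewal state, put $\widehat X=(\mathbf 1\{X_n=a\})_{n\in\mathbb Z}$ (and write $\widehat x,\widehat w$ likewise for points and words), and suppose $X$ is a *marked process*: there is $c<1$ such that $\mathbf P[X_{[0,n+1]}=awa\mid\widehat X_{[0,n+1]}=10^n1]\in[0,c]\cup\{1\}$ for all $n\ge1$ and $w\in(A\setminus\{a\})^n$. Assume $h:=h(X\mid\widehat X)=h(X)-h(\widehat X)>0$. Logarithms are natural, and $\Lambda_{u,v}(t)=t^{v}\log^{u}t$. Let $\xi=\xi(\widehat X)\in(\mathbb N\cup\{0\})^{\mathbb Z}$ be a *marker factor*: a measurable map, defined up to null sets and commuting with the shift, with $\xi_0>0\Rightarrow\widehat X_0=1$ almost surely and $\mathbf P[\xi_0\ge r]>0$ for every $r>0$. For $r\ge1$, an interval $[\alpha,\beta]$ with $\alpha\le\beta$ carries an *$r$-skeleton* $S=(\widehat x_{[\alpha,\beta]},\xi(\widehat x)_{[\alpha,\beta]})$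 if $\xi_\alpha,\xi_{\beta+1}\ge r>\xi_i$ for all $\alpha<i\le\beta$. A *skeleton* is an $r$-skeleton for some $r\ge1$; $|S|=\beta-\alpha+1$, and $i\in S$ means $i\in[\alpha,\beta]$. Statements on all skeletons concern the skeletons occurring in almost every $\widehat x$. $S_r=S_r(X)$ is the $r$-skeleton covering $0$. For random variables with $U$ countably valued, $\{U\Rrightarrow V\}$ is the event that, conditioned on the observed value of $U$, $V$ is almost surely constant. For a sequence $L=(L_r)$, $f(r)=\Delta(L_r)$ means $f(r)=O(L_r^{-k})$ as $r\to\infty$ for every $k\ge1$. Suppose $\xi$ is *nice with lengths sequence* $(L_r)$: $L_r\to\infty$, the event that $X_{[-L_r,L_r]}$ determines the interval covered by $S_r$ has probability $1-\Delta(L_r)$, and for some $c>0$, $\mathbf P[L_r/\log^cL_r\le|S_r|\le L_r]=1-\Delta(L_r)$. For a skeleton $S$ on $[\alpha,\beta]$, the *filler space* is $A_S=\{w\in A^{[\alpha,\beta]}:\widehat w=\widehat x_{[\alpha,\beta]}\}$ with $\mu_S(w)=\mathbf P[X_{[\alpha,\beta]}=w\mid\widehat X_{[\alpha,\beta+1]}=\widehat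 x_{[\alpha,\beta+1]}]$. A *system of fillers* (SOF) is a family of equivalence relations $\sim_S$ on the $A_S$, with classes $[w]$, such that: (i) it is translation invariant; (ii) whenever $S=S^1\cdots S^m$ is a decomposition into skeletons, $w\sim_Sw'$ implies $w_{S^i}\sim_{S^i}w'_{S^i}$ for all $i$; (iii) $\mathbf E\big[|S_r|^{-1}\sum_{i\in S_r}\mathbf 1\{[X_{S_r}]\Rrightarrow X_i\}\big]\to1$ as $r\to\infty$, where the value of the class $[X_{S_r}]$ includes the skeleton $S_r$. Write $I_{\mu_S}([w])=-\log\mu_S([w])$ ($=+\infty$ if $\mu_S([w])=0$). The SOF is *good* if there are reals $K\ge k$ such that 1. for every skeleton $S$ of large enough size and every $w\in A_S$, $I_{\mu_S}([w])\le|S|h-\Lambda_{k,1/2}(|S|)$; 2. $\mathbf P\big[I_{\mu_{S_r}}([X_{S_r}])\ge|S_r|h-\Lambda_{K,1/2}(|S_r|)\big]=1-\Delta(L_r)$. **Proposition.** For every marked process $X$ with $h(X\mid\widehat X)>0$, every nice marker factor $\xi$ of $\widehat X$ and every lengths sequence $(L_r)$ of $\xi$, there exists a good SOF which in addition satisfies,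 for some $\delta>0$, $$\mathbf P\Big[\frac1{|S_r|}\sum_{i\in S_r}\mathbf 1\{[X_{S_r}]\Rrightarrow X_i\}\ge1-\Lambda_{\delta,-1/2}(|S_r|)\Big]=1-\Delta(L_r).$$ -/

import Mathlib

open MeasureTheory ProbabilityTheory Filter Asymptotics
open scoped ENNReal Topology

namespace MarkedProc

noncomputable section

/-! ### Asymptotic conventions and determination -/

/-- The function `Λ_{a,b}(x) = x ^ b * (log x) ^ a`. -/
def Lam (a b x : ℝ) : ℝ := x ^ b * Real.log x ^ a

/-- `f r = Δ(L r)`: superpolynomial decay of `f` in terms of the sequence `L`. -/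
def IsDelta (f L : ℕ → ℝ) : Prop :=
  ∀ k : ℕ, 1 ≤ k → f =O[atTop] fun r => (L r ^ k)⁻¹

/-- `P[E r] = 1 - Δ(L r)`. -/
def OneSubDelta {Ω : Type*} [MeasurableSpace Ω] (μ : Measure Ω) (E : ℕ → Set Ω)
    (L : ℕ → ℝ) : Prop :=
  IsDelta (fun r => μ.real (E r)ᶜ) L

/-- The event that the (countably valued) random variable `F` determines `G`: all `ω` such that,
conditioned on `F = F ω`, the random variable `G` is almost surely equal to `G ω`. -/
def Determines {Ω α β : Type*} [MeasurableSpace Ω] (μ : Measure Ω) (F : Ω → α) (G : Ω → β) :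
    Set Ω :=
  {ω | μ {ω' | F ω' = F ω ∧ G ω' ≠ G ω} = 0}

/-- The information `-log p` of an event of probability `p`; it is `⊤` for `p = 0`. -/
def information (p : ℝ≥0∞) : EReal := -ENNReal.log p

/-! ### Processes -/

/-- The left shift. -/
def shift {B : Type*} (x : ℤ → B) : ℤ → B := fun n => x (n + 1)

/-- Shannon entropy of the first `n` coordinates (natural logarithm). -/
def blockEntropy {B : Type*} [Fintype B] [MeasurableSpace B] (ν : Measure (ℤ → B)) (n : ℕ) : ℝ :=
  ∑ w : Fin n → B, Real.negMulLog (ν.real {x | ∀ j : Fin n, x ((j : ℕ) : ℤ) = w j})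

/-- The entropy `h(Y)` of a stationary process `Y` with law `ν`. -/
def entropyRate {B : Type*} [Fintype B] [MeasurableSpace B] (ν : Measure (ℤ → B)) : ℝ :=
  limUnder atTop fun n : ℕ => blockEntropy ν n / n

section MarkedState

variable {A : Type*} [Fintype A] [DecidableEq A] [MeasurableSpace A]

/-- The indicator sequence of the occurrences of `a` in `x`. -/
def hat (a : A) (x : ℤ → A) : ℤ → Bool := fun n => decide (x n = a)

/-- The law of the process of occurrences of `a`. -/
def hatLaw (μ : Measure (ℤ → A)) (a : A) : Measure (ℤ → Bool) := μ.map (hat a)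

/-- The conditional entropy `h(X | X̂) = h(X) - h(X̂)`, `X̂` being a factor of `X`. -/
def condEntropy (μ : Measure (ℤ → A)) (a : A) : ℝ :=
  entropyRate μ - entropyRate (hatLaw μ a)

/-- `μ` is the law of a stationary aperiodic Markov process of memory one in which all states
have positive probability. -/
structure IsAperiodicMarkov (μ : Measure (ℤ → A)) : Prop where
  isProbabilityMeasure : IsProbabilityMeasure μ
  stationary : MeasurePreserving (shift : (ℤ → A) → (ℤ → A)) μ μ
  markov : ∀ (n : ℕ) (w : ℕ → A),
    μ {x | ∀ i : ℕ, i ≤ n + 1 → x i = w i} * μ {x | x n = w n} =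
      μ {x | ∀ i : ℕ, i ≤ n → x i = w i} * μ {x | x n = w n ∧ x (n + 1) = w (n + 1)}
  irreducible : ∀ b b' : A, ∃ n : ℕ, 0 < μ {x | x 0 = b ∧ x n = b'}
  period_one : ∀ (b b' : A) (d : ℕ), (∀ n : ℕ, 0 < μ {x | x 0 = b ∧ x n = b'} → d ∣ n) → d = 1

/-- Conditioned on `X 0 = a`, the words `X_{[-n,-1]}` and `X_{[1,n]}` are independent. -/
def IsRenewalState (μ : Measure (ℤ → A)) (a : A) : Prop :=
  ∀ (n : ℕ) (w : ℤ → A), w 0 = a →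
    μ {x | ∀ i : ℤ, -n ≤ i → i ≤ n → x i = w i} * μ {x | x 0 = a} =
      μ {x | ∀ i : ℤ, -n ≤ i → i ≤ 0 → x i = w i} * μ {x | ∀ i : ℤ, 0 ≤ i → i ≤ n → x i = w i}

/-- The probability reduction property of the state `a`. -/
def ProbabilityReduction (μ : Measure (ℤ → A)) (a : A) : Prop :=
  ∃ c : ℝ, c < 1 ∧ ∀ (n : ℕ) (w : ℕ → A), 1 ≤ n → (∀ i : ℕ, 1 ≤ i → i ≤ n → w i ≠ a) →
    let p : ℝ := (cond μ {x | x 0 = a ∧ (∀ i : ℕ, 1 ≤ i → i ≤ n → x i ≠ a) ∧ x (n + 1) = a}).real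
      {x | x 0 = a ∧ (∀ i : ℕ, 1 ≤ i → i ≤ n → x i = w i) ∧ x (n + 1) = a}
    p ∈ Set.Icc 0 c ∪ {1}

/-- `(A^ℤ, μ, a)` is a marked process. -/
structure IsMarkedProcess (μ : Measure (ℤ → A)) (a : A) : Prop where
  aperiodicMarkov : IsAperiodicMarkov μ
  renewal : IsRenewalState μ a
  reduction : ProbabilityReduction μ a

/-! ### Marker factors and skeletons -/

/-- `ξ` is a marker factor of the process with law `ν` on `{0,1}^ℤ`. -/
structure IsMarkerFactor (ν : Measure (ℤ → Bool)) (ξ : (ℤ → Bool) → (ℤ → ℕ)) : Prop where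
  measurable : Measurable ξ
  stationary : ∀ᵐ ω ∂ν, ξ (shift ω) = shift (ξ ω)
  marks : ∀ᵐ ω ∂ν, 0 < ξ ω 0 → ω 0 = true
  unbounded : ∀ r : ℕ, 0 < r → 0 < ν {ω | r ≤ ξ ω 0}

/-- In the marker sequence `m`, the interval `[α, α + n - 1]` is covered by a skeleton
(of some rank `r ≥ 1`). -/
def IsSkeleton (m : ℤ → ℕ) (α : ℤ) (n : ℕ) : Prop :=
  0 < n ∧ ∃ r : ℕ, 1 ≤ r ∧ r ≤ m α ∧ r ≤ m (α + n) ∧ ∀ i : ℤ, α < i → i < α + n → m i < r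

/-- The data of a skeleton `(x̂_{[α,β]}, ξ(x̂)_{[α,β]})`, where `α = start` and
`β = start + len - 1`. The `j`-th entry of a word belongs to the coordinate `start + j`. -/
structure Skel where
  start : ℤ
  len : ℕ
  hatWord : Fin len → Bool
  markWord : Fin len → ℕ

/-- The data `(ω_{[α,β]}, ξ(ω)_{[α,β]})` with `β = α + n - 1`. -/
def skelOf (ξ : (ℤ → Bool) → (ℤ → ℕ)) (ω : ℤ → Bool) (α : ℤ) (n : ℕ) : Skel where
  start := α
  len := n
  hatWord := fun j => ω (α + (j : ℕ))
  markWord := fun j => ξ ω (α + (j : ℕ))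

/-- Translation of a skeleton. -/
def Skel.translate (S : Skel) (t : ℤ) : Skel := { S with start := S.start + t }

/-- The piece of length `l` of `S` that begins at the coordinate `S.start + k`. -/
def Skel.sub (S : Skel) (k l : ℕ) (h : k + l ≤ S.len) : Skel where
  start := S.start + k
  len := l
  hatWord := fun j => S.hatWord ⟨k + j, by omega⟩
  markWord := fun j => S.markWord ⟨k + j, by omega⟩

/-- `S_r` begins at the last coordinate `i ≤ 0` with marker at least `r`. -/
def leftEnd (m : ℤ → ℕ) (r : ℕ) : ℤ := sSup {i : ℤ | i ≤ 0 ∧ r ≤ m i}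

/-- `S_r` ends just before the first coordinate `i > 0` with marker at least `r`. -/
def rightEnd (m : ℤ → ℕ) (r : ℕ) : ℤ := sInf {i : ℤ | 0 < i ∧ r ≤ m i}

/-- The size `|S_r(x)|`. -/
def size (ξ : (ℤ → Bool) → (ℤ → ℕ)) (a : A) (r : ℕ) (x : ℤ → A) : ℕ :=
  (rightEnd (ξ (hat a x)) r - leftEnd (ξ (hat a x)) r).toNat

/-- The `r`-skeleton `S_r(x)` that covers `x` at the coordinate `0`. -/
def skelAt (ξ : (ℤ → Bool) → (ℤ → ℕ)) (a : A) (r : ℕ) (x : ℤ → A) : Skel :=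
  skelOf ξ (hat a x) (leftEnd (ξ (hat a x)) r) (size ξ a r x)

/-- `ξ` is nice, with lengths sequence `L`: up to probability `Δ(L r)`, the sample on
`[-L r, L r]` determines the interval `S_r`, and `L r / (log (L r)) ^ c ≤ |S_r| ≤ L r`. -/
structure IsLengthsSequence (μ : Measure (ℤ → A)) (a : A) (ξ : (ℤ → Bool) → (ℤ → ℕ))
    (L : ℕ → ℝ) : Prop where
  tendsto_atTop : Tendsto L atTop atTop
  determined : OneSubDelta μ
    (fun r => Determines μ (fun x (i : {i : ℤ // |(i : ℝ)| ≤ L r}) => x i)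
      (fun x => (leftEnd (ξ (hat a x)) r, rightEnd (ξ (hat a x)) r))) L
  size_bounds : ∃ c : ℝ, 0 < c ∧ OneSubDelta μ
    (fun r => {x | L r / Real.log (L r) ^ c ≤ (size ξ a r x : ℝ) ∧ (size ξ a r x : ℝ) ≤ L r}) L

/-! ### Fillers and systems of fillers -/

/-- The fillers of a skeleton: words whose occurrences of `a` are prescribed. -/
def Filler (a : A) {n : ℕ} (u : Fin n → Bool) : Type _ :=
  {w : Fin n → A // ∀ j, decide (w j = a) = u j}

/-- The sub-word of a filler that fills a piece of the skeleton. -/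
def Filler.sub {a : A} {S : Skel} (w : Filler a S.hatWord) (k l : ℕ) (h : k + l ≤ S.len) :
    Filler a (S.sub k l h).hatWord :=
  ⟨fun j => w.1 ⟨k + j, Nat.lt_of_lt_of_le (Nat.add_lt_add_left j.2 k) h⟩, fun _ => w.2 _⟩

/-- The filler measure `μ_S`: the conditional law of `X_{[α,β]}` given that the occurrences of
`a` in `[α,β]` are those prescribed by `S` and that `a` occurs at `β + 1`. -/
def fillerProb (μ : Measure (ℤ → A)) (a : A) (S : Skel) (E : Set (Filler a S.hatWord)) : ℝ≥0∞ :=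
  (cond μ {x | (∀ j : Fin S.len, hat a x (S.start + (j : ℕ)) = S.hatWord j) ∧
      x (S.start + S.len) = a})
    {x | ∃ w ∈ E, ∀ j : Fin S.len, x (S.start + (j : ℕ)) = w.1 j}

/-- The word `x_{[α, α + n - 1]}` as a filler of the corresponding skeleton of `x`. -/
def fillerOf (ξ : (ℤ → Bool) → (ℤ → ℕ)) (a : A) (x : ℤ → A) (α : ℤ) (n : ℕ) :
    Filler a (skelOf ξ (hat a x) α n).hatWord :=
  ⟨fun j => x (α + (j : ℕ)), fun _ => rfl⟩

/-- A choice of an equivalence relation on each filler space. (Only the relations on fillers of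
skeletons that occur with positive probability are of significance.) -/
abbrev FillerRelations (a : A) : Type _ := ∀ S : Skel, Setoid (Filler a S.hatWord)

/-- The class `[w]` of a filler. -/
def FillerRelations.cls {a : A} (R : FillerRelations a) (S : Skel) (w : Filler a S.hatWord) :
    Set (Filler a S.hatWord) :=
  {w' | (R S).r w w'}

/-- The random class `[X_{S_r}]`, an equivalence class of fillers of the random skeleton `S_r`. -/
def FillerRelations.randomClass {a : A} (R : FillerRelations a) (ξ : (ℤ → Bool) → (ℤ → ℕ))
    (r : ℕ) (x : ℤ → A) : Σ S : Skel, Quotient (R S) :=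
  ⟨skelAt ξ a r x, Quotient.mk (R (skelAt ξ a r x)) (fillerOf ξ a x _ _)⟩

/-- The fraction of the coordinates `i ∈ S_r` such that `[X_{S_r}]` determines `X_i`. -/
def FillerRelations.determinedFraction {a : A} (R : FillerRelations a) (μ : Measure (ℤ → A))
    (ξ : (ℤ → Bool) → (ℤ → ℕ)) (r : ℕ) (x : ℤ → A) : ℝ :=
  (1 / (size ξ a r x : ℝ)) *
    ∑ i ∈ Finset.Ico (leftEnd (ξ (hat a x)) r) (rightEnd (ξ (hat a x)) r),
      (Determines μ (R.randomClass ξ r) (fun y => y i)).indicator (fun _ => (1 : ℝ)) x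

/-- The information `I_{μ_{S_r}}([X_{S_r}])` of the random class. -/
def FillerRelations.randomInformation {a : A} (R : FillerRelations a) (μ : Measure (ℤ → A))
    (ξ : (ℤ → Bool) → (ℤ → ℕ)) (r : ℕ) (x : ℤ → A) : EReal :=
  information (fillerProb μ a (skelAt ξ a r x)
    (R.cls (skelAt ξ a r x) (fillerOf ξ a x _ _)))

/-- The skeleton of `m` on `[α, α + n - 1]` is the concatenation of `q` skeletons, the `i`-th of
which has length `l i` and begins at the coordinate `α + k i`. -/
structure IsDecomposition (m : ℤ → ℕ) (α : ℤ) (n q : ℕ) (k l : Fin q → ℕ) : Prop where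
  offset : ∀ i, k i = ∑ j ∈ Finset.univ.filter (fun j => j < i), l j
  total : ∑ j, l j = n
  skeleton : ∀ i, IsSkeleton m (α + k i) (l i)

/-- Systems of fillers (SOF) for the process `μ` with marked state `a` and marker factor `ξ`. -/
structure IsSOF (μ : Measure (ℤ → A)) (a : A) (ξ : (ℤ → Bool) → (ℤ → ℕ))
    (R : FillerRelations a) : Prop where
  translation_invariant : ∀ (S : Skel) (t : ℤ) (w w' : Filler a S.hatWord),
    (R (S.translate t)).r w w' ↔ (R S).r w w'
  refines_product : ∀ᵐ ω ∂(hatLaw μ a), ∀ (α : ℤ) (n : ℕ), IsSkeleton (ξ ω) α n →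
    ∀ (q : ℕ) (k l : Fin q → ℕ), IsDecomposition (ξ ω) α n q k l →
      ∀ w w' : Filler a (skelOf ξ ω α n).hatWord, (R (skelOf ξ ω α n)).r w w' →
        ∀ (i : Fin q) (h : k i + l i ≤ (skelOf ξ ω α n).len),
          (R ((skelOf ξ ω α n).sub (k i) (l i) h)).r (w.sub (k i) (l i) h) (w'.sub (k i) (l i) h)
  tendsto_one : Tendsto (fun r => ∫ x, R.determinedFraction μ ξ r x ∂μ) atTop (𝓝 1)

/-- Good systems of fillers, with respect to the lengths sequence `L`. -/
structure IsGoodSOF (μ : Measure (ℤ → A)) (a : A) (ξ : (ℤ → Bool) → (ℤ → ℕ)) (L : ℕ → ℝ)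
    (R : FillerRelations a) : Prop where
  isSOF : IsSOF μ a ξ R
  information_bounds : ∃ k K : ℝ, k ≤ K ∧
    (∃ N : ℕ, ∀ᵐ ω ∂(hatLaw μ a), ∀ (α : ℤ) (n : ℕ), IsSkeleton (ξ ω) α n → N ≤ n →
      ∀ w : Filler a (skelOf ξ ω α n).hatWord,
        information (fillerProb μ a (skelOf ξ ω α n) (R.cls (skelOf ξ ω α n) w)) ≤
          ((n * condEntropy μ a - Lam k (1 / 2) n : ℝ) : EReal)) ∧
    OneSubDelta μ (fun r => {x |
      ((size ξ a r x * condEntropy μ a - Lam K (1 / 2) (size ξ a r x) : ℝ) : EReal) ≤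
        R.randomInformation μ ξ r x}) L

end MarkedState

end

end MarkedProc

/-! The state `a` cuts a sample into blocks. Given the positions of `a`, the blocks are independent,
each following its conditional law given its length (`condProb`), and `cost` is the information of a
block. Suppose a rule reveals some of the blocks of a filler, in such a way that the choice of the
revealed blocks depends only on what is revealed. Then "the same is revealed" is a product event,
and its information is exactly the sum of the revealed costs (`rev_congr`, `information_cls`). It
remains to choose the rule.

The rule `rev` has the budget max(0, nh - √n) for a skeleton of length n. It cuts the skeleton at an
inner position of maximal mark, treats both parts, and then scans the whole from left to right,
revealing each hidden block that fits even at the highest cost its length allows (`cap`). A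
sub-skeleton has smaller marks inside than at its ends, so no cut goes through it before it stands
alone; what is revealed in it alone stays revealed in the whole (`flagLE_rev_of_part`), and the
relation refines the product. The budget is superadditive (`budget_add`), so the two parts together
never overspend. This gives condition 1 with k = 0. That condition concerns every word of the filler
space, including null ones, and therefore impossible blocks are identified with possible ones
(`norm`).

For the other bounds let n be the size of S_r. Up to a negligible event every block has length at
most log² n, and the total cost of the blocks is nh up to √n log² n (`exists_good_event`). If a
block is hidden, its cap did not fit, so the revealed cost is within O(log² n) of the budget; if
none is hidden, it is the total cost. Either way K = 2 works. The hidden blocks then cost at most 2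
√n log² n in all. A block determined by its length has cap 0 and always fits; any other costs at
least a constant, by the probability reduction (`exists_le_cost`). So there are O(√n log² n) hidden
blocks, covering O(√n log⁴ n) coordinates, and δ = 5 works (`information_and_fraction`).

The probabilistic input is an exponential Chebyshev bound for sums over blocks, with parameter of
order 1/√n (`exists_deviation_bound`); it rests on the exponential tail of block lengths. The same
bound identifies h with the mean cost of a block divided by the mean distance of successive
occurrences of `a` (`condEntropy_eq`). -/

set_option linter.unusedSectionVars false

namespace MarkedProc

noncomputable section

/-! ### The revelation rule on lists of marked blocks -/

section Lists

variable {A : Type*}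

/-- What is known of an item (a mark and a block): everything if it is revealed, and otherwise
only its mark and its length. -/
def view : Bool → ℕ × List A → (ℕ × List A) ⊕ (ℕ × ℕ)
  | true, i => .inl i
  | false, i => .inr (i.1, i.2.length)

/-- What is known of a list of items, given the list of revelation flags. -/
def mask (fl : List Bool) (l : List (ℕ × List A)) : List ((ℕ × List A) ⊕ (ℕ × ℕ)) :=
  List.zipWith view fl l

/-- The mark and the length of an item. -/
def shape (i : ℕ × List A) : ℕ × ℕ := (i.1, i.2.length)

/-- The total cost of the revealed items. -/
def total (cost : List A → ℝ) (fl : List Bool) (l : List (ℕ × List A)) : ℝ :=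
  (List.zipWith (fun f i => if f = true then cost i.2 else 0) fl l).sum

/-- The number of coordinates that a list of items covers. -/
def weight (l : List (ℕ × List A)) : ℕ := (l.map fun i => i.2.length + 1).sum

/-- The pointwise order of flags. -/
abbrev FlagLE : List Bool → List Bool → Prop := List.Forall₂ fun f g => f = true → g = true

/-- Reveal, from left to right, every item that certainly fits into the budget `T`. -/
def greedy (cost : List A → ℝ) (cap : ℕ → ℝ) (T : ℝ) :
    ℝ → List Bool → List (ℕ × List A) → List Bool
  | _, [], _ => []
  | _, _, [] => []
  | c, true :: fl, _ :: l => true :: greedy cost cap T c fl l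
  | c, false :: fl, i :: l =>
    if c + cap i.2.length ≤ T then true :: greedy cost cap T (c + cost i.2) fl l
    else false :: greedy cost cap T c fl l

/-- The index `j` is an inner position with maximal positive mark. -/
def IsCut (ms : List ℕ) (j : ℕ) : Prop :=
  0 < j ∧ 0 < ms.getD j 0 ∧ ∀ i, 0 < i → ms.getD i 0 ≤ ms.getD j 0

lemma IsCut.lt_length {ms : List ℕ} {j : ℕ} (h : IsCut ms j) : j < ms.length := by
  by_contra! hj
  have := h.2.1
  rw [List.getD_eq_default _ _ hj] at this
  exact lt_irrefl _ this

/-- An inner position of a list of items with maximal positive mark, if there is one. -/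
def cut (l : List (ℕ × List A)) : ℕ := Classical.epsilon (IsCut (l.map Prod.fst))

/-- The list of items has an inner position with a positive mark. -/
def HasCut (l : List (ℕ × List A)) : Prop := IsCut (l.map Prod.fst) (cut l)

open Classical in
/-- The revelation flags of a list of items: cut at an inner position of maximal mark, reveal in
both parts, and then reveal greedily what fits into the budget `F (weight l)`. -/
def rev (cost : List A → ℝ) (cap F : ℕ → ℝ) (l : List (ℕ × List A)) : List Bool :=
  if h : HasCut l then
    greedy cost cap (F (weight l))
      (total cost (rev cost cap F (l.take (cut l)) ++
        rev cost cap F (l.drop (cut l))) l)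
      (rev cost cap F (l.take (cut l)) ++
        rev cost cap F (l.drop (cut l))) l
  else greedy cost cap (F (weight l)) 0 (List.replicate l.length false) l
termination_by l.length
decreasing_by
  all_goals
    have h1 := IsCut.lt_length h
    have h2 := h.1
    simp only [List.length_map] at h1
    simp only [List.length_take, List.length_drop]
    omega

variable {cost : List A → ℝ} {cap F : ℕ → ℝ}

lemma length_greedy (T c : ℝ) (fl : List Bool) (l : List (ℕ × List A))
    (h : fl.length = l.length) : (greedy cost cap T c fl l).length = l.length := by
  induction l generalizing c fl with
  | nil => cases fl <;> simp_all [greedy]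
  | cons i l ih =>
    rcases fl with _ | ⟨_ | _, fl⟩
    · simp at h
    · simp only [List.length_cons, Nat.add_right_cancel_iff] at h
      rw [greedy]
      split_ifs <;> simp [ih _ _ h]
    · simp only [List.length_cons, Nat.add_right_cancel_iff] at h
      simp [greedy, ih _ _ h]

lemma flagLE_greedy (T c : ℝ) (fl : List Bool) (l : List (ℕ × List A))
    (h : fl.length = l.length) : FlagLE fl (greedy cost cap T c fl l) := by
  induction l generalizing c fl with
  | nil => cases fl <;> simp_all [greedy]
  | cons i l ih =>
    rcases fl with _ | ⟨_ | _, fl⟩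
    · simp at h
    · simp only [List.length_cons, Nat.add_right_cancel_iff] at h
      rw [greedy]
      split_ifs <;> simp [ih _ _ h]
    · simp only [List.length_cons, Nat.add_right_cancel_iff] at h
      simp [greedy, ih _ _ h]

lemma length_rev (l : List (ℕ × List A)) : (rev cost cap F l).length = l.length := by
  induction hn : l.length using Nat.strong_induction_on generalizing l with
  | _ n ih =>
    subst hn
    rw [rev.eq_def]
    split_ifs with h
    · have h1 := IsCut.lt_length h
      have h2 := h.1
      simp only [List.length_map] at h1
      apply length_greedy
      rw [List.length_append, ih _ _ _ rfl, ih _ _ _ rfl] <;>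
        simp only [List.length_take, List.length_drop] <;> omega
    · exact length_greedy _ _ _ _ (by simp)

/-- A revealed item shows its mark and length too, so the view through fewer flags is a function of
the view through more flags. -/
lemma mask_mono {fl fl' : List Bool} (h : FlagLE fl fl') {l l' : List (ℕ × List A)}
    (hm : mask fl' l = mask fl' l') : mask fl l = mask fl l' := by
  induction h generalizing l l' with
  | nil => simp [mask]
  | @cons f f' fl fl' hf _ ih =>
    rcases l with _ | ⟨i, l⟩ <;> rcases l' with _ | ⟨i', l'⟩
    · rfl
    · simp [mask] at hm
    · simp [mask] at hm
    · simp only [mask, List.zipWith_cons_cons, List.cons.injEq] at hm ih ⊢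
      refine ⟨?_, ih hm.2⟩
      rcases f with _ | _ <;> rcases f' with _ | _ <;> simp_all [view]

lemma mask_append {fl fl' : List Bool} {l l' : List (ℕ × List A)} (h : fl.length = l.length) :
    mask (fl ++ fl') (l ++ l') = mask fl l ++ mask fl' l' :=
  List.zipWith_append h

lemma total_append {fl fl' : List Bool} {l l' : List (ℕ × List A)} (h : fl.length = l.length) :
    total cost (fl ++ fl') (l ++ l') = total cost fl l + total cost fl' l' := by
  rw [total, List.zipWith_append h, List.sum_append]; rfl

lemma total_congr {fl : List Bool} {l l' : List (ℕ × List A)}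
    (h : mask fl l = mask fl l') : total cost fl l = total cost fl l' := by
  induction fl generalizing l l' with
  | nil => simp [total]
  | cons f fl ih =>
    rcases l with _ | ⟨i, l⟩ <;> rcases l' with _ | ⟨i', l'⟩
    · rfl
    · simp [mask] at h
    · simp [mask] at h
    · simp only [mask, List.zipWith_cons_cons, List.cons.injEq] at h ih
      have := ih h.2
      simp only [total, List.zipWith_cons_cons, List.sum_cons] at this ⊢
      rw [this]
      rcases f with _ | _ <;> simp_all [view]

lemma shape_eq_of_mask {fl : List Bool} {l l' : List (ℕ × List A)} (hl : fl.length = l.length)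
    (hl' : fl.length = l'.length) (h : mask fl l = mask fl l') : l.map shape = l'.map shape := by
  induction fl generalizing l l' with
  | nil => rw [List.length_eq_zero_iff.1 hl.symm, List.length_eq_zero_iff.1 hl'.symm]
  | cons f fl ih =>
    rcases l with _ | ⟨i, l⟩
    · simp at hl
    rcases l' with _ | ⟨i', l'⟩
    · simp at hl'
    · simp only [mask, List.zipWith_cons_cons, List.cons.injEq, List.length_cons,
        Nat.add_right_cancel_iff] at h ih hl hl'
      simp only [List.map_cons, ih hl hl' h.2, List.cons.injEq, and_true]
      rcases f with _ | _
      · simpa [view, shape] using h.1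
      · have h1 : i = i' := by simpa [view] using h.1
        rw [h1]

/-- The two summands in the codomain of `view` record the flag, so a mask remembers which items were
revealed. -/
lemma flags_eq_of_mask {fl fl' : List Bool} {l l' : List (ℕ × List A)} (hl : fl.length = l.length)
    (hl' : fl'.length = l'.length) (h : mask fl l = mask fl' l') : fl = fl' := by
  induction fl generalizing l l' fl' with
  | nil =>
    have h1 := congrArg List.length h
    simp only [mask, List.length_zipWith, hl'] at h1
    simp only [List.length_nil, zero_le, inf_of_le_left, min_self] at h1
    exact (List.length_eq_zero_iff.1 (hl'.trans h1.symm)).symm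
  | cons f fl ih =>
    rcases l with _ | ⟨i, l⟩
    · simp at hl
    rcases l' with _ | ⟨i', l'⟩ <;> rcases fl' with _ | ⟨f', fl'⟩
    · simp [mask] at h
    · simp at hl'
    · simp at hl'
    · simp only [mask, List.zipWith_cons_cons, List.cons.injEq, List.length_cons,
        Nat.add_right_cancel_iff] at h ih hl hl'
      rw [ih hl hl' h.2]
      rcases f with _ | _ <;> rcases f' with _ | _ <;> simp_all [view]

/-- The scan is a stopping rule: each decision uses only the initial flags, the length of the item,
which every mask shows, and the costs of items already revealed. -/
lemma greedy_congr (T c : ℝ) (fl : List Bool) (l l' : List (ℕ × List A))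
    (hl : fl.length = l.length) (hl' : fl.length = l'.length)
    (h : mask (greedy cost cap T c fl l) l = mask (greedy cost cap T c fl l) l') :
    greedy cost cap T c fl l' = greedy cost cap T c fl l := by
  induction fl generalizing l l' c with
  | nil => simp [greedy]
  | cons f fl ih =>
    rcases l with _ | ⟨i, l⟩
    · simp at hl
    rcases l' with _ | ⟨i', l'⟩
    · simp at hl'
    simp only [List.length_cons, Nat.add_right_cancel_iff] at hl hl'
    rcases f with _ | _
    · have hlen : i.2.length = i'.2.length := by
        have := shape_eq_of_mask (by rw [length_greedy _ _ _ _ (by simpa using hl)])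
          (by rw [length_greedy _ _ _ _ (by simpa using hl)]; simp [← hl, hl']) h
        simp only [List.map_cons, List.cons.injEq, shape, Prod.mk.injEq] at this
        exact this.1.2
      rw [greedy] at h ⊢
      rw [greedy, ← hlen]
      split_ifs at h ⊢ with hc
      · simp only [mask, List.zipWith_cons_cons, List.cons.injEq, view, Sum.inl.injEq] at h
        rw [← h.1, ih _ _ _ hl hl' h.2]
      · simp only [mask, List.zipWith_cons_cons, List.cons.injEq] at h
        rw [ih _ _ _ hl hl' h.2]
    · simp only [greedy, mask, List.zipWith_cons_cons, List.cons.injEq] at h ⊢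
      exact ⟨trivial, ih _ _ _ hl hl' h.2⟩

lemma weight_eq_of_shape {l l' : List (ℕ × List A)} (h : l.map shape = l'.map shape) :
    weight l = weight l' := by
  have := congrArg (fun s => (s.map fun i : ℕ × ℕ => i.2 + 1).sum) h
  simpa [weight, shape, List.map_map, Function.comp_def] using this

/-- The revelation flags form a stopping rule. -/
lemma rev_congr {l l' : List (ℕ × List A)} (hs : l.length = l'.length)
    (h : mask (rev cost cap F l) l = mask (rev cost cap F l) l') :
    rev cost cap F l' = rev cost cap F l := by
  induction hn : l.length using Nat.strong_induction_on generalizing l l' with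
  | _ n ih =>
    subst hn
    -- Marks and lengths are visible in every mask, so the two lists have the same cut and the same
    -- budget.
    have hsh := shape_eq_of_mask (length_rev l) ((length_rev l).trans hs) h
    have hw := weight_eq_of_shape hsh
    have hms : l.map Prod.fst = l'.map Prod.fst := by
      have := congrArg (List.map Prod.fst) hsh
      simpa [shape, List.map_map, Function.comp_def] using this
    have hcut : cut l = cut l' := by rw [cut, cut, hms]
    have hhas : HasCut l ↔ HasCut l' := by rw [HasCut, HasCut, hcut, hms]
    rw [rev.eq_def _ _ _ l] at h ⊢
    rw [rev.eq_def _ _ _ l']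
    split_ifs at h with hc
    · rw [dif_pos hc, dif_pos (hhas.1 hc)]
      simp only [← hcut]
      have h1 := IsCut.lt_length hc
      have h2 := hc.1
      simp only [List.length_map] at h1
      set j := cut l
      set fl := rev cost cap F (l.take j) ++ rev cost cap F (l.drop j) with hfl
      have hlen : fl.length = l.length := by
        rw [hfl, List.length_append, length_rev, length_rev, ← List.length_append,
          List.take_append_drop]
      -- The final flags dominate the flags of the two parts, so the lists also look alike through
      -- the latter. This feeds the induction in each part and makes the initial costs of the final
      -- scan agree.
      have hm := mask_mono (flagLE_greedy _ _ _ _ hlen) h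
      have hm' := hm
      rw [← List.take_append_drop j l, ← List.take_append_drop j l', hfl,
        mask_append (length_rev _), mask_append (by rw [length_rev]; simp [hs])] at hm'
      obtain ⟨ha, hb⟩ := List.append_inj hm' (by simp [mask, length_rev, hs])
      have e1 := ih _ (by simp; omega) (by simp [hs]) ha rfl
      have e2 := ih _ (by simp; omega) (by simp [hs]) hb rfl
      rw [e1, e2, ← hfl, ← total_congr hm, ← hw]
      exact greedy_congr _ _ _ _ _ hlen (hlen.trans hs) h
    · rw [dif_neg hc, dif_neg (mt hhas.2 hc), ← hw, ← hs]
      exact greedy_congr _ _ _ _ _ (by simp) (by simp [hs]) h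

/-- Here c plus the difference of the totals is the running cost at the end of the scan. An item
stays hidden only if its cap overshoots T at that moment, and the running cost can only grow
afterwards. -/
lemma greedy_spec (hcap : ∀ i : ℕ × List A, cost i.2 ≤ cap i.2.length) (h0 : ∀ b, 0 ≤ cost b)
    (T c : ℝ) (fl : List Bool) (l : List (ℕ × List A)) (hl : fl.length = l.length) (hc : c ≤ T) :
    c ≤ c + (total cost (greedy cost cap T c fl l) l - total cost fl l) ∧
    c + (total cost (greedy cost cap T c fl l) l - total cost fl l) ≤ T ∧
    ∀ p ∈ List.zip (greedy cost cap T c fl l) l, p.1 = false →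
      T < c + (total cost (greedy cost cap T c fl l) l - total cost fl l) + cap p.2.2.length := by
  induction fl generalizing l c with
  | nil => simp [greedy, total, hc]
  | cons f fl ih =>
    rcases l with _ | ⟨i, l⟩
    · simp at hl
    simp only [List.length_cons, Nat.add_right_cancel_iff] at hl
    have htc : ∀ f fl, total cost (f :: fl) (i :: l) = (if f = true then cost i.2 else 0)
      + total cost fl l := fun f fl => by simp [total]
    rcases f with _ | _
    · rw [greedy]
      split_ifs with hT
      · obtain ⟨h1, h2, h3⟩ := ih (c + cost i.2) l hl (by linarith [hcap i])
        have := h0 i.2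
        simp only [htc, if_true, Bool.false_eq_true, if_false]
        refine ⟨by linarith, by linarith, ?_⟩
        intro p hp hpf
        rw [List.zip_cons_cons, List.mem_cons] at hp
        rcases hp with rfl | hp
        · simp at hpf
        · linarith [h3 p hp hpf]
      · obtain ⟨h1, h2, h3⟩ := ih c l hl hc
        simp only [htc, Bool.false_eq_true, if_false]
        refine ⟨by linarith, by linarith, ?_⟩
        intro p hp hpf
        rw [List.zip_cons_cons, List.mem_cons] at hp
        rcases hp with rfl | hp
        · push Not at hT
          simp only
          linarith
        · linarith [h3 p hp hpf]
    · obtain ⟨h1, h2, h3⟩ := ih c l hl hc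
      simp only [greedy, htc]
      refine ⟨by linarith, by linarith, ?_⟩
      intro p hp hpf
      rw [List.zip_cons_cons, List.mem_cons] at hp
      rcases hp with rfl | hp
      · simp at hpf
      · linarith [h3 p hp hpf]

lemma total_replicate_false (n : ℕ) (l : List (ℕ × List A)) :
    total cost (List.replicate n false) l = 0 := by
  induction n generalizing l with
  | zero => simp [total]
  | succ n ih =>
    rcases l with _ | ⟨i, l⟩
    · simp [total]
    · have := ih l
      simp only [total] at this
      simp [total, List.replicate_succ, this]

lemma weight_append (l l' : List (ℕ × List A)) : weight (l ++ l') = weight l + weight l' := by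
  simp [weight]

/-- The revealed cost is within the budget, and no hidden item certainly fits. -/
lemma rev_spec (hcap : ∀ i : ℕ × List A, cost i.2 ≤ cap i.2.length) (h0 : ∀ b, 0 ≤ cost b)
    (hF : ∀ n, 0 ≤ F n) (hsup : ∀ m n, F m + F n ≤ F (m + n)) (l : List (ℕ × List A)) :
    total cost (rev cost cap F l) l ≤ F (weight l) ∧
    ∀ p ∈ List.zip (rev cost cap F l) l, p.1 = false →
      F (weight l) < total cost (rev cost cap F l) l + cap p.2.2.length := by
  induction hn : l.length using Nat.strong_induction_on generalizing l with
  | _ n ih =>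
    subst hn
    rw [rev.eq_def]
    split_ifs with hc
    · have h1 := IsCut.lt_length hc
      have h2 := hc.1
      simp only [List.length_map] at h1
      set j := cut l
      set fl := rev cost cap F (l.take j) ++ rev cost cap F (l.drop j) with hfl
      have hlen : fl.length = l.length := by
        rw [hfl, List.length_append, length_rev, length_rev, ← List.length_append,
          List.take_append_drop]
      -- By superadditivity of F the costs of the two parts fit into the budget of the whole, so the
      -- final scan starts within its budget.
      have hle : total cost fl l ≤ F (weight l) := by
        have e1 := (ih _ (by simp; omega) (l.take j) rfl).1
        have e2 := (ih _ (by simp; omega) (l.drop j) rfl).1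
        calc total cost fl l = total cost fl (l.take j ++ l.drop j) := by
              rw [List.take_append_drop]
          _ = _ := by rw [hfl, total_append (length_rev _)]
          _ ≤ _ := add_le_add e1 e2
          _ ≤ _ := hsup _ _
          _ = _ := by rw [← weight_append, List.take_append_drop]
      obtain ⟨-, g2, g3⟩ := greedy_spec hcap h0 _ _ fl l hlen hle
      refine ⟨by linarith, fun p hp hf => ?_⟩
      linarith [g3 p hp hf]
    · obtain ⟨-, g2, g3⟩ := greedy_spec hcap h0 (F (weight l)) 0 (List.replicate l.length false) l
        (by simp) (hF _)
      rw [total_replicate_false] at g2 g3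
      refine ⟨by linarith, fun p hp hf => ?_⟩
      linarith [g3 p hp hf]

lemma FlagLE.refl (fl : List Bool) : FlagLE fl fl := by
  induction fl <;> simp_all

lemma FlagLE.trans {f g h : List Bool} (h1 : FlagLE f g) (h2 : FlagLE g h) : FlagLE f h := by
  induction h1 generalizing h with
  | nil => exact h2
  | cons hab _ ih =>
    cases h2 with
    | cons hbc h2 => exact .cons (fun h => hbc (hab h)) (ih h2)

lemma flagLE_replicate_false {n : ℕ} {fl : List Bool} (h : fl.length = n) :
    FlagLE (List.replicate n false) fl := by
  subst h
  induction fl <;> simp_all [List.replicate_succ]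

lemma FlagLE.append {f g f' g' : List Bool} (h : FlagLE f g) (h' : FlagLE f' g') :
    FlagLE (f ++ f') (g ++ g') := by
  induction h with
  | nil => exact h'
  | cons hab _ ih => exact .cons hab ih

lemma exists_isCut {ms : List ℕ} {i : ℕ} (hi : 0 < i) (h : 0 < ms.getD i 0) :
    ∃ j, IsCut ms j := by
  have hil : i < ms.length := by
    by_contra! hj
    rw [List.getD_eq_default _ _ hj] at h
    exact lt_irrefl _ h
  obtain ⟨j, hj, hmax⟩ := Finset.exists_max_image (Finset.Ico 1 ms.length) (fun i => ms.getD i 0)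
    ⟨i, by simp; omega⟩
  simp only [Finset.mem_Ico] at hj hmax
  refine ⟨j, by omega, lt_of_lt_of_le h (hmax i (by omega)), fun k hk => ?_⟩
  by_cases hkl : k < ms.length
  · exact hmax k (by omega)
  · rw [List.getD_eq_default _ _ (by omega)]; exact Nat.zero_le _

/-- What is revealed in a part that is bounded by large marks is revealed in the whole. -/
lemma flagLE_rev_of_part (l : List (ℕ × List A)) (p s r : ℕ) (hps : p + s ≤ l.length) (hs : 0 < s)
    (hr : 0 < r)
    (hin : ∀ i, p < i → i < p + s → (l.map Prod.fst).getD i 0 < r)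
    (hp : 0 < p → r ≤ (l.map Prod.fst).getD p 0)
    (he : p + s < l.length → r ≤ (l.map Prod.fst).getD (p + s) 0) :
    FlagLE (List.replicate p false ++ (rev cost cap F ((l.drop p).take s) ++
      List.replicate (l.length - p - s) false)) (rev cost cap F l) := by
  induction hn : l.length using Nat.strong_induction_on generalizing l p with
  | _ n ih =>
    subst hn
    by_cases hw : p = 0 ∧ s = l.length
    · obtain ⟨rfl, rfl⟩ := hw
      simp only [List.replicate_zero, List.drop_zero, List.take_length, List.nil_append, Nat.sub_zero,
        Nat.sub_self, List.append_nil]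
      exact FlagLE.refl _
    -- A proper part has one of its ends at an inner position, where the mark is at least r. So a
    -- cut exists, and its maximal mark is at least r.
    · obtain ⟨i, hi, hri⟩ : ∃ i, 0 < i ∧ r ≤ (l.map Prod.fst).getD i 0 := by
        by_cases h0 : 0 < p
        · exact ⟨p, h0, hp h0⟩
        · exact ⟨p + s, by omega, he (by omega)⟩
      have hc := Classical.epsilon_spec (exists_isCut hi (lt_of_lt_of_le hr hri))
      change HasCut l at hc
      rw [rev.eq_def cost cap F l, dif_pos hc]
      have hcut := hc
      have h1 := IsCut.lt_length hcut
      have h2 := hcut.1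
      simp only [List.length_map] at h1
      set j := cut l
      have hrj : r ≤ (l.map Prod.fst).getD j 0 := hri.trans (hcut.2.2 i hi)
      have hlen : (rev cost cap F (l.take j) ++ rev cost cap F (l.drop j)).length = l.length := by
        rw [List.length_append, length_rev, length_rev, ← List.length_append,
          List.take_append_drop]
      refine FlagLE.trans ?_ (flagLE_greedy _ _ _ _ hlen)
      have hgd : ∀ k, ((l.drop j).map Prod.fst).getD k 0 = (l.map Prod.fst).getD (j + k) 0 := by
        intro k; simp [List.getD_eq_getElem?_getD, List.getElem?_drop]
      have hgt : ∀ k, k < j → ((l.take j).map Prod.fst).getD k 0 = (l.map Prod.fst).getD k 0 := by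
        intro k hk; simp [List.getD_eq_getElem?_getD, hk]
      -- Marks strictly inside the part are below r, so the cut does not fall there: the part lies
      -- in one half, to which the induction applies, and in the other half nothing is claimed to be
      -- revealed.
      by_cases hjp : j ≤ p
      · have := ih (l.drop j).length (by simp; omega) (l.drop j) (p - j) (by simp; omega)
          (fun i hi hi' => by rw [hgd]; exact hin _ (by omega) (by omega))
          (fun h => by rw [hgd]; convert hp (by omega) using 2; omega)
          (fun h => by
            rw [hgd]; convert he (by simp at h; omega) using 2; omega) rfl
        rw [List.drop_drop, show j + (p - j) = p by omega, List.length_drop,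
          show l.length - j - (p - j) - s = l.length - p - s by omega] at this
        have e : List.replicate p false = List.replicate j false ++ List.replicate (p - j) false := by
          rw [← List.replicate_add]; congr 1; omega
        rw [e, List.append_assoc]
        exact FlagLE.append (flagLE_replicate_false (by rw [length_rev]; simp; omega)) this
      · by_cases hjs : p + s ≤ j
        · have := ih (l.take j).length (by simp; omega) (l.take j) p (by simp; omega)
            (fun i hi hi' => by rw [hgt _ (by omega)]; exact hin _ (by omega) (by omega))
            (fun h => by rw [hgt _ (by omega)]; exact hp h)
            (fun h => by
              simp at h
              rw [hgt _ (by omega)]; exact he (by omega)) rfl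
          rw [List.drop_take, List.take_take, min_eq_left (by omega), List.length_take,
            min_eq_left h1.le] at this
          have e : List.replicate (l.length - p - s) false = List.replicate (j - p - s) false ++
              List.replicate (l.length - j) false := by
            rw [← List.replicate_add]; congr 1; omega
          rw [e, ← List.append_assoc (rev _ _ _ _), ← List.append_assoc]
          exact FlagLE.append this (flagLE_replicate_false (by rw [length_rev]; simp))
        · exact absurd (hin j (by omega) (by omega)) (by omega)

end Lists

/-! ### Division of marked words into items -/

section Parsing

variable {A : Type*} [DecidableEq A] (a : A)

/-- One step (from the right) of the division of a marked word into items. -/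
def parseStep (p : A × ℕ) (s : List A × List (ℕ × List A)) : List A × List (ℕ × List A) :=
  if p.1 = a then ([], (p.2, s.1) :: s.2) else (p.1 :: s.1, s.2)

/-- The items of a marked word: for each occurrence of `a`, its mark and the block that follows. -/
def parse (l : List (A × ℕ)) : List (ℕ × List A) := (l.foldr (parseStep a) ([], [])).2

/-- One step (from the right) of the division of a word into blocks. -/
def blockStep (c : A) (s : List A × List (List A)) : List A × List (List A) :=
  if c = a then ([], s.1 :: s.2) else (c :: s.1, s.2)

/-- The part of a word before the first occurrence of `a`. -/
def initial (l : List A) : List A := (l.foldr (blockStep a) ([], [])).1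

/-- The blocks between the occurrences of `a` in a word. -/
def blocks (l : List A) : List (List A) := (l.foldr (blockStep a) ([], [])).2

@[simp] lemma blocks_nil : blocks a [] = [] := rfl

@[simp] lemma initial_nil : initial a [] = [] := rfl

lemma blocks_cons_self (l : List A) : blocks a (a :: l) = initial a l :: blocks a l := by
  simp [blocks, initial, blockStep]

lemma initial_cons_self (l : List A) : initial a (a :: l) = [] := by
  simp [initial, blockStep]

lemma blocks_cons_of_ne {c : A} (h : c ≠ a) (l : List A) : blocks a (c :: l) = blocks a l := by
  simp [blocks, blockStep, h]

lemma initial_cons_of_ne {c : A} (h : c ≠ a) (l : List A) :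
    initial a (c :: l) = c :: initial a l := by
  simp [initial, blockStep, h]

lemma initial_append_flatMap_blocks (l : List A) :
    initial a l ++ (blocks a l).flatMap (a :: ·) = l := by
  induction l with
  | nil => rfl
  | cons c l ih =>
    by_cases h : c = a
    · subst h
      rw [blocks_cons_self, initial_cons_self, List.flatMap_cons, List.nil_append, List.cons_append,
        ih]
    · rw [blocks_cons_of_ne a h, initial_cons_of_ne a h, List.cons_append, ih]

lemma notMem_initial (l : List A) : a ∉ initial a l := by
  induction l with
  | nil => simp
  | cons c l ih =>
    by_cases h : c = a
    · subst h; simp [initial_cons_self]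
    · simp [initial_cons_of_ne a h, ih, Ne.symm h]

lemma notMem_of_mem_blocks {l : List A} {b : List A} (h : b ∈ blocks a l) : a ∉ b := by
  induction l with
  | nil => simp at h
  | cons c l ih =>
    by_cases hc : c = a
    · subst hc
      rw [blocks_cons_self, List.mem_cons] at h
      rcases h with rfl | h
      · exact notMem_initial _ _
      · exact ih h
    · rw [blocks_cons_of_ne a hc] at h
      exact ih h

lemma initial_append {b : List A} (hb : a ∉ b) (l : List A) :
    initial a (b ++ l) = b ++ initial a l := by
  induction b with
  | nil => rfl
  | cons c b ih =>
    simp only [List.mem_cons, not_or] at hb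
    rw [List.cons_append, initial_cons_of_ne a (Ne.symm hb.1), ih hb.2, List.cons_append]

lemma blocks_append_of_notMem {b : List A} (hb : a ∉ b) (l : List A) :
    blocks a (b ++ l) = blocks a l := by
  induction b with
  | nil => rfl
  | cons c b ih =>
    simp only [List.mem_cons, not_or] at hb
    rw [List.cons_append, blocks_cons_of_ne a (Ne.symm hb.1), ih hb.2]

/-- The word is empty or begins with `a`. -/
def Starts (l : List A) : Prop := initial a l = []

lemma starts_cons (l : List A) : Starts a (a :: l) := initial_cons_self a l

lemma starts_nil : Starts a [] := rfl

lemma blocks_cons_append {b : List A} (hb : a ∉ b) {l : List A} (hl : Starts a l) :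
    blocks a (a :: b ++ l) = b :: blocks a l := by
  rw [List.cons_append, blocks_cons_self, initial_append a hb, blocks_append_of_notMem a hb, hl,
    List.append_nil]

lemma parse_eq (l : List (A × ℕ)) :
    (parse a l).map Prod.snd = blocks a (l.map Prod.fst) ∧
      (l.foldr (parseStep a) ([], [])).1 = initial a (l.map Prod.fst) := by
  induction l with
  | nil => exact ⟨rfl, rfl⟩
  | cons p l ih =>
    simp only [parse] at ih
    by_cases h : p.1 = a
    · simp [parse, parseStep, h, blocks_cons_self, initial_cons_self, ih]
    · simp [parse, parseStep, h, blocks_cons_of_ne a h, initial_cons_of_ne a h, ih]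

lemma parse_cons_self (m : ℕ) (l : List (A × ℕ)) :
    parse a ((a, m) :: l) = (m, initial a (l.map Prod.fst)) :: parse a l := by
  rw [← (parse_eq a l).2]
  simp [parse, parseStep]

/-- The right fold carries the unfinished block to the left; at the junction it is empty because `v`
is empty or begins with `a`. -/
lemma parse_append {v : List (A × ℕ)} (hv : Starts a (v.map Prod.fst)) (u : List (A × ℕ)) :
    parse a (u ++ v) = parse a u ++ parse a v := by
  suffices h : (u ++ v).foldr (parseStep a) ([], []) =
      ((u.foldr (parseStep a) ([], [])).1, parse a u ++ parse a v) by
    rw [parse, h]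
  induction u with
  | nil =>
    rw [List.nil_append]
    refine Prod.ext ?_ rfl
    rw [(parse_eq a v).2, hv]
    rfl
  | cons p u ih =>
    rw [List.cons_append, List.foldr_cons, ih, List.foldr_cons]
    by_cases h : p.1 = a <;> simp [parse, parseStep, h]

lemma mem_marks_of_mem_parse {l : List (A × ℕ)} {i : ℕ × List A} (h : i ∈ parse a l) :
    ∃ p ∈ l, p.2 = i.1 := by
  induction l with
  | nil => simp [parse] at h
  | cons p l ih =>
    by_cases hp : p.1 = a
    · obtain ⟨c, m⟩ := p
      simp only at hp
      subst hp
      rw [parse_cons_self, List.mem_cons] at h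
      rcases h with rfl | h
      · exact ⟨_, List.mem_cons_self, rfl⟩
      · obtain ⟨p, hp, he⟩ := ih h
        exact ⟨p, List.mem_cons_of_mem _ hp, he⟩
    · have : parse a (p :: l) = parse a l := by simp [parse, parseStep, hp]
      rw [this] at h
      obtain ⟨p, hp, he⟩ := ih h
      exact ⟨p, List.mem_cons_of_mem _ hp, he⟩

/-- The hypothesis is the relation between two fillers of one skeleton: same occurrences of `a`,
same marks. The length of the initial part is included to carry the induction. -/
lemma shape_parse_congr {l l' : List (A × ℕ)}
    (h : List.Forall₂ (fun p q => (p.1 = a ↔ q.1 = a) ∧ p.2 = q.2) l l') :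
    (parse a l).map shape = (parse a l').map shape ∧
      (initial a (l.map Prod.fst)).length = (initial a (l'.map Prod.fst)).length := by
  induction h with
  | nil => exact ⟨rfl, rfl⟩
  | @cons p q l l' hpq _ ih =>
    rw [← (parse_eq a l).2, ← (parse_eq a l').2, parse, parse] at ih
    rw [← (parse_eq a _).2, ← (parse_eq a _).2, parse, parse]
    by_cases hp : p.1 = a
    · simp [parseStep, hp, hpq.1.1 hp, hpq.2, ih, shape]
    · simp [parseStep, hp, mt hpq.1.2 hp, ih]

lemma weight_parse (l : List (A × ℕ)) (hl : Starts a (l.map Prod.fst)) :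
    weight (parse a l) = l.length := by
  have h1 := congrArg List.length (initial_append_flatMap_blocks a (l.map Prod.fst))
  rw [hl, List.nil_append, ← (parse_eq a l).1, List.length_map] at h1
  rw [← h1, weight, List.length_flatMap]
  simp [List.map_map, Function.comp_def]

/-- The items of a marked word, with each block replaced by `norm` of it. -/
def items (norm : List A → List A) (l : List (A × ℕ)) : List (ℕ × List A) :=
  (parse a l).map fun i => (i.1, norm i.2)

variable {a} {norm : List A → List A}

lemma items_append {v : List (A × ℕ)} (hv : Starts a (v.map Prod.fst)) (u : List (A × ℕ)) :
    items a norm (u ++ v) = items a norm u ++ items a norm v := by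
  simp [items, parse_append a hv]

lemma map_fst_items (l : List (A × ℕ)) :
    (items a norm l).map Prod.fst = (parse a l).map Prod.fst := by
  simp [items, List.map_map, Function.comp_def]

lemma map_snd_items (l : List (A × ℕ)) :
    (items a norm l).map Prod.snd = (blocks a (l.map Prod.fst)).map norm := by
  simp [items, ← (parse_eq a l).1, List.map_map, Function.comp_def]

lemma map_shape_items (hn : ∀ b, (norm b).length = b.length) (l : List (A × ℕ)) :
    (items a norm l).map shape = (parse a l).map shape := by
  simp [items, List.map_map, Function.comp_def, shape, hn]

lemma weight_items (hn : ∀ b, (norm b).length = b.length) (l : List (A × ℕ))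
    (hl : Starts a (l.map Prod.fst)) : weight (items a norm l) = l.length := by
  rw [weight_eq_of_shape (l' := parse a l) (map_shape_items hn l), weight_parse a l hl]

lemma shape_items_congr (hn : ∀ b, (norm b).length = b.length) {l l' : List (A × ℕ)}
    (h : List.Forall₂ (fun p q => (p.1 = a ↔ q.1 = a) ∧ p.2 = q.2) l l') :
    (items a norm l).map shape = (items a norm l').map shape := by
  rw [map_shape_items hn, map_shape_items hn, (shape_parse_congr a h).1]

variable (a norm) in
/-- What is revealed of a marked word. -/
def revealed (cost : List A → ℝ) (cap F : ℕ → ℝ) (l : List (A × ℕ)) :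
    List ((ℕ × List A) ⊕ (ℕ × ℕ)) :=
  mask (rev cost cap F (items a norm l)) (items a norm l)

variable {cost : List A → ℝ} {cap F : ℕ → ℝ}

/-- By the stopping property the flags of `l` may be fixed in advance. This turns an equivalence
class into a separate condition on each block, that is, into a product event. -/
lemma revealed_eq_iff {l l' : List (A × ℕ)}
    (hlen : (items a norm l).length = (items a norm l').length) :
    revealed a norm cost cap F l = revealed a norm cost cap F l' ↔
      mask (rev cost cap F (items a norm l)) (items a norm l) =
        mask (rev cost cap F (items a norm l)) (items a norm l') := by
  constructor
  · intro h
    have := flags_eq_of_mask (length_rev _) (length_rev _) h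
    rw [revealed, revealed, ← this] at h
    exact h
  · intro h
    rw [revealed, revealed, rev_congr hlen h, h]

/-- If the same is revealed of two words, then the same is revealed of their parts that are
bounded by large marks. -/
lemma revealed_part {u u' v v' z z' : List (A × ℕ)} (r : ℕ) (hr : 0 < r)
    (hn : ∀ b, (norm b).length = b.length)
    (hu : List.Forall₂ (fun p q => (p.1 = a ↔ q.1 = a) ∧ p.2 = q.2) u u')
    (hv : List.Forall₂ (fun p q => (p.1 = a ↔ q.1 = a) ∧ p.2 = q.2) v v')
    (hz : List.Forall₂ (fun p q => (p.1 = a ↔ q.1 = a) ∧ p.2 = q.2) z z')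
    (hv0 : ∃ m t, v = (a, m) :: t ∧ (u ≠ [] → r ≤ m) ∧ ∀ p ∈ t, p.2 < r)
    (hz0 : z = [] ∨ ∃ m t, z = (a, m) :: t ∧ r ≤ m)
    (h : revealed a norm cost cap F (u ++ (v ++ z)) =
      revealed a norm cost cap F (u' ++ (v' ++ z'))) :
    revealed a norm cost cap F v = revealed a norm cost cap F v' := by
  have hstart : ∀ {l l' : List (A × ℕ)},
      List.Forall₂ (fun p q => (p.1 = a ↔ q.1 = a) ∧ p.2 = q.2) l l' →
      Starts a (l.map Prod.fst) → Starts a (l'.map Prod.fst) := by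
    intro l l' hl h
    have := (shape_parse_congr a hl).2
    rw [h] at this
    exact List.length_eq_zero_iff.1 this.symm
  obtain ⟨m, t, rfl, hm, ht⟩ := hv0
  have sz : Starts a (z.map Prod.fst) := by
    rcases hz0 with rfl | ⟨m', t', rfl, -⟩
    · exact starts_nil a
    · exact starts_cons a _
  have sv : Starts a (((a, m) :: t).map Prod.fst) := starts_cons a _
  have svz : Starts a ((((a, m) :: t) ++ z).map Prod.fst) := starts_cons a _
  have sz' := hstart hz sz
  have svz' : Starts a ((v' ++ z').map Prod.fst) := hstart (List.rel_append hv hz) svz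
  have lu : (items a norm u).length = (items a norm u').length := by
    simpa using congrArg List.length (shape_items_congr hn hu)
  have lv : (items a norm ((a, m) :: t)).length = (items a norm v').length := by
    simpa using congrArg List.length (shape_items_congr hn hv)
  have lz : (items a norm z).length = (items a norm z').length := by
    simpa using congrArg List.length (shape_items_congr hn hz)
  have e := items_append (norm := norm) svz u
  rw [items_append (norm := norm) sz] at e
  have e' := items_append (norm := norm) svz' u'
  rw [items_append (norm := norm) sz'] at e'
  rw [revealed_eq_iff (by rw [e, e']; simp [lu, lv, lz]), e, e'] at h
  have hpos : 0 < (items a norm ((a, m) :: t)).length := by simp [items, parse_cons_self]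
  -- The flags that the part receives on its own, padded by `false`, are dominated by those of the
  -- whole word. Equality of the masks of the whole words then descends to the padded flags, and
  -- cutting out the middle gives the claim.
  have hle := flagLE_rev_of_part (cost := cost) (cap := cap) (F := F)
    (items a norm u ++ (items a norm ((a, m) :: t) ++ items a norm z))
    (items a norm u).length (items a norm ((a, m) :: t)).length r (by simp) hpos hr
    (by
      intro i hi hi'
      rw [List.map_append, List.map_append, List.getD_append_right _ _ _ _ (by simp; omega),
        List.getD_append _ _ _ _ (by simp; omega), List.length_map, map_fst_items]
      obtain ⟨k, hk⟩ : ∃ k, i - (items a norm u).length = k + 1 :=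
        ⟨i - (items a norm u).length - 1, by omega⟩
      rw [hk, parse_cons_self, List.map_cons, List.getD_cons_succ]
      by_cases hkl : k < ((parse a t).map Prod.fst).length
      · rw [List.getD_eq_getElem _ _ hkl]
        have hmem := List.getElem_mem hkl
        rw [List.mem_map] at hmem
        obtain ⟨it, hit, he⟩ := hmem
        rw [← he]
        obtain ⟨p, hp, hpe⟩ := mem_marks_of_mem_parse a hit
        rw [← hpe]
        exact ht p hp
      · rw [List.getD_eq_default _ _ (by omega)]
        exact hr)
    (by
      intro hp
      rw [List.map_append, List.map_append, List.getD_append_right _ _ _ _ (by simp),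
        List.getD_append _ _ _ _ (by simpa using hpos), List.length_map, map_fst_items,
        parse_cons_self]
      simp only [Nat.sub_self, List.map_cons, List.getD_cons_zero]
      apply hm
      rintro rfl
      simp [items, parse] at hp)
    (by
      intro hp
      rw [List.map_append, List.map_append, List.getD_append_right _ _ _ _ (by simp),
        List.getD_append_right _ _ _ _ (by simp)]
      rcases hz0 with rfl | ⟨m', t', rfl, hm'⟩
      · simp [items, parse] at hp
      · rw [map_fst_items, map_fst_items, map_fst_items, parse_cons_self a m']
        simpa [items] using hm')
  have h2 := mask_mono hle h
  rw [List.drop_left, List.take_left] at h2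
  rw [mask_append List.length_replicate, mask_append (length_rev _),
    mask_append (List.length_replicate.trans lu), mask_append ((length_rev _).trans lv)] at h2
  have h3 := (List.append_inj h2 (by simp [mask, lu])).2
  have h4 := (List.append_inj h3 (by simp [mask, lv])).1
  rwa [revealed_eq_iff lv]

end Parsing

/-! ### Shifts of stationary processes -/

section Stationary

/-- The shift by `t`. -/
def shiftBy {B : Type*} (t : ℤ) (x : ℤ → B) : ℤ → B := fun n => x (n + t)

variable {B : Type*} [MeasurableSpace B] {ν : Measure (ℤ → B)}

lemma measurable_shiftBy (t : ℤ) : Measurable (shiftBy t : (ℤ → B) → ℤ → B) :=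
  measurable_pi_lambda _ fun n => measurable_pi_apply (n + t)

lemma measurePreserving_shiftBy (h : MeasurePreserving (shift : (ℤ → B) → (ℤ → B)) ν ν) (t : ℤ) :
    MeasurePreserving (shiftBy t) ν ν := by
  have h1 : (shift : (ℤ → B) → (ℤ → B)) = shiftBy 1 := rfl
  have hcomp : ∀ s t : ℤ, (shiftBy s ∘ shiftBy t : (ℤ → B) → ℤ → B) = shiftBy (s + t) := by
    intro s t; funext x n; simp [shiftBy, add_assoc]
  have h0 : (shiftBy 0 : (ℤ → B) → ℤ → B) = id := by funext x n; simp [shiftBy]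
  refine ⟨measurable_shiftBy t, ?_⟩
  induction t using Int.induction_on with
  | zero => rw [h0, Measure.map_id]
  | succ n ih =>
    rw [add_comm, ← hcomp, ← Measure.map_map (measurable_shiftBy _) (measurable_shiftBy _), ih,
      ← h1, h.map_eq]
  | pred n ih =>
    conv_lhs => rw [← h.map_eq]
    rw [h1, Measure.map_map (measurable_shiftBy _) (measurable_shiftBy _), hcomp]
    simpa using ih

/-- If the events `E i` are shifts of each other up to null sets then they are equally likely. -/
lemma measure_eq_of_shift (h : MeasurePreserving (shift : (ℤ → B) → (ℤ → B)) ν ν)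
    {E : ℤ → Set (ℤ → B)} (hE : ∀ i, NullMeasurableSet (E i) ν)
    (hs : ∀ i, E (i + 1) =ᵐ[ν] shift ⁻¹' E i) (i : ℤ) : ν (E i) = ν (E 0) := by
  have hstep : ∀ i, ν (E (i + 1)) = ν (E i) := fun i => by
    rw [measure_congr (hs i), h.measure_preimage (hE i)]
  induction i using Int.induction_on with
  | zero => rfl
  | succ n ih => rw [hstep, ih]
  | pred n ih => rw [← ih, ← hstep]; simp

end Stationary

/-! ### Words in a sample and events on a finite window -/

section Segments

variable {A : Type*}

/-- The word `x_{[α, α + n - 1]}`. -/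
def seg (x : ℤ → A) (α : ℤ) (n : ℕ) : List A := List.ofFn fun j : Fin n => x (α + (j : ℕ))

@[simp] lemma length_seg (x : ℤ → A) (α : ℤ) (n : ℕ) : (seg x α n).length = n := by simp [seg]

@[simp] lemma seg_zero (x : ℤ → A) (α : ℤ) : seg x α 0 = [] := by simp [seg]

lemma seg_succ (x : ℤ → A) (α : ℤ) (n : ℕ) : seg x α (n + 1) = x α :: seg x (α + 1) n := by
  simp only [seg, List.ofFn_succ, Fin.val_zero, Nat.cast_zero, add_zero, Fin.val_succ,
    Nat.cast_add, Nat.cast_one, List.cons.injEq, true_and]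
  congr 1
  funext j
  congr 1
  ring

lemma seg_add (x : ℤ → A) (α : ℤ) (m n : ℕ) : seg x α (m + n) = seg x α m ++ seg x (α + m) n := by
  induction m generalizing α with
  | zero => simp
  | succ m ih =>
    rw [show m + 1 + n = (m + n) + 1 by ring, seg_succ, ih, seg_succ, List.cons_append]
    congr 3
    push_cast
    ring

lemma seg_congr {x y : ℤ → A} {α : ℤ} {n : ℕ} (h : ∀ i, α ≤ i → i < α + n → x i = y i) :
    seg x α n = seg y α n := by
  simp only [seg]
  congr 1
  funext j
  exact h _ (by omega) (by omega)

lemma seg_eq_seg_iff {x y : ℤ → A} {α : ℤ} {n : ℕ} :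
    seg x α n = seg y α n ↔ ∀ i, α ≤ i → i < α + n → x i = y i := by
  refine ⟨fun h i h1 h2 => ?_, seg_congr⟩
  have := congrFun (List.ofFn_injective h) ⟨(i - α).toNat, by omega⟩
  simpa [Int.toNat_of_nonneg (sub_nonneg.2 h1)] using this

lemma mem_seg_iff {x : ℤ → A} {α : ℤ} {n : ℕ} {c : A} :
    c ∈ seg x α n ↔ ∃ i, α ≤ i ∧ i < α + n ∧ x i = c := by
  simp only [seg, List.mem_ofFn]
  constructor
  · rintro ⟨j, rfl⟩
    exact ⟨_, by omega, by omega, rfl⟩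
  · rintro ⟨i, h1, h2, rfl⟩
    exact ⟨⟨(i - α).toNat, by omega⟩, by simp [Int.toNat_of_nonneg (sub_nonneg.2 h1)]⟩

lemma seg_shiftBy (x : ℤ → A) (t α : ℤ) (n : ℕ) : seg (shiftBy t x) α n = seg x (α + t) n := by
  simp only [seg, shiftBy]
  congr 1
  funext j
  congr 1
  ring

/-- `F` depends only on the coordinates in `[s, t]`. -/
def DependsOnIcc (F : Set (ℤ → A)) (s t : ℤ) : Prop :=
  ∀ x y : ℤ → A, (∀ i, s ≤ i → i ≤ t → x i = y i) → x ∈ F → y ∈ F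

end Segments

/-! ### The Markov property for events on finite windows -/

section Markov

variable {A : Type*} [MeasurableSpace A] [MeasurableSingletonClass A]

lemma measurableSet_coord (t : ℤ) (b : A) : MeasurableSet {x : ℤ → A | x t = b} :=
  (measurableSet_singleton b).preimage (measurable_pi_apply t)

lemma measurableSet_seg (α : ℤ) (n : ℕ) (u : List A) :
    MeasurableSet {x : ℤ → A | seg x α n = u} := by
  induction n generalizing α u with
  | zero => simp
  | succ n ih =>
    rcases u with _ | ⟨c, u⟩
    · simp [seg_succ]
    · simp only [seg_succ, List.cons.injEq]
      exact (measurableSet_coord α c).inter (ih (α + 1) u)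

variable [Fintype A] [DecidableEq A] 

/-- The words of length `n`. -/
def words (A : Type*) [Fintype A] [DecidableEq A] (n : ℕ) : Finset (List A) :=
  Finset.univ.image fun w : Fin n → A => List.ofFn w

lemma mem_words {n : ℕ} {u : List A} : u ∈ words A n ↔ u.length = n := by
  simp only [words, Finset.mem_image, Finset.mem_univ, true_and]
  constructor
  · rintro ⟨w, rfl⟩; simp
  · rintro rfl; exact ⟨u.get, List.ofFn_get u⟩

lemma sum_measureReal_seg (μ : Measure (ℤ → A)) [IsFiniteMeasure μ] {E : Set (ℤ → A)}
    (hE : MeasurableSet E) (α : ℤ) (n : ℕ) :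
    μ.real E = ∑ u ∈ words A n, μ.real (E ∩ {x | seg x α n = u}) := by
  rw [← measureReal_biUnion_finset]
  · congr 1
    ext x
    simp [mem_words]
  · intro u _ v _ huv
    refine Set.disjoint_left.2 ?_
    rintro x ⟨-, hx⟩ ⟨-, hx'⟩
    exact huv (hx.symm.trans hx')
  · exact fun u _ => hE.inter (measurableSet_seg _ _ _)

/-- The alphabet is finite, so such an event is a finite union of cylinders. -/
lemma DependsOnIcc.measurableSet {F : Set (ℤ → A)} {s t : ℤ} (hF : DependsOnIcc F s t) :
    MeasurableSet F := by
  have : F = ⋃ u ∈ (words A (t + 1 - s).toNat : Set (List A)) ∩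
      {u | ∃ x ∈ F, seg x s (t + 1 - s).toNat = u},
      {x | seg x s (t + 1 - s).toNat = u} := by
    ext x
    simp only [Set.mem_iUnion, Set.mem_ofPred_eq, exists_prop, Set.mem_inter_iff]
    constructor
    · intro hx
      exact ⟨_, ⟨by simp [mem_words], x, hx, rfl⟩, rfl⟩
    · rintro ⟨u, ⟨-, y, hy, rfl⟩, h⟩
      rw [seg_eq_seg_iff] at h
      exact hF y x (fun i h1 h2 => (h i h1 (by omega)).symm) hy
  rw [this]
  exact MeasurableSet.biUnion (((words A _).finite_toSet.inter_of_left _).countable)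
    fun u _ => measurableSet_seg _ _ _

variable {μ : Measure (ℤ → A)} 

namespace IsAperiodicMarkov

lemma shift_eq (hμ : IsAperiodicMarkov μ) {E : Set (ℤ → A)} (hE : MeasurableSet E) (t : ℤ) :
    μ.real (shiftBy t ⁻¹' E) = μ.real E := by
  rw [Measure.real, (measurePreserving_shiftBy hμ.stationary t).measure_preimage
    hE.nullMeasurableSet, Measure.real]

lemma real_coord (hμ : IsAperiodicMarkov μ) (t : ℤ) (b : A) :
    μ.real {x | x t = b} = μ.real {x | x 0 = b} := by
  rw [← hμ.shift_eq (measurableSet_coord 0 b) t]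
  simp [shiftBy]

lemma pos_coord (hμ : IsAperiodicMarkov μ) (b : A) : 0 < μ.real {x | x 0 = b} := by
  have := hμ.isProbabilityMeasure
  obtain ⟨n, hn⟩ := hμ.irreducible b b
  rw [measureReal_def, ENNReal.toReal_pos_iff]
  exact ⟨hn.trans_le (measure_mono fun x hx => hx.1), measure_lt_top _ _⟩

/-- Induction on k with the one-step property, applied to the long word and to its final part; the
positive probability of the letter `w (p + k)` cancels. -/
lemma real_cyl (hμ : IsAperiodicMarkov μ) (p k : ℕ) (w : ℕ → A) :
    μ.real {x | ∀ i : ℕ, i ≤ p + k → x i = w i} * μ.real {x | x 0 = w p} =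
      μ.real {x | ∀ i : ℕ, i ≤ p → x i = w i} *
        μ.real {x | ∀ i : ℕ, i ≤ k → x i = w (p + i)} := by
  have hmeas : ∀ (k : ℕ) (w : ℕ → A), MeasurableSet {x : ℤ → A | ∀ i : ℕ, i ≤ k → x i = w i} := by
    intro k w
    simp only [Set.ofPred_forall]
    exact .iInter fun i => .iInter fun _ => measurableSet_coord _ _
  have hM : ∀ (n : ℕ) (w : ℕ → A),
      μ.real {x | ∀ i : ℕ, i ≤ n + 1 → x i = w i} * μ.real {x | x 0 = w n} =
      μ.real {x | ∀ i : ℕ, i ≤ n → x i = w i} * μ.real {x | x 0 = w n ∧ x 1 = w (n + 1)} := by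
    intro n w
    have h1 := congrArg ENNReal.toReal (hμ.markov n w)
    rw [ENNReal.toReal_mul, ENNReal.toReal_mul] at h1
    simp only [← measureReal_def] at h1
    rw [hμ.real_coord] at h1
    have h2 := hμ.shift_eq ((measurableSet_coord 0 (w n)).inter
      (measurableSet_coord 1 (w (n + 1)))) n
    have e1 : {x : ℤ → A | x 0 = w n} ∩ {x | x 1 = w (n + 1)} =
      {x | x 0 = w n ∧ x 1 = w (n + 1)} := rfl
    rw [e1] at h2
    rw [h1, ← h2]
    congr 2
    ext x
    simp [shiftBy, add_comm]
  induction k with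
  | zero => simp [mul_comm]
  | succ k ih =>
    have h1 := hM (p + k) w
    have h2 := hM k (fun i => w (p + i))
    simp only [← add_assoc] at h2
    rw [← add_assoc]
    refine mul_right_cancel₀ (hμ.pos_coord (w (p + k))).ne' ?_
    calc _ = (μ.real {x | ∀ i : ℕ, i ≤ p + k + 1 → x i = w i} * μ.real {x | x 0 = w (p + k)}) *
          μ.real {x | x 0 = w p} := by ring
      _ = (μ.real {x | ∀ i : ℕ, i ≤ p + k → x i = w i} * μ.real {x | x 0 = w p}) *
          μ.real {x | x 0 = w (p + k) ∧ x 1 = w (p + k + 1)} := by rw [h1]; ring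
      _ = μ.real {x | ∀ i : ℕ, i ≤ p → x i = w i} * (μ.real {x | ∀ i : ℕ, i ≤ k → x i = w (p + i)} *
          μ.real {x | x 0 = w (p + k) ∧ x 1 = w (p + k + 1)}) := by rw [ih]; ring
      _ = _ := by rw [← h2]; ring

/-- This is `real_cyl` moved to the place t. The two words share the coordinate t, whose probability
is the additional factor on the left. -/
lemma real_seg_inter (hμ : IsAperiodicMarkov μ) (t : ℤ) (p k : ℕ) (z : ℤ → A) :
    μ.real ({x | seg x (t - p) (p + 1) = seg z (t - p) (p + 1)} ∩
        {x | seg x t (k + 1) = seg z t (k + 1)}) * μ.real {x | x 0 = z t} =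
      μ.real {x | seg x (t - p) (p + 1) = seg z (t - p) (p + 1)} *
        μ.real {x | seg x t (k + 1) = seg z t (k + 1)} := by
  have h := hμ.real_cyl p k (fun i => z (t - p + i))
  have hmeas : ∀ (k : ℕ) (w : ℕ → A), MeasurableSet {x : ℤ → A | ∀ i : ℕ, i ≤ k → x i = w i} := by
    intro k w
    simp only [Set.ofPred_forall]
    exact .iInter fun i => .iInter fun _ => measurableSet_coord _ _
  rw [← hμ.shift_eq (hmeas (p + k) _) (t - p), ← hμ.shift_eq (hmeas p _) (t - p),
    ← hμ.shift_eq (hmeas k _) t] at h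
  have e1 : (shiftBy (t - p) ⁻¹' {x : ℤ → A | ∀ i : ℕ, i ≤ p + k → x i = z (t - p + i)}) =
      {x | seg x (t - p) (p + 1) = seg z (t - p) (p + 1)} ∩
        {x | seg x t (k + 1) = seg z t (k + 1)} := by
    ext x
    simp only [Set.mem_preimage, Set.mem_ofPred_eq, shiftBy, Set.mem_inter_iff, seg_eq_seg_iff]
    constructor
    · intro h
      have h' : ∀ i : ℤ, t - p ≤ i → i ≤ t + k → x i = z i := by
        intro i h1 h2
        have := h (i - (t - p)).toNat (by omega)
        rw [Int.toNat_of_nonneg (by omega)] at this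
        convert this using 2 <;> ring
      exact ⟨fun i h1 h2 => h' i h1 (by omega), fun i h1 h2 => h' i (by omega) (by omega)⟩
    · rintro ⟨h1, h2⟩ i hi
      rw [add_comm]
      by_cases hp : i ≤ p
      · exact h1 _ (by omega) (by omega)
      · exact h2 _ (by omega) (by omega)
  have e2 : (shiftBy (t - p) ⁻¹' {x : ℤ → A | ∀ i : ℕ, i ≤ p → x i = z (t - p + i)}) =
      {x | seg x (t - p) (p + 1) = seg z (t - p) (p + 1)} := by
    ext x
    simp only [Set.mem_preimage, Set.mem_ofPred_eq, shiftBy, seg_eq_seg_iff]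
    constructor
    · intro h i h1 h2
      have := h (i - (t - p)).toNat (by omega)
      rw [Int.toNat_of_nonneg (by omega)] at this
      convert this using 2 <;> ring
    · intro h1 i hi
      rw [add_comm]
      exact h1 _ (by omega) (by omega)
  have e3 : (shiftBy t ⁻¹' {x : ℤ → A | ∀ i : ℕ, i ≤ k → x i = z (t - p + (p + i : ℕ))}) =
      {x | seg x t (k + 1) = seg z t (k + 1)} := by
    ext x
    simp only [Set.mem_preimage, Set.mem_ofPred_eq, shiftBy, seg_eq_seg_iff]
    constructor
    · intro h i h1 h2
      have := h (i - t).toNat (by omega)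
      push_cast at this
      rw [Int.toNat_of_nonneg (by omega)] at this
      convert this using 2 <;> ring
    · intro h1 i hi
      have := h1 (t + i) (by omega) (by omega)
      rw [add_comm, this]
      congr 1
      push_cast
      ring
  rw [e1, e2, e3] at h
  simpa using h

/-- The Markov property at the state `b`: past and future are conditionally independent. -/
lemma real_inter (hμ : IsAperiodicMarkov μ) (t : ℤ) (p k : ℕ) (b : A) {F G : Set (ℤ → A)}
    (hF : DependsOnIcc F (t - p) t) (hG : DependsOnIcc G t (t + k)) :
    μ.real (F ∩ {x | x t = b} ∩ G) * μ.real {x | x 0 = b} =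
      μ.real (F ∩ {x | x t = b}) * μ.real ({x | x t = b} ∩ G) := by
  have := hμ.isProbabilityMeasure
  have mF := hF.measurableSet
  have mG := hG.measurableSet
  have mb := measurableSet_coord t b
  rw [sum_measureReal_seg μ (mF.inter mb) (t - p) (p + 1),
    sum_measureReal_seg μ (mb.inter mG) t (k + 1),
    sum_measureReal_seg μ ((mF.inter mb).inter mG) (t - p) (p + 1), Finset.sum_mul_sum,
    Finset.sum_mul]
  refine Finset.sum_congr rfl fun u hu => ?_
  rw [sum_measureReal_seg μ (((mF.inter mb).inter mG).inter (measurableSet_seg _ _ _)) t (k + 1),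
    Finset.sum_mul]
  refine Finset.sum_congr rfl fun v hv => ?_
  -- If the past word is compatible with F and the future word with G, both with `b` at t, pasting
  -- them at t gives a point z for which the identity of words holds. Otherwise both sides vanish.
  by_cases h1 : ∃ x, x ∈ F ∩ {x | x t = b} ∩ {x | seg x (t - p) (p + 1) = u}
  · by_cases h2 : ∃ y, y ∈ {x | x t = b} ∩ G ∩ {x | seg x t (k + 1) = v}
    · obtain ⟨x, ⟨hxF, hxb⟩, rfl⟩ := h1
      obtain ⟨y, ⟨hyb, hyG⟩, rfl⟩ := h2
      simp only [Set.mem_ofPred_eq] at hxb hyb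
      set z : ℤ → A := fun i => if i ≤ t then x i else y i with hz
      have zx : ∀ i, i ≤ t → z i = x i := fun i hi => by simp [hz, hi]
      have zy : ∀ i, t ≤ i → z i = y i := fun i hi => by
        rcases hi.eq_or_lt with rfl | hi
        · simp [hz, hxb, hyb]
        · simp [hz, not_le.2 hi]
      have sx : seg x (t - p) (p + 1) = seg z (t - p) (p + 1) :=
        seg_congr fun i _ h => (zx i (by omega)).symm
      have sy : seg y t (k + 1) = seg z t (k + 1) := seg_congr fun i h _ => (zy i h).symm
      have key := hμ.real_seg_inter t p k z
      rw [← sx, ← sy, zx t le_rfl, hxb] at key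
      have c1 : ∀ x', seg x' (t - p) (p + 1) = seg x (t - p) (p + 1) → x' ∈ F ∧ x' t = b := by
        intro x' h
        rw [seg_eq_seg_iff] at h
        exact ⟨hF x x' (fun i h1 h2 => (h i h1 (by omega)).symm) hxF,
          (h t (by omega) (by omega)).trans hxb⟩
      have c2 : ∀ x', seg x' t (k + 1) = seg y t (k + 1) → x' ∈ G ∧ x' t = b := by
        intro x' h
        rw [seg_eq_seg_iff] at h
        exact ⟨hG y x' (fun i h1 h2 => (h i h1 (by omega)).symm) hyG,
          (h t (by omega) (by omega)).trans hyb⟩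
      convert key using 3
      · ext x'
        simp only [Set.mem_inter_iff, Set.mem_ofPred_eq]
        constructor
        · rintro ⟨⟨-, h⟩, h'⟩; exact ⟨h, h'⟩
        · rintro ⟨h, h'⟩; exact ⟨⟨⟨c1 _ h, (c2 _ h').1⟩, h⟩, h'⟩
      · ext x'
        simp only [Set.mem_inter_iff, Set.mem_ofPred_eq]
        exact ⟨fun h => h.2, fun h => ⟨c1 _ h, h⟩⟩
      · ext x'
        simp only [Set.mem_inter_iff, Set.mem_ofPred_eq]
        exact ⟨fun h => h.2, fun h => ⟨⟨(c2 _ h).2, (c2 _ h).1⟩, h⟩⟩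
    · have e1 : {x | x t = b} ∩ G ∩ {x | seg x t (k + 1) = v} = ∅ :=
        Set.eq_empty_iff_forall_notMem.2 fun x hx => h2 ⟨x, hx⟩
      have e2 : F ∩ {x | x t = b} ∩ G ∩ {x | seg x (t - p) (p + 1) = u} ∩
          {x | seg x t (k + 1) = v} = ∅ :=
        Set.eq_empty_iff_forall_notMem.2 fun x hx => h2 ⟨x, ⟨hx.1.1.1.2, hx.1.1.2⟩, hx.2⟩
      rw [e1, e2]; simp
  · have e1 : F ∩ {x | x t = b} ∩ {x | seg x (t - p) (p + 1) = u} = ∅ :=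
      Set.eq_empty_iff_forall_notMem.2 fun x hx => h1 ⟨x, hx⟩
    have e2 : F ∩ {x | x t = b} ∩ G ∩ {x | seg x (t - p) (p + 1) = u} ∩
        {x | seg x t (k + 1) = v} = ∅ :=
      Set.eq_empty_iff_forall_notMem.2 fun x hx => h1 ⟨x, hx.1.1.1, hx.1.2⟩
    rw [e1, e2]; simp

end IsAperiodicMarkov

end Markov

/-- A contraction by ρ every N steps is a factor ρ^(1/N) per step. Taking the maximum with 1/2 keeps
the ratio positive, and the constant θ^(-N) covers n ≤ N, including n = 0, where no contraction is
assumed. -/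
lemma exists_geometric_bound {e : ℕ → ℝ} {N : ℕ} (hN : 0 < N) {ρ : ℝ} (hρ : ρ < 1)
    (he : ∀ n, e n ≤ 1) (h0 : ∀ n, 0 ≤ e n) (h : ∀ n, 1 ≤ n → e (n + N) ≤ ρ * e n) :
    ∃ C θ : ℝ, 0 < C ∧ 0 < θ ∧ θ < 1 ∧ ∀ n, e n ≤ C * θ ^ n := by
  set ρ' := max ρ (1 / 2) with hρ'
  have hp : 0 < ρ' := lt_of_lt_of_le (by norm_num) (le_max_right _ _)
  have hl : ρ' < 1 := max_lt hρ (by norm_num)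
  set θ := ρ' ^ ((N : ℝ)⁻¹) with hθ
  have hNr : (0 : ℝ) < (N : ℝ)⁻¹ := by positivity
  have hθp : 0 < θ := Real.rpow_pos_of_pos hp _
  have hθl : θ < 1 := Real.rpow_lt_one hp.le hl hNr
  have hθN : θ ^ N = ρ' := Real.rpow_inv_natCast_pow hp.le hN.ne'
  refine ⟨(θ ^ N)⁻¹, θ, by positivity, hθp, hθl, fun n => ?_⟩
  induction n using Nat.strong_induction_on with
  | _ n ih =>
    by_cases hn : n ≤ N
    · refine (he n).trans ?_
      rw [inv_mul_eq_div, one_le_div (by positivity)]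
      exact pow_le_pow_of_le_one hθp.le hθl.le hn
    · obtain ⟨k, rfl⟩ : ∃ k, n = k + N := ⟨n - N, by omega⟩
      calc e (k + N) ≤ ρ * e k := h k (by omega)
        _ ≤ ρ' * e k := mul_le_mul_of_nonneg_right (le_max_left _ _) (h0 k)
        _ ≤ ρ' * ((θ ^ N)⁻¹ * θ ^ k) := mul_le_mul_of_nonneg_left (ih k (by omega)) hp.le
        _ = (θ ^ N)⁻¹ * θ ^ (k + N) := by rw [pow_add, hθN]; ring

/-! ### Exponential tails of gaps and lower bounds for words -/

section Markov

variable {A : Type*} [MeasurableSpace A] [MeasurableSingletonClass A] [Fintype A] [DecidableEq A]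
  {μ : Measure (ℤ → A)} {a : A}

lemma dependsOnIcc_notMem_seg (a : A) (α : ℤ) (n : ℕ) {s t : ℤ} (hs : s ≤ α) (ht : α + n ≤ t + 1) :
    DependsOnIcc {x : ℤ → A | a ∉ seg x α n} s t := by
  intro x y h hx
  simp only [Set.mem_ofPred_eq] at hx ⊢
  rwa [← seg_congr (x := x) fun i h1 h2 => h i (by omega) (by omega)]

namespace IsAperiodicMarkov

lemma real_notMem_seg (hμ : IsAperiodicMarkov μ) (a : A) (α : ℤ) (n : ℕ) :
    μ.real {x | a ∉ seg x α n} = μ.real {x | a ∉ seg x 0 n} := by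
  rw [← hμ.shift_eq (dependsOnIcc_notMem_seg a 0 n le_rfl
    (show (0 : ℤ) + n ≤ n + 1 by omega)).measurableSet α]
  congr 1
  ext x
  simp [seg_shiftBy]

/-- The time without an occurrence of `a` has an exponential tail. -/
lemma exists_tail_bound (hμ : IsAperiodicMarkov μ) (a : A) :
    ∃ C θ : ℝ, 0 < C ∧ 0 < θ ∧ θ < 1 ∧ ∀ (α : ℤ) (n : ℕ), μ.real {x | a ∉ seg x α n} ≤ C * θ ^ n := by
  have := hμ.isProbabilityMeasure
  choose k hk using fun b => hμ.irreducible b a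
  set N := Finset.univ.sup k + 1 with hN
  have hkN : ∀ b, k b < N := fun b => Nat.lt_succ_of_le (Finset.le_sup (Finset.mem_univ b))
  set ε : A → ℝ := fun b => μ.real {x | x 0 = b ∧ x (k b) = a} / μ.real {x | x 0 = b} with hε
  have hε0 : ∀ b, 0 < ε b := fun b => div_pos (by
    rw [measureReal_def, ENNReal.toReal_pos_iff]
    exact ⟨hk b, measure_lt_top _ _⟩) (hμ.pos_coord b)
  obtain ⟨b₀, -, hb₀⟩ := Finset.exists_min_image Finset.univ ε ⟨a, Finset.mem_univ a⟩
  -- From the state b at the last coordinate of an `a`-free word, `a` is reached after `k b` < N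
  -- steps with probability `ε b` ≥ `ε b₀`. The condition n ≥ 1 guarantees that there is a last
  -- coordinate.
  suffices h : ∀ n, 1 ≤ n → μ.real {x | a ∉ seg x 0 (n + N)} ≤
      (1 - ε b₀) * μ.real {x | a ∉ seg x 0 n} by
    obtain ⟨C, θ, h1, h2, h3, h4⟩ := exists_geometric_bound
      (e := fun n => μ.real {x | a ∉ seg x 0 n}) (N := N) (by omega)
      (sub_lt_self _ (hε0 b₀)) (fun n => measureReal_le_one) (fun n => measureReal_nonneg) h
    exact ⟨C, θ, h1, h2, h3, fun α n => by rw [hμ.real_notMem_seg]; exact h4 n⟩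
  intro n hn
  obtain ⟨p, rfl⟩ : ∃ p, n = p + 1 := ⟨n - 1, by omega⟩
  have hsum : ∀ E : Set (ℤ → A), MeasurableSet E →
      μ.real E = ∑ b, μ.real (E ∩ {x | x p = b}) := by
    intro E hE
    rw [← measureReal_biUnion_finset]
    · congr 1; ext x; simp
    · intro u _ v _ huv
      refine Set.disjoint_left.2 ?_
      rintro x ⟨-, hx⟩ ⟨-, hx'⟩
      exact huv (hx.symm.trans hx')
    · exact fun u _ => hE.inter (measurableSet_coord _ _)
  have dF := dependsOnIcc_notMem_seg a 0 (p + 1) le_rfl (show (0 : ℤ) + (p + 1 : ℕ) ≤ p + 1 by simp)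
  have mF := dF.measurableSet
  have mF' := (dependsOnIcc_notMem_seg a 0 (p + 1 + N) le_rfl
    (show (0 : ℤ) + (p + 1 + N : ℕ) ≤ (p + 1 + N : ℕ) + 1 by simp)).measurableSet
  rw [hsum _ mF, hsum _ mF', Finset.mul_sum]
  refine Finset.sum_le_sum fun b _ => ?_
  have key := hμ.real_inter p p (k b) b (F := {x | a ∉ seg x 0 (p + 1)})
    (G := {x | x (p + k b) = a}) (by simpa using dF)
    (fun x y h hx => by rw [Set.mem_ofPred_eq, ← h _ (by omega) le_rfl]; exact hx)
  have hG : μ.real ({x | x p = b} ∩ {x | x (p + k b) = a}) =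
      μ.real {x | x 0 = b ∧ x (k b) = a} := by
    rw [← hμ.shift_eq (E := {x | x 0 = b ∧ x (k b) = a})
      ((measurableSet_coord 0 b).inter (measurableSet_coord _ a)) p]
    congr 1
    ext x
    simp [shiftBy, add_comm]
  rw [hG] at key
  have hpb := hμ.pos_coord b
  have key' : μ.real ({x | a ∉ seg x 0 (p + 1)} ∩ {x | x p = b} ∩ {x | x (p + k b) = a}) =
      ε b * μ.real ({x | a ∉ seg x 0 (p + 1)} ∩ {x | x p = b}) := by
    rw [hε]
    field_simp
    rw [key]
    ring
  have hsub : ({x | a ∉ seg x 0 (p + 1 + N)} ∩ {x | x p = b}) ⊆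
      ({x | a ∉ seg x 0 (p + 1)} ∩ {x | x p = b}) \
      ({x | a ∉ seg x 0 (p + 1)} ∩ {x | x p = b} ∩ {x | x (p + k b) = a}) := by
    rintro x ⟨hx, hxb⟩
    simp only [Set.mem_ofPred_eq, mem_seg_iff, not_exists, not_and] at hx
    refine ⟨⟨?_, hxb⟩, fun h => ?_⟩
    · simp only [Set.mem_ofPred_eq, mem_seg_iff, not_exists, not_and]
      exact fun i h1 h2 => hx i h1 (by push_cast at h2 ⊢; omega)
    · have := hkN b
      exact hx _ (by omega) (by push_cast; omega) h.2
  calc _ ≤ _ := measureReal_mono hsub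
    _ = μ.real ({x | a ∉ seg x 0 (p + 1)} ∩ {x | x p = b}) -
        ε b * μ.real ({x | a ∉ seg x 0 (p + 1)} ∩ {x | x p = b}) := by
      rw [← key']
      exact measureReal_sdiff Set.inter_subset_left
        ((mF.inter (measurableSet_coord _ _)).inter (measurableSet_coord _ _))
    _ ≤ _ := by
      have := mul_le_mul_of_nonneg_right (hb₀ b (Finset.mem_univ b))
        (measureReal_nonneg (μ := μ) (s := {x | a ∉ seg x 0 (p + 1)} ∩ {x | x p = b}))
      linarith

/-- Words of positive probability are not too improbable. -/
lemma exists_lower_bound (hμ : IsAperiodicMarkov μ) :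
    ∃ c : ℝ, 0 < c ∧ c ≤ 1 ∧ ∀ (α : ℤ) (n : ℕ) (u : List A), 0 < μ.real {x | seg x α n = u} →
      c ^ n ≤ μ.real {x | seg x α n = u} := by
  have := hμ.isProbabilityMeasure
  -- Impossible transitions receive the value 1, so that the minimum over all pairs is positive.
  set c1 : A × A → ℝ := fun p => if 0 < μ.real {x | x 0 = p.1 ∧ x 1 = p.2} then
    μ.real {x | x 0 = p.1 ∧ x 1 = p.2} else 1 with hc1
  rcases isEmpty_or_nonempty A with hA | ⟨⟨a₀⟩⟩
  · refine ⟨1, one_pos, le_rfl, fun α n u hu => ?_⟩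
    have : IsEmpty (ℤ → A) := ⟨fun x => hA.elim (x 0)⟩
    have h0 : {x : ℤ → A | seg x α n = u} = ∅ := Set.eq_empty_of_isEmpty _
    rw [h0] at hu
    simp at hu
  obtain ⟨p₀, -, hp₀⟩ := Finset.exists_min_image Finset.univ c1 ⟨(a₀, a₀), Finset.mem_univ _⟩
  obtain ⟨b₀, -, hb₀⟩ := Finset.exists_min_image Finset.univ (fun b => μ.real {x | x 0 = b})
    ⟨a₀, Finset.mem_univ _⟩
  have h1 : 0 < c1 p₀ := by
    rw [hc1]; dsimp only; split_ifs with h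
    · exact h
    · exact one_pos
  set c := min (c1 p₀) (μ.real {x | x 0 = b₀}) with hc
  have hcpos : 0 < c := lt_min h1 (hμ.pos_coord b₀)
  have hcle : c ≤ 1 := (min_le_right _ _).trans measureReal_le_one
  refine ⟨c, hcpos, hcle, fun α n => ?_⟩
  rcases n with _ | n
  · intro u hu
    by_cases h : u = []
    · subst h; simp
    · exfalso
      have : {x : ℤ → A | seg x α 0 = u} = ∅ := by ext x; simp [Ne.symm h]
      rw [this] at hu
      simp at hu
  induction n generalizing α with
  | zero =>
    intro u hu
    obtain ⟨x, hx⟩ : {x : ℤ → A | seg x α 1 = u}.Nonempty := by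
      by_contra! h; rw [h] at hu; simp at hu
    have : {x : ℤ → A | seg x α 1 = u} = {y | y α = x α} := by
      ext y
      rw [Set.mem_ofPred_eq, ← show seg x α 1 = u from hx]
      simp [seg_succ]
    rw [this, hμ.real_coord]
    rw [zero_add, pow_one]
    exact (min_le_right _ _).trans (hb₀ _ (Finset.mem_univ _))
  | succ n ih =>
    intro u hu
    obtain ⟨z, hz⟩ : {x : ℤ → A | seg x α (n + 1 + 1) = u}.Nonempty := by
      by_contra! h; rw [h] at hu; simp at hu
    have hzu : seg z α (n + 1 + 1) = u := hz
    have key := hμ.real_seg_inter (α + n) n 1 z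
    rw [show α + n - (n : ℤ) = α by ring] at key
    have e1 : {x | seg x α (n + 1) = seg z α (n + 1)} ∩
        {x | seg x (α + n) (1 + 1) = seg z (α + n) (1 + 1)} =
        {x : ℤ → A | seg x α (n + 1 + 1) = u} := by
      ext x
      simp only [Set.mem_inter_iff, Set.mem_ofPred_eq, ← hzu, seg_eq_seg_iff]
      constructor
      · rintro ⟨h1, h2⟩ i hi hi'
        by_cases h : i < α + (n + 1 : ℕ)
        · exact h1 i hi h
        · push_cast at h hi'
          exact h2 i (by omega) (by push_cast; omega)
      · intro h
        push_cast at h ⊢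
        exact ⟨fun i h1 h2 => h i h1 (by omega), fun i h1 h2 => h i (by omega) (by omega)⟩
    have e2 : μ.real {x : ℤ → A | seg x (α + n) (1 + 1) = seg z (α + n) (1 + 1)} =
        μ.real {x | x 0 = z (α + n) ∧ x 1 = z (α + n + 1)} := by
      rw [← hμ.shift_eq (E := {x | x 0 = z (α + n) ∧ x 1 = z (α + n + 1)})
        ((measurableSet_coord _ _).inter (measurableSet_coord _ _)) (α + n)]
      congr 1
      ext x
      simp [shiftBy, seg_succ, add_comm]
    rw [e1, e2] at key
    have hπ := hμ.pos_coord (z (α + n))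
    have hpos : 0 < μ.real {x | seg x α (n + 1) = seg z α (n + 1)} *
      μ.real {x | x 0 = z (α + n) ∧ x 1 = z (α + n + 1)} := by rw [← key]; positivity
    have hp1 := pos_of_mul_pos_left hpos measureReal_nonneg
    have hp2 := pos_of_mul_pos_right hpos measureReal_nonneg
    have i1 := ih α _ hp1
    have i2 : c ≤ μ.real {x | x 0 = z (α + n) ∧ x 1 = z (α + n + 1)} := by
      refine (min_le_left _ _).trans ?_
      have := hp₀ (z (α + n), z (α + n + 1)) (Finset.mem_univ _)
      rw [hc1] at this ⊢
      dsimp only at this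
      rwa [if_pos hp2] at this
    calc c ^ (n + 1 + 1) = c ^ (n + 1) * c := pow_succ _ _
      _ ≤ _ := mul_le_mul i1 i2 hcpos.le measureReal_nonneg
      _ = _ := key.symm
      _ ≤ μ.real {x | seg x α (n + 1 + 1) = u} * 1 :=
        mul_le_mul_of_nonneg_left measureReal_le_one measureReal_nonneg
      _ = _ := mul_one _

end IsAperiodicMarkov

end Markov

/-! ### Independence and information of the blocks -/

section Blocks

variable {A : Type*} [MeasurableSpace A] [MeasurableSingletonClass A] [Fintype A] [DecidableEq A]
  {μ : Measure (ℤ → A)} {a : A}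

/-- The number of coordinates that is prescribed by a specification of blocks. -/
def specLength (sp : List (ℕ × Set (List A))) : ℕ := (sp.map fun s => s.1 + 1).sum

/-- From `α` on, the blocks have the specified lengths and lie in the specified sets. -/
def Matches (a : A) : ℤ → List (ℕ × Set (List A)) → Set (ℤ → A)
  | α, [] => {x | x α = a}
  | α, s :: sp => {x | x α = a ∧ seg x (α + 1) s.1 ∈ s.2 ∧ a ∉ seg x (α + 1) s.1} ∩
      Matches a (α + s.1 + 1) sp

lemma Matches.coord_start {α : ℤ} {sp : List (ℕ × Set (List A))} {x : ℤ → A}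
    (h : x ∈ Matches a α sp) : x α = a := by
  cases sp with
  | nil => exact h
  | cons s sp => exact h.1.1

/-- Links the recursive description of the event, which suits the Markov property, to the parsed
word, which suits fillers. The `a` after the segment is what closes the last block. -/
lemma mem_matches_iff {x : ℤ → A} {α : ℤ} {sp : List (ℕ × Set (List A))} :
    x ∈ Matches a α sp ↔ x (α + specLength sp) = a ∧ x α = a ∧
      List.Forall₂ (fun b s => b.length = s.1 ∧ b ∈ s.2) (blocks a (seg x α (specLength sp))) sp := by
  induction sp generalizing α with
  | nil => simp [Matches, specLength]
  | cons s sp ih =>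
    have hlen : specLength (s :: sp) = s.1 + specLength sp + 1 := by simp [specLength]; ring
    have hseg : seg x α (specLength (s :: sp)) =
        x α :: (seg x (α + 1) s.1 ++ seg x (α + s.1 + 1) (specLength sp)) := by
      rw [hlen, seg_succ, seg_add]; congr 3; ring
    have hend : x (α + specLength (s :: sp)) = x (α + s.1 + 1 + specLength sp) := by
      rw [hlen]; congr 1; push_cast; ring
    rw [hseg, hend, Matches, Set.mem_inter_iff, ih, Set.mem_ofPred_eq]
    constructor
    · rintro ⟨⟨h1, h2, h3⟩, h4, h5, h6⟩
      refine ⟨h4, h1, ?_⟩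
      have hst : Starts a (seg x (α + s.1 + 1) (specLength sp)) := by
        rcases specLength sp with _ | n
        · simp [starts_nil]
        · rw [seg_succ, h5]; exact starts_cons a _
      rw [h1, ← List.cons_append, blocks_cons_append a h3 hst]
      exact .cons ⟨by simp, h2⟩ h6
    · rintro ⟨h1, h2, h3⟩
      rw [h2, blocks_cons_self, List.forall₂_cons] at h3
      obtain ⟨⟨h4, h5⟩, h6⟩ := h3
      have hcat := initial_append_flatMap_blocks a
        (seg x (α + 1) s.1 ++ seg x (α + s.1 + 1) (specLength sp))
      obtain ⟨e1, e2⟩ := List.append_inj hcat (by simp [h4])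
      have hnot := notMem_initial a (seg x (α + 1) s.1 ++ seg x (α + s.1 + 1) (specLength sp))
      rw [e1] at hnot h5
      rw [blocks_append_of_notMem a hnot] at h6 e2
      refine ⟨⟨h2, h5, hnot⟩, h1, ?_, h6⟩
      rcases hn : specLength sp with _ | n
      · rw [hn] at h1; simpa using h1
      · rw [hn] at e2
        rw [seg_succ] at e2
        rcases hb : blocks a (x (α + s.1 + 1) :: seg x (α + s.1 + 1 + 1) n) with _ | ⟨b, bs⟩
        · rw [hb] at e2; simp at e2
        · rw [hb, List.flatMap_cons, List.cons_append, List.cons.injEq] at e2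
          exact e2.1.symm

lemma dependsOnIcc_matches (α : ℤ) (sp : List (ℕ × Set (List A))) :
    DependsOnIcc (Matches a α sp) α (α + specLength sp) := by
  intro x y h hx
  rw [mem_matches_iff] at hx ⊢
  rwa [← h _ (by omega) le_rfl, ← h _ le_rfl (by omega),
    ← seg_congr (x := x) fun i h1 h2 => h i (by omega) (by omega)]

variable (μ a) in
/-- The probability, starting from `a`, that the next block has length `n` and lies in `E`. -/
def blockProbSet (n : ℕ) (E : Set (List A)) : ℝ :=
  μ.real {x | x 0 = a ∧ seg x 1 n ∈ E ∧ a ∉ seg x 1 n ∧ x (n + 1) = a} / μ.real {x | x 0 = a}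

variable (μ a) in
/-- The probability, starting from `a`, that the next block is `b`. -/
def blockProb (b : List A) : ℝ := blockProbSet μ a b.length {b}

lemma dependsOnIcc_block (α : ℤ) (n : ℕ) (E : Set (List A)) :
    DependsOnIcc {x | x α = a ∧ seg x (α + 1) n ∈ E ∧ a ∉ seg x (α + 1) n} α (α + n + 1) := by
  intro x y h hx
  rw [Set.mem_ofPred_eq] at hx ⊢
  rwa [← h _ le_rfl (by omega), ← seg_congr (x := x) fun i h1 h2 => h i (by omega) (by omega)]

lemma dependsOnIcc_block_end (α : ℤ) (n : ℕ) (E : Set (List A)) :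
    DependsOnIcc {x | x α = a ∧ seg x (α + 1) n ∈ E ∧ a ∉ seg x (α + 1) n ∧ x (α + n + 1) = a}
      α (α + n + 1) := by
  intro x y h hx
  rw [Set.mem_ofPred_eq] at hx ⊢
  rwa [← h _ le_rfl (by omega), ← h _ (by omega) le_rfl,
    ← seg_congr (x := x) fun i h1 h2 => h i (by omega) (by omega)]

lemma blockProbSet_nonneg (n : ℕ) (E : Set (List A)) : 0 ≤ blockProbSet μ a n E := by
  rw [blockProbSet]; positivity

lemma blockProb_nonneg (b : List A) : 0 ≤ blockProb μ a b := blockProbSet_nonneg _ _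

namespace IsAperiodicMarkov

lemma real_block (hμ : IsAperiodicMarkov μ) (α : ℤ) (n : ℕ) (E : Set (List A)) :
    μ.real {x | x α = a ∧ seg x (α + 1) n ∈ E ∧ a ∉ seg x (α + 1) n ∧ x (α + n + 1) = a} =
      μ.real {x | x 0 = a} * blockProbSet μ a n E := by
  have h := (dependsOnIcc_block_end (a := a) 0 n E).measurableSet
  simp only [zero_add] at h
  rw [blockProbSet, mul_div_cancel₀ _ (hμ.pos_coord a).ne', ← hμ.shift_eq h α]
  congr 1
  ext x
  simp only [Set.mem_ofPred_eq, Set.mem_preimage, seg_shiftBy]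
  simp only [shiftBy, zero_add, add_comm 1 α, show (n : ℤ) + 1 + α = α + n + 1 by ring]

/-- The block lies in the past of the `a` that closes it and G in its future, so the Markov property
at that `a` separates them. -/
lemma real_block_inter (hμ : IsAperiodicMarkov μ) (α : ℤ) (n : ℕ) (E : Set (List A)) (m : ℕ)
    {G : Set (ℤ → A)} (hG : DependsOnIcc G (α + n + 1) (α + n + 1 + m)) :
    μ.real ({x | x α = a ∧ seg x (α + 1) n ∈ E ∧ a ∉ seg x (α + 1) n} ∩
        ({x | x (α + n + 1) = a} ∩ G)) =
      blockProbSet μ a n E * μ.real ({x | x (α + n + 1) = a} ∩ G) := by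
  have key := hμ.real_inter (α + n + 1) (n + 1) m a
    (F := {x | x α = a ∧ seg x (α + 1) n ∈ E ∧ a ∉ seg x (α + 1) n}) (G := G)
    (by convert dependsOnIcc_block (a := a) α n E using 1; push_cast; ring) hG
  have e1 : {x | x α = a ∧ seg x (α + 1) n ∈ E ∧ a ∉ seg x (α + 1) n} ∩ {x | x (α + n + 1) = a} =
      {x | x α = a ∧ seg x (α + 1) n ∈ E ∧ a ∉ seg x (α + 1) n ∧ x (α + n + 1) = a} := by
    ext x; simp [and_assoc]
  rw [Set.inter_assoc, e1, hμ.real_block] at key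
  have hπ := hμ.pos_coord a
  refine mul_right_cancel₀ hπ.ne' ?_
  rw [key]
  ring

/-- Successive blocks are independent. -/
lemma real_matches (hμ : IsAperiodicMarkov μ) (α : ℤ) (sp : List (ℕ × Set (List A))) :
    μ.real (Matches a α sp) =
      μ.real {x | x 0 = a} * (sp.map fun s => blockProbSet μ a s.1 s.2).prod := by
  induction sp generalizing α with
  | nil => simp [Matches, hμ.real_coord]
  | cons s sp ih =>
    have e : Matches a (α + s.1 + 1) sp = {x | x (α + s.1 + 1) = a} ∩ Matches a (α + s.1 + 1) sp :=
      (Set.inter_eq_right.2 fun x hx => Matches.coord_start hx).symm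
    rw [Matches, e, hμ.real_block_inter _ _ _ _ (dependsOnIcc_matches _ _), ← e, ih, List.map_cons,
      List.prod_cons]
    ring

lemma blockProbSet_eq_sum (hμ : IsAperiodicMarkov μ) (n : ℕ) (E : Set (List A))
    [DecidablePred (· ∈ E)] :
    blockProbSet μ a n E = ∑ b ∈ (words A n).filter (· ∈ E), blockProb μ a b := by
  have := hμ.isProbabilityMeasure
  have h := (dependsOnIcc_block_end (a := a) 0 n E).measurableSet
  simp only [zero_add] at h
  rw [blockProbSet, sum_measureReal_seg μ h 1 n, Finset.sum_filter, Finset.sum_div]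
  refine Finset.sum_congr rfl fun b hb => ?_
  rw [mem_words] at hb
  subst hb
  split_ifs with hE
  · rw [blockProb, blockProbSet]
    congr 2
    ext x
    simp only [Set.mem_inter_iff, Set.mem_ofPred_eq, Set.mem_singleton_iff]
    constructor
    · rintro ⟨⟨h1, h2, h3, h4⟩, h5⟩; exact ⟨h1, h5, h3, h4⟩
    · rintro ⟨h1, h5, h3, h4⟩; exact ⟨⟨h1, by rw [h5]; exact hE, h3, h4⟩, h5⟩
  · have : {x : ℤ → A | x 0 = a ∧ seg x 1 b.length ∈ E ∧ a ∉ seg x 1 b.length ∧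
        x (b.length + 1) = a} ∩ {x | seg x 1 b.length = b} = ∅ := by
      ext x
      simp only [Set.mem_inter_iff, Set.mem_ofPred_eq, Set.mem_empty_iff_false, iff_false]
      rintro ⟨⟨h1, h2, h3, h4⟩, h5⟩; exact hE (h5 ▸ h2)
    rw [this]; simp

lemma blockProbSet_univ (hμ : IsAperiodicMarkov μ) (n : ℕ) :
    blockProbSet μ a n Set.univ = ∑ b ∈ words A n, blockProb μ a b := by
  classical
  rw [hμ.blockProbSet_eq_sum]; simp

lemma blockProbSet_le_one (hμ : IsAperiodicMarkov μ) (n : ℕ) (E : Set (List A)) :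
    blockProbSet μ a n E ≤ 1 := by
  have := hμ.isProbabilityMeasure
  rw [blockProbSet, div_le_one (hμ.pos_coord a)]
  exact measureReal_mono fun x hx => hx.1

lemma blockProb_le_univ (hμ : IsAperiodicMarkov μ) (b : List A) :
    blockProb μ a b ≤ blockProbSet μ a b.length Set.univ := by
  rw [hμ.blockProbSet_univ]
  exact Finset.single_le_sum (fun b _ => blockProb_nonneg b) (mem_words.2 rfl)

/-- The lengths of blocks have exponential tails. -/
lemma exists_blockProbSet_bound (hμ : IsAperiodicMarkov μ) (a : A) :
    ∃ C θ : ℝ, 0 < C ∧ 0 < θ ∧ θ < 1 ∧ ∀ n, blockProbSet μ a n Set.univ ≤ C * θ ^ n := by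
  have := hμ.isProbabilityMeasure
  obtain ⟨C, θ, hC, h0, h1, h⟩ := hμ.exists_tail_bound a
  have hπ := hμ.pos_coord a
  refine ⟨C / μ.real {x | x 0 = a}, θ, by positivity, h0, h1, fun n => ?_⟩
  rw [blockProbSet, div_mul_eq_mul_div]
  refine div_le_div_of_nonneg_right ((measureReal_mono fun x hx => ?_).trans (h 1 n)) hπ.le
  exact hx.2.2.1

/-- The probabilities of the lengths of the next block have sum at most one. -/
lemma sum_blockProbSet_le_one (hμ : IsAperiodicMarkov μ) (n : ℕ) :
    ∑ k ∈ Finset.range n, blockProbSet μ a k Set.univ ≤ 1 := by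
  have := hμ.isProbabilityMeasure
  have hπ := hμ.pos_coord a
  simp only [blockProbSet]
  rw [← Finset.sum_div, div_le_one hπ, ← measureReal_biUnion_finset]
  · refine measureReal_mono fun x hx => ?_
    simp only [Set.mem_iUnion] at hx
    obtain ⟨k, -, hk⟩ := hx
    exact hk.1
  -- The events are disjoint, since the length of the block tells the time of the first return to
  -- `a`.
  · intro i _ j _ hij
    refine Set.disjoint_left.2 fun x hi hj => ?_
    obtain ⟨-, -, h1, h2⟩ := hi
    obtain ⟨-, -, h3, h4⟩ := hj
    rw [mem_seg_iff] at h1 h3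
    rcases lt_or_gt_of_ne hij with h | h
    · exact h3 ⟨i + 1, by omega, by omega, h2⟩
    · exact h1 ⟨j + 1, by omega, by omega, h4⟩
  · intro k _
    have h := (dependsOnIcc_block_end (a := a) 0 k Set.univ).measurableSet
    simpa only [zero_add] using h

end IsAperiodicMarkov

variable (μ a) in
/-- The conditional probability of a block, given its length. -/
def condProb (b : List A) : ℝ := blockProb μ a b / blockProbSet μ a b.length Set.univ

open Classical in
variable (μ a) in
/-- Impossible blocks are replaced by possible blocks of the same length. -/
def norm (b : List A) : List A :=
  if 0 < blockProb μ a b then b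
  else if h : ∃ b', b'.length = b.length ∧ 0 < blockProb μ a b' then h.choose else b

variable (μ a) in
/-- The information of a block, given its length. -/
def cost (b : List A) : ℝ := -Real.log (condProb μ a (norm μ a b))

open Classical in
variable (μ a) in
/-- An upper bound for the information of the blocks of a given length, which vanishes when the
length determines the block. -/
def cap (C : ℝ) (n : ℕ) : ℝ :=
  if ∃ b : List A, b.length = n ∧ condProb μ a b = 1 then 0 else C * (n + 1)

lemma length_norm (b : List A) : (norm μ a b).length = b.length := by
  rw [norm]
  split_ifs with h h'
  · rfl
  · exact h'.choose_spec.1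
  · rfl

lemma norm_eq_self {b : List A} (h : 0 < blockProb μ a b) : norm μ a b = b := by
  rw [norm, if_pos h]

namespace IsAperiodicMarkov

lemma blockProb_norm_pos (hμ : IsAperiodicMarkov μ) {b : List A}
    (h : 0 < blockProbSet μ a b.length Set.univ) : 0 < blockProb μ a (norm μ a b) := by
  rw [norm]
  split_ifs with h1 h2
  · exact h1
  · exact h2.choose_spec.2
  · exfalso
    rw [hμ.blockProbSet_univ] at h
    obtain ⟨b', hb', h'⟩ := Finset.exists_lt_of_sum_lt (s := words A b.length) (f := fun _ => (0:ℝ))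
      (g := blockProb μ a) (by simpa using h)
    exact h2 ⟨b', mem_words.1 hb', h'⟩

lemma univ_pos (hμ : IsAperiodicMarkov μ) {b : List A} (h : 0 < blockProb μ a b) :
    0 < blockProbSet μ a b.length Set.univ := h.trans_le (hμ.blockProb_le_univ b)

lemma condProb_le_one (hμ : IsAperiodicMarkov μ) (b : List A) : condProb μ a b ≤ 1 :=
  div_le_one_of_le₀ (hμ.blockProb_le_univ b) (blockProbSet_nonneg _ _)

lemma condProb_nonneg (b : List A) : 0 ≤ condProb μ a b :=
  div_nonneg (blockProb_nonneg _) (blockProbSet_nonneg _ _)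

lemma condProb_pos (hμ : IsAperiodicMarkov μ) {b : List A} (h : 0 < blockProb μ a b) :
    0 < condProb μ a b := div_pos h (hμ.univ_pos h)

lemma cost_nonneg (hμ : IsAperiodicMarkov μ) (b : List A) : 0 ≤ cost μ a b :=
  neg_nonneg.2 (Real.log_nonpos (condProb_nonneg _) (hμ.condProb_le_one _))

/-- A block of conditional probability one is the only possible block of its length. -/
lemma eq_of_condProb_eq_one (hμ : IsAperiodicMarkov μ) {b b' : List A} (h : condProb μ a b = 1)
    (hl : b'.length = b.length) (h' : 0 < blockProb μ a b') : b' = b := by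
  by_contra hne
  have hu := hl ▸ hμ.univ_pos h'
  rw [condProb, div_eq_one_iff_eq hu.ne', hμ.blockProbSet_univ] at h
  have := Finset.sum_le_sum_of_subset_of_nonneg (s := {b, b'}) (t := words A b.length)
    (f := blockProb μ a) (by
      intro c hc
      rw [Finset.mem_insert, Finset.mem_singleton] at hc
      rcases hc with rfl | rfl
      · exact mem_words.2 rfl
      · exact mem_words.2 hl) (fun c _ _ => blockProb_nonneg c)
  rw [Finset.sum_pair (Ne.symm hne)] at this
  linarith

/-- The conditional probability of a possible block b is at least the probability of the word a b a,
which has |b| + 2 letters. If no block of the given length is possible, the cost is 0 since log 0 =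
0. The summand 1 in the constant makes it positive. -/
lemma exists_cost_le (hμ : IsAperiodicMarkov μ) (a : A) :
    ∃ C : ℝ, 0 < C ∧ ∀ b : List A, cost μ a b ≤ C * (b.length + 1) := by
  have := hμ.isProbabilityMeasure
  obtain ⟨c, hc0, hc1, hc⟩ := hμ.exists_lower_bound
  have hlog : 0 ≤ -Real.log c := neg_nonneg.2 (Real.log_nonpos hc0.le hc1)
  refine ⟨2 * (-Real.log c) + 1, by linarith, fun b => ?_⟩
  by_cases h : 0 < blockProb μ a (norm μ a b)
  · have hl := length_norm (μ := μ) (a := a) b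
    rw [cost]
    set d := norm μ a b
    rw [← hl]
    have hle : c ^ (d.length + 2) ≤ condProb μ a d := by
      rw [condProb, le_div_iff₀ (hμ.univ_pos h)]
      refine (mul_le_of_le_one_right (by positivity) (hμ.blockProbSet_le_one _ _)).trans ?_
      have hpos : 0 < blockProb μ a d := h
      rw [blockProb, blockProbSet] at hpos ⊢
      have hpos' : 0 < μ.real {x | x 0 = a ∧ seg x 1 d.length ∈ ({d} : Set (List A)) ∧
          a ∉ seg x 1 d.length ∧ x (d.length + 1) = a} := by
        by_contra hcon
        rw [le_antisymm (not_lt.1 hcon) measureReal_nonneg, zero_div] at hpos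
        exact lt_irrefl _ hpos
      have hsub : {x : ℤ → A | x 0 = a ∧ seg x 1 d.length ∈ ({d} : Set (List A)) ∧
          a ∉ seg x 1 d.length ∧ x (d.length + 1) = a} =
          {x | seg x 0 (d.length + 2) = a :: (d ++ [a])} := by
        have had : a ∉ d := by
          intro had
          rw [show {x : ℤ → A | x 0 = a ∧ seg x 1 d.length ∈ ({d} : Set (List A)) ∧
            a ∉ seg x 1 d.length ∧ x (d.length + 1) = a} = ∅ from by
              ext x
              simp only [Set.mem_ofPred_eq, Set.mem_singleton_iff, Set.mem_empty_iff_false,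
                iff_false]
              rintro ⟨-, h1, h2, -⟩
              exact h2 (by rw [h1]; exact had)] at hpos'
          simp at hpos'
        ext x
        rw [Set.mem_ofPred_eq, Set.mem_ofPred_eq, show d.length + 2 = d.length + 1 + 1 by ring,
          seg_succ, seg_add, zero_add, List.cons.injEq, Set.mem_singleton_iff, seg_succ, seg_zero,
          add_comm 1]
        constructor
        · rintro ⟨h1, h2, -, h3⟩; exact ⟨h1, by rw [h2, h3]⟩
        · rintro ⟨h1, h2⟩
          obtain ⟨h2, h3⟩ := List.append_inj h2 (by simp)
          exact ⟨h1, h2, by rw [h2]; exact had, by simpa using h3⟩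
      rw [hsub] at hpos' ⊢
      refine (hc _ _ _ hpos').trans ?_
      exact le_div_self measureReal_nonneg (hμ.pos_coord a) measureReal_le_one
    have := Real.log_le_log (by positivity) hle
    rw [Real.log_pow] at this
    push_cast at this
    nlinarith [Nat.cast_nonneg (α := ℝ) d.length]
  · have h0 : blockProb μ a (norm μ a b) = 0 := le_antisymm (not_lt.1 h) (blockProb_nonneg _)
    rw [cost, condProb, h0]
    simp only [zero_div, Real.log_zero, neg_zero]
    positivity

/-- When the length determines the block, `norm` yields exactly that block, whose cost is 0. -/
lemma cost_le_cap (hμ : IsAperiodicMarkov μ) {C : ℝ}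
    (hC : ∀ b : List A, cost μ a b ≤ C * (b.length + 1)) (b : List A) :
    cost μ a b ≤ cap μ a C b.length := by
  rw [cap]
  split_ifs with h
  · obtain ⟨d, hd, h1⟩ := h
    by_cases hu : 0 < blockProbSet μ a b.length Set.univ
    · rw [cost, hμ.eq_of_condProb_eq_one h1 (by rw [length_norm, hd]) (hμ.blockProb_norm_pos hu), h1]
      simp
    · exfalso
      have : blockProbSet μ a b.length Set.univ = 0 :=
        le_antisymm (not_lt.1 hu) (blockProbSet_nonneg _ _)
      rw [condProb, hd, this, div_zero] at h1
      exact zero_ne_one h1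
  · exact hC b

/-- The blocks that are not determined by their length have an information bounded below. -/
lemma exists_le_cost (hμ : IsAperiodicMarkov μ) (hr : ProbabilityReduction μ a) :
    ∃ κ : ℝ, 0 < κ ∧ ∀ (C : ℝ) (b : List A), 0 < blockProbSet μ a b.length Set.univ →
      cap μ a C b.length ≠ 0 → κ ≤ cost μ a b := by
  have := hμ.isProbabilityMeasure
  obtain ⟨c, hc, h⟩ := hr
  -- The constant of the reduction property need not be positive; the maximum with 1/2 makes the
  -- logarithm finite and negative.
  refine ⟨-Real.log (max c (1 / 2)), neg_pos.2 (Real.log_neg (by positivity)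
    (max_lt hc (by norm_num))), fun C b hu hcap => ?_⟩
  have hdet : ¬ ∃ d : List A, d.length = b.length ∧ condProb μ a d = 1 := by
    intro hd
    rw [cap, if_pos hd] at hcap
    exact hcap rfl
  have hpos := hμ.blockProb_norm_pos hu
  have hl := length_norm (μ := μ) (a := a) b
  rw [cost]
  set d := norm μ a b
  have hcd : condProb μ a d ≠ 1 := fun h1 => hdet ⟨d, hl, h1⟩
  suffices condProb μ a d ≤ c by
    refine neg_le_neg (Real.log_le_log (hμ.condProb_pos hpos) (this.trans (le_max_left _ _)))
  have had : a ∉ d := by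
    intro had
    have h0 : {x : ℤ → A | x 0 = a ∧ seg x 1 d.length ∈ ({d} : Set (List A)) ∧
      a ∉ seg x 1 d.length ∧ x (d.length + 1) = a} = ∅ := by
        ext x
        simp only [Set.mem_ofPred_eq, Set.mem_singleton_iff, Set.mem_empty_iff_false,
          iff_false]
        rintro ⟨-, h1, h2, -⟩
        exact h2 (by rw [h1]; exact had)
    rw [blockProb, blockProbSet, h0] at hpos
    simp at hpos
  -- The reduction property speaks of n ≥ 1 only. The empty block is the only one of its length, so
  -- it has conditional probability one and is already excluded.
  have hlen : 1 ≤ d.length := by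
    by_contra! h0
    apply hcd
    have hd : d = [] := List.length_eq_zero_iff.1 (by omega)
    have huv := hμ.univ_pos hpos
    rw [condProb, hd, blockProb]
    rw [hd] at huv
    rw [div_eq_one_iff_eq huv.ne', blockProbSet, blockProbSet]
    simp
  have key := h d.length (fun i => d.getD (i - 1) a) hlen (by
    intro i h1 h2
    rw [List.getD_eq_getElem _ _ (by omega)]
    exact fun h => had (h ▸ List.getElem_mem _))
  have hsegiff : ∀ x : ℤ → A, (∀ i : ℕ, 1 ≤ i → i ≤ d.length → x i = d.getD (i - 1) a) ↔
      seg x 1 d.length = d := by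
    intro x
    constructor
    · intro hx
      refine List.ext_getElem (by simp) fun i h1 h2 => ?_
      have := hx (i + 1) (by omega) (by omega)
      rw [Nat.add_sub_cancel, List.getD_eq_getElem _ _ h2] at this
      rw [← this]
      simp [seg, add_comm]
    · intro hx i h1 h2
      rw [List.getD_eq_getElem _ _ (by omega)]
      rw [← List.getElem_of_eq hx (by simp; omega)]
      simp only [seg, List.getElem_ofFn]
      congr 1
      omega
  have hnotiff : ∀ x : ℤ → A, (∀ i : ℕ, 1 ≤ i → i ≤ d.length → x i ≠ a) ↔
      a ∉ seg x 1 d.length := by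
    intro x
    rw [mem_seg_iff]
    push Not
    constructor
    · intro hx i h1 h2
      have := hx i.toNat (by omega) (by omega)
      rwa [Int.toNat_of_nonneg (by omega)] at this
    · intro hx i h1 h2
      exact hx i (by omega) (by omega)
  simp only [hsegiff, hnotiff] at key
  have m1 : MeasurableSet {x : ℤ → A | x 0 = a ∧ a ∉ seg x 1 d.length ∧ x (d.length + 1) = a} := by
    have h := (dependsOnIcc_block_end (a := a) 0 d.length Set.univ).measurableSet
    simpa only [zero_add, Set.mem_univ, true_and] using h
  rw [measureReal_def, cond_apply m1, ENNReal.toReal_mul, ENNReal.toReal_inv, ← measureReal_def,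
    ← measureReal_def] at key
  have e1 : {x : ℤ → A | x 0 = a ∧ a ∉ seg x 1 d.length ∧ x (d.length + 1) = a} ∩
      {x | x 0 = a ∧ seg x 1 d.length = d ∧ x (d.length + 1) = a} =
      {x | x 0 = a ∧ seg x 1 d.length ∈ ({d} : Set (List A)) ∧ a ∉ seg x 1 d.length ∧
        x (d.length + 1) = a} := by
    ext x
    simp only [Set.mem_inter_iff, Set.mem_ofPred_eq, Set.mem_singleton_iff]
    tauto
  have e2 : (μ.real {x : ℤ → A | x 0 = a ∧ a ∉ seg x 1 d.length ∧ x (d.length + 1) = a})⁻¹ *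
      μ.real {x | x 0 = a ∧ seg x 1 d.length ∈ ({d} : Set (List A)) ∧ a ∉ seg x 1 d.length ∧
        x (d.length + 1) = a} = condProb μ a d := by
    have hπ := hμ.pos_coord a
    rw [condProb, blockProb, blockProbSet, blockProbSet]
    simp only [Set.mem_univ, true_and]
    field_simp
  rw [e1, e2] at key
  rcases key with hk | hk
  · exact hk.2
  · exact absurd hk hcd

end IsAperiodicMarkov

end Blocks

/-- A Taylor bound valid on the whole line: the usual one for |y| ≤ 1, while for |y| > 1 the last
term suffices because y² ≥ |y| ≥ 1. -/
lemma exp_le_one_add_add (y : ℝ) : Real.exp y ≤ 1 + y + y ^ 2 * Real.exp |y| := by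
  have h1 : 1 ≤ Real.exp |y| := Real.one_le_exp (abs_nonneg y)
  rcases le_or_gt |y| 1 with h | h
  · have := (abs_le.1 (Real.abs_exp_sub_one_sub_id_le h)).2
    nlinarith [sq_nonneg y]
  · rcases le_or_gt 0 y with h0 | h0
    · rw [abs_of_nonneg h0] at h ⊢
      have h2 : 1 ≤ y ^ 2 := by nlinarith
      nlinarith [mul_le_mul_of_nonneg_right h2 (Real.exp_pos y).le]
    · rw [abs_of_neg h0] at h
      have : Real.exp y ≤ 1 := Real.exp_le_one_iff.2 h0.le
      nlinarith [sq_nonneg y]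

/-! ### Moderate deviations of the information of blocks -/

section Deviation

variable {A : Type*} [MeasurableSpace A] [MeasurableSingletonClass A] [Fintype A] [DecidableEq A]
  {μ : Measure (ℤ → A)} {a : A}

lemma starts_seg {x : ℤ → A} {α : ℤ} {n : ℕ} (h : n = 0 ∨ x α = a) : Starts a (seg x α n) := by
  rcases n with _ | n
  · simp [starts_nil]
  · have hx : x α = a := by simpa using h
    rw [seg_succ, hx]
    exact starts_cons a _

lemma blocks_seg_eq {x : ℤ → A} {α : ℤ} {n l : ℕ} (hl : l < n) (hα : x α = a)
    (hx : x (α + l + 1) = a) (hnot : a ∉ seg x (α + 1) l) :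
    blocks a (seg x α n) = seg x (α + 1) l :: blocks a (seg x (α + l + 1) (n - l - 1)) := by
  have : seg x α n = x α :: seg x (α + 1) l ++ seg x (α + l + 1) (n - l - 1) := by
    conv_lhs => rw [show n = l + (n - l - 1) + 1 by omega]
    rw [seg_succ, seg_add, List.cons_append]
    congr 3
    ring
  rw [this, hα, blocks_cons_append a hnot (starts_seg (.inr hx))]

lemma exists_first_block {x : ℤ → A} {α : ℤ} {n : ℕ} (hn : 0 < n) (hx : x (α + n) = a) :
    ∃ l < n, x (α + l + 1) = a ∧ a ∉ seg x (α + 1) l := by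
  classical
  have hex : ∃ l : ℕ, x (α + l + 1) = a := ⟨n - 1, by
    convert hx using 2
    push_cast [Nat.cast_sub (show 1 ≤ n from hn)]
    ring⟩
  refine ⟨Nat.find hex, ?_, Nat.find_spec hex, ?_⟩
  · have := Nat.find_min' hex (m := n - 1) (by
      convert hx using 2
      push_cast [Nat.cast_sub (show 1 ≤ n from hn)]
      ring)
    omega
  · rw [mem_seg_iff]
    rintro ⟨i, h1, h2, h3⟩
    have := Nat.find_min' hex (m := (i - α - 1).toNat) (by
      convert h3 using 2
      omega)
    omega

lemma sum_length_blocks {l : List A} (h : Starts a l) :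
    ((blocks a l).map fun b => b.length + 1).sum = l.length := by
  have := congrArg List.length (initial_append_flatMap_blocks a l)
  rw [h, List.nil_append, List.length_flatMap] at this
  simpa using this

namespace IsAperiodicMarkov

/-- Exponential Chebyshev bound for sums over the blocks between two occurrences of `a`. -/
lemma real_sum_blocks_le (hμ : IsAperiodicMarkov μ) {V : List A → ℝ} {M : ℝ} (hM1 : 1 ≤ M)
    (hM : ∀ n, ∑ l ∈ Finset.range n, ∑ b ∈ words A l, blockProb μ a b * Real.exp (V b) ≤ M)
    (n : ℕ) (α : ℤ) (s : ℝ) :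
    μ.real {x | x α = a ∧ x (α + n) = a ∧ s ≤ ((blocks a (seg x α n)).map V).sum} ≤
      Real.exp (-s) * M ^ n := by
  have := hμ.isProbabilityMeasure
  induction n using Nat.strong_induction_on generalizing α s with
  | _ n ih =>
    rcases Nat.eq_zero_or_pos n with rfl | hn
    · by_cases hs : s ≤ 0
      · refine measureReal_le_one.trans ?_
        rw [pow_zero, mul_one]
        exact Real.one_le_exp (by linarith)
      · have : {x : ℤ → A | x α = a ∧ x (α + (0 : ℕ)) = a ∧
            s ≤ ((blocks a (seg x α 0)).map V).sum} = ∅ := by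
          ext x
          simp [hs]
        rw [this]
        simp only [measureReal_empty]
        positivity
    -- Split by the first block b, of length l. The rest is an event of the same kind over the
    -- distance n - l - 1 with threshold s - V b, independent of b given the `a` between them. As M
    -- ≥ 1, its power is at most M^(n-1), and summing the probabilities of b times exp (V b) gives
    -- the missing factor M. The number of blocks is random but at most n.
    · set G : ℕ → List A → Set (ℤ → A) := fun l b => {x | x (α + l + 1) = a ∧
        x (α + l + 1 + (n - l - 1 : ℕ)) = a ∧
        s - V b ≤ ((blocks a (seg x (α + l + 1) (n - l - 1))).map V).sum} with hG
      have hdep : ∀ l b, DependsOnIcc (G l b) (α + l + 1) (α + l + 1 + (n - l - 1 : ℕ)) := by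
        intro l b x y h hx
        simp only [hG, Set.mem_ofPred_eq] at hx ⊢
        rwa [← h _ le_rfl (by omega), ← h _ (by omega) le_rfl,
          ← seg_congr (x := x) fun i h1 h2 => h i (by omega) (by omega)]
      have hsub : {x | x α = a ∧ x (α + n) = a ∧ s ≤ ((blocks a (seg x α n)).map V).sum} ⊆
          ⋃ l ∈ Finset.range n, ⋃ b ∈ words A l,
            ({x | x α = a ∧ seg x (α + 1) l ∈ ({b} : Set (List A)) ∧ a ∉ seg x (α + 1) l} ∩
              ({x | x (α + l + 1) = a} ∩ G l b)) := by
        rintro x ⟨hα, hend, hs⟩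
        obtain ⟨l, hl, h1, h2⟩ := exists_first_block hn hend
        simp only [Set.mem_iUnion, Finset.mem_range, exists_prop]
        refine ⟨l, hl, seg x (α + 1) l, mem_words.2 (by simp), ⟨hα, rfl, h2⟩, h1, h1, ?_, ?_⟩
        · convert hend using 2
          push_cast [Nat.cast_sub (show l ≤ n from hl.le), Nat.sub_sub, Nat.cast_sub
            (show l + 1 ≤ n from hl)]
          ring
        · rw [blocks_seg_eq hl hα h1 h2, List.map_cons, List.sum_cons] at hs
          linarith
      refine (measureReal_mono hsub (measure_ne_top _ _)).trans ?_
      refine (measureReal_biUnion_finset_le _ _).trans ?_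
      have hb : ∀ l ∈ Finset.range n, μ.real (⋃ b ∈ words A l,
            ({x | x α = a ∧ seg x (α + 1) l ∈ ({b} : Set (List A)) ∧ a ∉ seg x (α + 1) l} ∩
              ({x | x (α + l + 1) = a} ∩ G l b))) ≤
          (∑ b ∈ words A l, blockProb μ a b * Real.exp (V b)) * (Real.exp (-s) * M ^ (n - 1)) := by
        intro l hl
        rw [Finset.mem_range] at hl
        refine (measureReal_biUnion_finset_le _ _).trans ?_
        rw [Finset.sum_mul]
        refine Finset.sum_le_sum fun b hb => ?_
        rw [hμ.real_block_inter _ _ _ _ (hdep l b)]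
        have hbl := mem_words.1 hb
        have e : blockProbSet μ a l {b} = blockProb μ a b := by rw [blockProb, hbl]
        rw [e, mul_assoc]
        refine mul_le_mul_of_nonneg_left ?_ (blockProb_nonneg b)
        have e2 : {x | x (α + l + 1) = a} ∩ G l b = G l b :=
          Set.inter_eq_right.2 fun x hx => hx.1
        rw [e2]
        refine (ih (n - l - 1) (by omega) (α + l + 1) (s - V b)).trans ?_
        rw [← mul_assoc, ← Real.exp_add]
        refine mul_le_mul (Real.exp_le_exp.2 (by linarith))
          (pow_le_pow_right₀ hM1 (by omega)) (by positivity) (Real.exp_pos _).le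
      refine (Finset.sum_le_sum hb).trans ?_
      rw [← Finset.sum_mul]
      refine (mul_le_mul_of_nonneg_right (hM n) (by positivity)).trans_eq ?_
      obtain ⟨k, rfl⟩ : ∃ k, n = k + 1 := ⟨n - 1, by omega⟩
      rw [Nat.add_sub_cancel, pow_succ]
      ring

/-- W grows linearly in the length of the block, and the length has a geometric tail. -/
lemma summable_sum_blockProb_mul (hμ : IsAperiodicMarkov μ) {W : List A → ℝ} {C₁ : ℝ}
    (hW : ∀ b, |W b| ≤ C₁ * (b.length + 1)) :
    Summable fun l => ∑ b ∈ words A l, blockProb μ a b * W b := by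
  obtain ⟨C, θ, hC, hθ0, hθ1, hf⟩ := hμ.exists_blockProbSet_bound a
  have hC₁ : 0 ≤ C₁ := by simpa using (abs_nonneg _).trans (hW [])
  have hs : Summable fun l : ℕ => C * C₁ * (((l : ℝ) + 1) * θ ^ l) := by
    refine Summable.mul_left _ ?_
    have hθ' : ‖θ‖ < 1 := by rwa [Real.norm_of_nonneg hθ0.le]
    have := (summable_pow_mul_geometric_of_norm_lt_one 1 hθ').add
      (summable_pow_mul_geometric_of_norm_lt_one 0 hθ')
    exact this.congr fun l => by ring
  refine Summable.of_norm_bounded hs fun l => ?_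
  rw [Real.norm_eq_abs]
  refine (Finset.abs_sum_le_sum_abs _ _).trans ?_
  calc ∑ b ∈ words A l, |blockProb μ a b * W b|
      ≤ ∑ b ∈ words A l, blockProb μ a b * (C₁ * (l + 1)) := by
        refine Finset.sum_le_sum fun b hb => ?_
        rw [abs_mul, abs_of_nonneg (blockProb_nonneg b)]
        refine mul_le_mul_of_nonneg_left ?_ (blockProb_nonneg b)
        rw [← mem_words.1 hb]
        exact hW b
    _ = blockProbSet μ a l Set.univ * (C₁ * (l + 1)) := by
        rw [← Finset.sum_mul, hμ.blockProbSet_univ]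
    _ ≤ C * θ ^ l * (C₁ * (l + 1)) := mul_le_mul_of_nonneg_right (hf l) (by positivity)
    _ = _ := by ring

/-- Second order bound for the moment generating function of a centred function of a block. -/
lemma exists_mgf_bound (hμ : IsAperiodicMarkov μ) {W : List A → ℝ} {C₁ : ℝ} (hC₁ : 0 ≤ C₁)
    (hW : ∀ b, |W b| ≤ C₁ * (b.length + 1))
    (h0 : ∑' l, ∑ b ∈ words A l, blockProb μ a b * W b = 0) :
    ∃ C₂ t₀ : ℝ, 0 ≤ C₂ ∧ 0 < t₀ ∧ ∀ t : ℝ, |t| ≤ t₀ → ∀ n,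
      ∑ l ∈ Finset.range n, ∑ b ∈ words A l, blockProb μ a b * Real.exp (t * W b) ≤
        1 + C₂ * t ^ 2 := by
  obtain ⟨C, θ, hC, hθ0, hθ1, hf⟩ := hμ.exists_blockProbSet_bound a
  set f : ℕ → ℝ := fun l => blockProbSet μ a l Set.univ with hfdef
  have hlog : Real.log θ < 0 := Real.log_neg hθ0 hθ1
  -- Small enough that exp(t₀ C₁) θ < 1, so that the exponential factor in the remainder does not
  -- spoil summability.
  set t₀ : ℝ := -Real.log θ / (2 * (C₁ + 1)) with ht₀
  have ht₀pos : 0 < t₀ := div_pos (by linarith) (by linarith)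
  set r : ℝ := Real.exp (t₀ * C₁) * θ with hr
  have hr0 : 0 ≤ r := by positivity
  have hr1 : r < 1 := by
    rw [hr, ← Real.exp_log hθ0, ← Real.exp_add, Real.exp_lt_one_iff]
    have : t₀ * C₁ ≤ -Real.log θ / 2 := by
      rw [ht₀, div_mul_eq_mul_div, div_le_div_iff₀ (by linarith) (by norm_num)]
      nlinarith
    linarith
  set g : ℕ → ℝ := fun l => C * Real.exp (t₀ * C₁) * C₁ ^ 2 * (((l : ℝ) + 1) ^ 2 * r ^ l) with hg
  have hr1' : ‖r‖ < 1 := by rwa [Real.norm_of_nonneg hr0]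
  have hgs : Summable g := by
    refine Summable.mul_left _ ?_
    have := ((summable_pow_mul_geometric_of_norm_lt_one 2 hr1').add
      ((summable_pow_mul_geometric_of_norm_lt_one 1 hr1').mul_left 2)).add
      (summable_pow_mul_geometric_of_norm_lt_one 0 hr1')
    refine this.congr fun l => ?_
    ring
  have hfs : Summable f := by
    refine Summable.of_nonneg_of_le (fun l => blockProbSet_nonneg _ _) hf ?_
    exact (summable_geometric_of_lt_one hθ0.le hθ1).mul_left C
  set w : ℕ → ℝ := fun l => ∑ b ∈ words A l, blockProb μ a b * W b with hw
  have hws : Summable w := hμ.summable_sum_blockProb_mul hW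
  have hg0 : ∀ l, 0 ≤ g l := fun l => by rw [hg]; positivity
  refine ⟨∑' l, g l, t₀, tsum_nonneg hg0, ht₀pos, fun t ht n => ?_⟩
  have hterm : ∀ l, ∑ b ∈ words A l, blockProb μ a b * Real.exp (t * W b) ≤
      f l + t * w l + t ^ 2 * g l := by
    intro l
    have hpt : ∀ b ∈ words A l, blockProb μ a b * Real.exp (t * W b) ≤
        blockProb μ a b + t * (blockProb μ a b * W b) +
          blockProb μ a b * (t ^ 2 * (C₁ * (l + 1)) ^ 2 * Real.exp (t₀ * (C₁ * (l + 1)))) := by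
      intro b hb
      have hWb := hW b
      rw [mem_words.1 hb] at hWb
      have h1 := exp_le_one_add_add (t * W b)
      have h2 : (t * W b) ^ 2 * Real.exp |t * W b| ≤
          t ^ 2 * (C₁ * (l + 1)) ^ 2 * Real.exp (t₀ * (C₁ * (l + 1))) := by
        refine mul_le_mul ?_ (Real.exp_le_exp.2 ?_) (Real.exp_pos _).le (by positivity)
        · rw [mul_pow]
          refine mul_le_mul_of_nonneg_left ?_ (sq_nonneg t)
          rw [← sq_abs (W b)]
          exact pow_le_pow_left₀ (abs_nonneg _) hWb 2
        · rw [abs_mul]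
          exact mul_le_mul ht hWb (abs_nonneg _) ht₀pos.le
      have h3 := mul_le_mul_of_nonneg_left (h1.trans (add_le_add_right h2 _))
        (blockProb_nonneg (μ := μ) (a := a) b)
      refine h3.trans_eq ?_
      ring
    refine (Finset.sum_le_sum hpt).trans ?_
    rw [Finset.sum_add_distrib, Finset.sum_add_distrib, ← Finset.mul_sum, ← Finset.sum_mul,
      ← hμ.blockProbSet_univ]
    refine add_le_add_right ?_ _
    have := mul_le_mul_of_nonneg_right (hf l) (show 0 ≤ t ^ 2 * (C₁ * ((l : ℝ) + 1)) ^ 2 *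
      Real.exp (t₀ * (C₁ * (l + 1))) by positivity)
    refine this.trans_eq ?_
    have hexp : Real.exp (t₀ * (C₁ * ((l : ℝ) + 1))) =
        Real.exp (t₀ * C₁) * Real.exp (t₀ * C₁) ^ l := by
      rw [← Real.exp_nat_mul, ← Real.exp_add]; congr 1; ring
    rw [hexp, hg, hr]
    simp only
    rw [mul_pow (Real.exp (t₀ * C₁)) θ]
    ring
  have hs : Summable fun l => f l + t * w l + t ^ 2 * g l :=
    (hfs.add (hws.mul_left t)).add (hgs.mul_left _)
  have hnn : ∀ l, 0 ≤ f l + t * w l + t ^ 2 * g l := fun l =>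
    (Finset.sum_nonneg fun b _ => mul_nonneg (blockProb_nonneg b) (Real.exp_pos _).le).trans
      (hterm l)
  calc _ ≤ ∑ l ∈ Finset.range n, (f l + t * w l + t ^ 2 * g l) :=
        Finset.sum_le_sum fun l _ => hterm l
    _ ≤ ∑' l, (f l + t * w l + t ^ 2 * g l) := hs.sum_le_tsum _ fun l _ => hnn l
    _ = ∑' l, f l + t * ∑' l, w l + t ^ 2 * ∑' l, g l := by
      rw [(hfs.add (hws.mul_left t)).tsum_add (hgs.mul_left _), hfs.tsum_add (hws.mul_left t),
        tsum_mul_left, tsum_mul_left]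
    _ ≤ _ := by
      rw [h0]
      -- The constant terms sum to at most 1, the linear term vanishes by centring, and the
      -- quadratic one is the claimed error.
      have : ∑' l, f l ≤ 1 := hfs.tsum_le_of_sum_range_le hμ.sum_blockProbSet_le_one
      linarith

end IsAperiodicMarkov

variable (μ a) in
/-- The mean information of a block, divided by the mean distance of the occurrences of `a`. -/
def infoRate : ℝ :=
  (∑' l, ∑ b ∈ words A l, blockProb μ a b * cost μ a b) /
    ∑' l, ∑ b ∈ words A l, blockProb μ a b * ((b.length : ℝ) + 1)

namespace IsAperiodicMarkov

/-- Moderate deviations of the information of the blocks between two occurrences of `a`. -/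
lemma exists_deviation_bound (hμ : IsAperiodicMarkov μ) (a : A) :
    ∃ K t₁ : ℝ, 0 < K ∧ 0 < t₁ ∧ ∀ (n : ℕ) (α : ℤ) (s : ℝ), 0 < n →
      μ.real {x | x α = a ∧ x (α + n) = a ∧
        s * √n ≤ |((blocks a (seg x α n)).map (cost μ a)).sum - n * infoRate μ a|} ≤
          K * Real.exp (-(t₁ * s)) := by
  have := hμ.isProbabilityMeasure
  obtain ⟨C, hC, hcost⟩ := hμ.exists_cost_le a
  set η := infoRate μ a with hη
  set W : List A → ℝ := fun b => cost μ a b - η * (b.length + 1) with hW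
  have hc : ∀ b, |cost μ a b| ≤ C * (b.length + 1) := fun b => by
    rw [abs_of_nonneg (hμ.cost_nonneg b)]; exact hcost b
  have hl : ∀ b : List A, |(b.length : ℝ) + 1| ≤ 1 * (b.length + 1) := fun b => by
    rw [abs_of_nonneg (by positivity), one_mul]
  have hWb : ∀ b, |W b| ≤ (C + |η|) * (b.length + 1) := fun b => by
    refine (abs_sub _ _).trans ?_
    rw [abs_mul, add_mul]
    have := hl b
    rw [one_mul] at this
    exact add_le_add (hc b) (mul_le_mul_of_nonneg_left this (abs_nonneg _))
  have h0 : ∑' l, ∑ b ∈ words A l, blockProb μ a b * W b = 0 := by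
    have s1 := hμ.summable_sum_blockProb_mul (a := a) hc
    have s2 := hμ.summable_sum_blockProb_mul (a := a) hl
    have e : ∀ l, ∑ b ∈ words A l, blockProb μ a b * W b =
        ∑ b ∈ words A l, blockProb μ a b * cost μ a b -
          η * ∑ b ∈ words A l, blockProb μ a b * ((b.length : ℝ) + 1) := by
      intro l
      rw [Finset.mul_sum, ← Finset.sum_sub_distrib]
      exact Finset.sum_congr rfl fun b _ => by rw [hW]; ring
    simp only [e]
    rw [s1.tsum_sub (s2.mul_left η), tsum_mul_left, hη, infoRate]
    -- In the degenerate case `infoRate` is a division by zero; but then all block probabilities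
    -- vanish, and W still has mean zero.
    by_cases hz : ∑' l, ∑ b ∈ words A l, blockProb μ a b * ((b.length : ℝ) + 1) = 0
    · rw [hz, mul_zero, sub_zero]
      have hnn : ∀ l, 0 ≤ ∑ b ∈ words A l, blockProb μ a b * ((b.length : ℝ) + 1) := fun l =>
        Finset.sum_nonneg fun b _ => mul_nonneg (blockProb_nonneg b) (by positivity)
      have hz' := (hasSum_zero_iff_of_nonneg hnn).1 (hz ▸ s2.hasSum)
      have : ∀ l, ∑ b ∈ words A l, blockProb μ a b * cost μ a b = 0 := by
        intro l
        have h1 := (Finset.sum_eq_zero_iff_of_nonneg fun b _ =>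
          mul_nonneg (blockProb_nonneg b) (by positivity)).1 (congrFun hz' l)
        refine Finset.sum_eq_zero fun b hb => ?_
        have h2 := h1 b hb
        rw [mul_eq_zero] at h2
        rcases h2 with h2 | h2
        · rw [h2, zero_mul]
        · exact absurd h2 (by positivity)
      simp [this]
    · rw [div_mul_cancel₀ _ hz, sub_self]
  obtain ⟨C₂, t₀, hC₂, ht₀, hmgf⟩ := hμ.exists_mgf_bound (by positivity) hWb h0
  refine ⟨2 * Real.exp (C₂ * t₀ ^ 2), t₀, by positivity, ht₀, fun n α s hn => ?_⟩
  have hn' : (0 : ℝ) < n := Nat.cast_pos.2 hn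
  have hsq : 0 < √(n : ℝ) := Real.sqrt_pos.2 hn'
  have hsq1 : 1 ≤ √(n : ℝ) := by rw [Real.one_le_sqrt]; exact_mod_cast hn
  -- At this scale (1 + C₂ t²)^n stays bounded, while the threshold s √n contributes exp(-t s √n) =
  -- exp(-t₀ s).
  set t := t₀ / √(n : ℝ) with ht
  have htle : t ≤ t₀ := div_le_self ht₀.le hsq1
  have htpos : 0 < t := div_pos ht₀ hsq
  have htsq : t ^ 2 = t₀ ^ 2 / n := by rw [ht, div_pow, Real.sq_sqrt hn'.le]
  have hpow : (1 + C₂ * t ^ 2) ^ n ≤ Real.exp (C₂ * t₀ ^ 2) := by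
    calc (1 + C₂ * t ^ 2) ^ n ≤ (Real.exp (C₂ * t ^ 2)) ^ n :=
          pow_le_pow_left₀ (by positivity) (by linarith [Real.add_one_le_exp (C₂ * t ^ 2)]) n
      _ = _ := by
        rw [← Real.exp_nat_mul, htsq]; congr 1; field_simp
  have hone : 1 ≤ 1 + C₂ * t ^ 2 := by nlinarith [mul_nonneg hC₂ (sq_nonneg t)]
  have hp := hμ.real_sum_blocks_le hone (hmgf t (by rwa [abs_of_pos htpos])) n α (t₀ * s)
  have hm := hμ.real_sum_blocks_le (V := fun b => -t * W b) hone
    (by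
      have := hmgf (-t) (by rwa [abs_neg, abs_of_pos htpos])
      rwa [neg_sq] at this) n α (t₀ * s)
  have hsum : ∀ (x : ℤ → A), x α = a → ((blocks a (seg x α n)).map W).sum =
      ((blocks a (seg x α n)).map (cost μ a)).sum - n * η := by
    intro x hx
    have h1 := sum_length_blocks (starts_seg (n := n) (.inr hx))
    rw [length_seg] at h1
    have h2 : ∀ L : List (List A), (L.map W).sum =
        (L.map (cost μ a)).sum - ((L.map fun b => b.length + 1).sum : ℕ) * η := by
      intro L
      induction L with
      | nil => simp
      | cons b L ih =>
        simp only [List.map_cons, List.sum_cons]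
        rw [ih]
        simp only [hW]
        push_cast
        ring
    rw [h2, h1]
  have hmul : ∀ (c : ℝ) (L : List (List A)), (L.map fun b => c * W b).sum = c * (L.map W).sum := by
    intro c L
    exact List.sum_map_mul_left L W c
  have hsub : {x | x α = a ∧ x (α + n) = a ∧
      s * √n ≤ |((blocks a (seg x α n)).map (cost μ a)).sum - n * η|} ⊆
      {x | x α = a ∧ x (α + n) = a ∧ t₀ * s ≤ ((blocks a (seg x α n)).map fun b => t * W b).sum} ∪
      {x | x α = a ∧ x (α + n) = a ∧
        t₀ * s ≤ ((blocks a (seg x α n)).map fun b => -t * W b).sum} := by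
    rintro x ⟨h1, h2, h3⟩
    rw [← hsum x h1, le_abs] at h3
    have e : t₀ * s = t * (s * √n) := by rw [ht]; field_simp
    rcases h3 with h3 | h3
    · refine .inl ⟨h1, h2, ?_⟩
      rw [hmul, e]
      exact mul_le_mul_of_nonneg_left h3 htpos.le
    · refine .inr ⟨h1, h2, ?_⟩
      rw [hmul, e, neg_mul, ← mul_neg]
      exact mul_le_mul_of_nonneg_left h3 htpos.le
  refine (measureReal_mono hsub).trans ((measureReal_union_le _ _).trans ((add_le_add hp hm).trans ?_))
  have := mul_le_mul_of_nonneg_left hpow (Real.exp_pos (-(t₀ * s))).le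
  linarith

end IsAperiodicMarkov

end Deviation

/-! ### Occurrences of `a` and lengths of blocks -/

section HatWords

variable {A : Type*} [DecidableEq A] {a : A}

variable (a) in
/-- The occurrences of `a` in a word. -/
def hatList (l : List A) : List Bool := l.map fun c => decide (c = a)

lemma length_blocks_of_hatList_eq {l l' : List A} (h : hatList a l = hatList a l') :
    (blocks a l).map List.length = (blocks a l').map List.length ∧
      (initial a l).length = (initial a l').length := by
  induction l generalizing l' with
  | nil =>
    rcases l' with _ | ⟨c, l'⟩
    · simp
    · simp [hatList] at h
  | cons c l ih =>
    rcases l' with _ | ⟨c', l'⟩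
    · simp [hatList] at h
    · simp only [hatList, List.map_cons, List.cons.injEq, decide_eq_decide] at h ih
      obtain ⟨h1, h2⟩ := ih h.2
      by_cases hc : c = a
      · have hc' := h.1.1 hc
        subst hc hc'
        simp [blocks_cons_self, initial_cons_self, h1, h2]
      · have hc' : c' ≠ a := fun e => hc (h.1.2 e)
        simp [blocks_cons_of_ne, initial_cons_of_ne, hc, hc', h1, h2]

lemma hatList_eq_flatMap {l : List A} (h : Starts a l) :
    hatList a l =
      ((blocks a l).map List.length).flatMap fun n => true :: List.replicate n false := by
  have h1 := initial_append_flatMap_blocks a l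
  rw [h, List.nil_append] at h1
  conv_lhs => rw [← h1]
  rw [hatList, List.map_flatMap, List.flatMap_map]
  refine List.flatMap_congr fun b hb => ?_
  have hab := notMem_of_mem_blocks a hb
  simp only [List.map_cons, decide_true, List.cons.injEq, true_and]
  refine List.eq_replicate_iff.2 ⟨by simp, fun c hc => ?_⟩
  rw [List.mem_map] at hc
  obtain ⟨d, hd, rfl⟩ := hc
  exact decide_eq_false fun h => hab (h ▸ hd)

/-- In words that are empty or begin with `a`, the occurrences of `a` and the lengths of the blocks
are the same data. Hence conditioning on the former is conditioning on the latter. -/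
lemma hatList_eq_iff {l l' : List A} (h : Starts a l) (h' : Starts a l') :
    hatList a l = hatList a l' ↔ (blocks a l).map List.length = (blocks a l').map List.length :=
  ⟨fun e => (length_blocks_of_hatList_eq e).1, fun e => by
    rw [hatList_eq_flatMap h, hatList_eq_flatMap h', e]⟩

lemma eq_of_blocks_eq {l l' : List A} (h : Starts a l) (h' : Starts a l')
    (he : blocks a l = blocks a l') : l = l' := by
  have h1 := initial_append_flatMap_blocks a l
  have h2 := initial_append_flatMap_blocks a l'
  rw [h, he] at h1
  rw [h'] at h2
  exact h1.symm.trans h2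

lemma hatList_seg (x : ℤ → A) (α : ℤ) (n : ℕ) : hatList a (seg x α n) = seg (hat a x) α n := by
  simp [hatList, seg, hat, List.map_ofFn, Function.comp_def]

end HatWords

/-! ### Block entropies as integrals, and probabilities of words -/

section Entropy

variable {A : Type*} [MeasurableSpace A] [MeasurableSingletonClass A] [Fintype A] [DecidableEq A]
  {μ : Measure (ℤ → A)} {a : A}

/-- Matching specified sets of blocks, given that the lengths of the blocks are those of `x`. -/
lemma mem_matches_iff_hatList {x y : ℤ → A} {α : ℤ} {N : ℕ} (hα : x α = a)
    {sp : List (ℕ × Set (List A))} (hsp : sp.map Prod.fst = (blocks a (seg x α N)).map List.length) :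
    y ∈ Matches a α sp ↔ (y α = a ∧ y (α + N) = a ∧ hatList a (seg y α N) = hatList a (seg x α N)) ∧
      List.Forall₂ (fun b s => b ∈ s.2) (blocks a (seg y α N)) sp := by
  have hN : specLength sp = N := by
    have h1 := sum_length_blocks (starts_seg (x := x) (α := α) (n := N) (.inr hα))
    rw [length_seg] at h1
    have h2 := congrArg (fun L : List ℕ => (L.map fun n => n + 1).sum) hsp
    simp only [List.map_map, Function.comp_def] at h2
    rw [specLength, h2, h1]
  rw [mem_matches_iff, hN]
  constructor
  · rintro ⟨h1, h2, h3⟩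
    have hl : (blocks a (seg y α N)).map List.length = sp.map Prod.fst := by
      clear hsp hN
      generalize blocks a (seg y α N) = L at h3
      induction h3 with
      | nil => rfl
      | cons h _ ih => simp [h.1, ih]
    refine ⟨⟨h2, h1, ?_⟩, h3.imp fun _ _ h => h.2⟩
    rw [hatList_eq_iff (starts_seg (.inr h2)) (starts_seg (.inr hα)), hl, hsp]
  · rintro ⟨⟨h2, h1, h3⟩, h4⟩
    refine ⟨h1, h2, ?_⟩
    rw [hatList_eq_iff (starts_seg (.inr h2)) (starts_seg (.inr hα)), ← hsp] at h3
    clear hsp hN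
    generalize blocks a (seg y α N) = L at h3 h4
    induction h4 with
    | nil => exact .nil
    | cons h _ ih =>
      simp only [List.map_cons, List.cons.injEq] at h3
      exact .cons ⟨h3.1, h⟩ (ih h3.2)

lemma dependsOnIcc_seg (α : ℤ) (n : ℕ) (P : List A → Prop) {s t : ℤ} (hs : s ≤ α)
    (ht : α + n ≤ t + 1) : DependsOnIcc {x : ℤ → A | P (seg x α n)} s t := by
  intro x y h hx
  simp only [Set.mem_ofPred_eq] at hx ⊢
  rwa [← seg_congr (x := x) fun i h1 h2 => h i (by omega) (by omega)]

lemma measurable_comp_seg (f : List A → ℝ) (α : ℤ) (n : ℕ) :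
    Measurable fun x : ℤ → A => f (seg x α n) := fun T _ =>
  (dependsOnIcc_seg α n (fun u => f u ∈ T) le_rfl (show α + n ≤ α + n + 1 by omega)).measurableSet

lemma integrable_comp_seg (μ : Measure (ℤ → A)) [IsFiniteMeasure μ] (f : List A → ℝ) (α : ℤ)
    (n : ℕ) : Integrable (fun x : ℤ → A => f (seg x α n)) μ := by
  refine Integrable.of_bound (measurable_comp_seg f α n).aestronglyMeasurable
    (∑ u ∈ words A n, |f u|) (Eventually.of_forall fun x => ?_)
  exact Finset.single_le_sum (f := fun u => |f u|) (fun u _ => abs_nonneg _)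
    (mem_words.2 (length_seg x α n))

lemma integral_comp_seg (μ : Measure (ℤ → A)) [IsFiniteMeasure μ] (f : List A → ℝ) (α : ℤ)
    (n : ℕ) : ∫ x, f (seg x α n) ∂μ = ∑ u ∈ words A n, μ.real {x | seg x α n = u} * f u := by
  have : ∀ x : ℤ → A, f (seg x α n) =
      ∑ u ∈ words A n, ({x | seg x α n = u} : Set (ℤ → A)).indicator (fun _ => f u) x := by
    intro x
    rw [Finset.sum_eq_single (seg x α n)]
    · rw [Set.indicator_of_mem]; rfl
    · intro u _ hu
      exact Set.indicator_of_notMem (fun h => hu h.symm) _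
    · intro h; exact absurd (mem_words.2 (length_seg x α n)) h
  simp_rw [this]
  rw [integral_finsetSum]
  · refine Finset.sum_congr rfl fun u _ => ?_
    rw [integral_indicator_const _ (measurableSet_seg _ _ _), smul_eq_mul]
  · intro u _
    exact (integrable_const _).indicator (measurableSet_seg _ _ _)

/-- Entropy as mean information, so that pointwise estimates of the information can be integrated.
-/
lemma blockEntropy_eq_integral (μ : Measure (ℤ → A)) [IsFiniteMeasure μ] (n : ℕ) :
    blockEntropy μ n = -∫ x, Real.log (μ.real {y | seg y 0 n = seg x 0 n}) ∂μ := by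
  rw [integral_comp_seg μ (fun u => Real.log (μ.real {y | seg y 0 n = u})), blockEntropy, words,
    Finset.sum_image (fun _ _ _ _ h => List.ofFn_injective h), ← Finset.sum_neg_distrib]
  refine Finset.sum_congr rfl fun w _ => ?_
  have : {x : ℤ → A | ∀ j : Fin n, x ((j : ℕ) : ℤ) = w j} = {x | seg x 0 n = List.ofFn w} := by
    ext x
    simp only [seg, Set.mem_ofPred_eq, List.ofFn_inj, funext_iff, zero_add]
  rw [this, Real.negMulLog, neg_mul]

lemma measurable_hat (a : A) : Measurable (hat a : (ℤ → A) → ℤ → Bool) := by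
  refine measurable_pi_lambda _ fun n => ?_
  refine measurable_to_bool ?_
  have : (fun x : ℤ → A => hat a x n) ⁻¹' {true} = {x | x n = a} := by ext x; simp [hat]
  rw [this]
  exact measurableSet_coord n a

lemma blockEntropy_hatLaw (μ : Measure (ℤ → A)) [IsFiniteMeasure μ] (a : A) (n : ℕ) :
    blockEntropy (hatLaw μ a) n =
      -∫ x, Real.log (μ.real {y | hatList a (seg y 0 n) = hatList a (seg x 0 n)}) ∂μ := by
  have : IsFiniteMeasure (hatLaw μ a) := by rw [hatLaw]; infer_instance
  rw [blockEntropy_eq_integral, hatLaw,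
    integral_map (measurable_hat a).aemeasurable
      (measurable_comp_seg (fun u => Real.log ((μ.map (hat a)).real {y | seg y 0 n = u})) 0
        n).aestronglyMeasurable]
  congr 2
  funext x
  rw [map_measureReal_apply (measurable_hat a) (measurableSet_seg _ _ _)]
  simp only [hatList_seg]
  rfl

lemma ae_seg_pos (μ : Measure (ℤ → A)) [IsFiniteMeasure μ] :
    ∀ᵐ x ∂μ, ∀ (α : ℤ) (n : ℕ), 0 < μ.real {y | seg y α n = seg x α n} := by
  rw [ae_all_iff]
  intro α
  rw [ae_all_iff]
  intro n
  rw [ae_iff]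
  refine measure_mono_null (t := ⋃ u ∈ (words A n).filter (fun u => μ {y | seg y α n = u} = 0),
    {y | seg y α n = u}) (fun x hx => ?_) ?_
  · simp only [Set.mem_iUnion, Finset.mem_filter, exists_prop]
    refine ⟨seg x α n, ⟨mem_words.2 (length_seg _ _ _), ?_⟩, rfl⟩
    have h0 := le_antisymm (not_lt.1 hx) measureReal_nonneg
    rwa [measureReal_eq_zero_iff] at h0
  · exact (measure_biUnion_null_iff (Finset.countable_toSet
      ((words A n).filter (fun u => μ {y | seg y α n = u} = 0)))).2 fun u hu =>
        (Finset.mem_filter.1 hu).2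

namespace IsAperiodicMarkov

/-- From the second letter on, each letter of a Markov process adds the same amount κ to the block
entropy. Convergence is needed because `entropyRate` is a `limUnder`, which is meaningful only when
the limit exists. -/
lemma exists_tendsto_blockEntropy (hμ : IsAperiodicMarkov μ) :
    ∃ h, Tendsto (fun n : ℕ => blockEntropy μ n / n) atTop (𝓝 h) := by
  have := hμ.isProbabilityMeasure
  set g : List A → ℝ := fun u => Real.log (μ.real {y | seg y 0 2 = u}) -
    Real.log (μ.real {y | seg y 0 1 = u.take 1}) with hg
  set κ : ℝ := -∫ x, g (seg x 0 2) ∂μ with hκ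
  have hstep : ∀ n, blockEntropy μ (n + 2) = blockEntropy μ (n + 1) + κ := by
    intro n
    have hst : ∫ x, g (seg x 0 2) ∂μ = ∫ x, g (seg x n 2) ∂μ := by
      conv_lhs => rw [← (measurePreserving_shiftBy hμ.stationary n).map_eq]
      rw [integral_map (measurable_shiftBy _).aemeasurable
        (measurable_comp_seg g 0 2).aestronglyMeasurable]
      simp [seg_shiftBy]
    rw [hκ, hst, blockEntropy_eq_integral, blockEntropy_eq_integral, ← neg_add, neg_inj,
      ← integral_add (integrable_comp_seg μ (fun u => Real.log (μ.real {y | seg y 0 (n + 1) = u}))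
        0 (n + 1)) (integrable_comp_seg μ g n 2)]
    refine integral_congr_ae ?_
    filter_upwards [ae_seg_pos μ] with x hx
    have key := hμ.real_seg_inter n n 1 x
    rw [sub_self] at key
    have e1 : {y | seg y 0 (n + 1) = seg x 0 (n + 1)} ∩ {y | seg y n (1 + 1) = seg x n (1 + 1)} =
        {y : ℤ → A | seg y 0 (n + 2) = seg x 0 (n + 2)} := by
      ext y
      simp only [Set.mem_inter_iff, Set.mem_ofPred_eq, seg_eq_seg_iff]
      constructor
      · rintro ⟨h1, h2⟩ i hi hi'
        by_cases h : i < n + 1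
        · exact h1 i hi (by push_cast; omega)
        · exact h2 i (by omega) (by push_cast at hi' ⊢; omega)
      · intro h
        exact ⟨fun i h1 h2 => h i h1 (by push_cast at h2 ⊢; omega),
          fun i h1 h2 => h i (by omega) (by push_cast at h2 ⊢; omega)⟩
    rw [e1] at key
    have e2 : ∀ u : List A, μ.real {y | seg y n 2 = u} = μ.real {y | seg y 0 2 = u} := by
      intro u
      rw [← hμ.shift_eq (measurableSet_seg 0 2 u) n]
      simp [seg_shiftBy]
    have e3 : μ.real {y | seg y 0 1 = (seg x n 2).take 1} = μ.real {y | y 0 = x n} := by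
      simp [seg_succ]
    have p1 := hx 0 (n + 2)
    have p2 := hx 0 (n + 1)
    have p3 := hx n 2
    have p4 := hμ.pos_coord (x n)
    have hl := congrArg Real.log key
    rw [Real.log_mul p1.ne' p4.ne', Real.log_mul p2.ne' p3.ne'] at hl
    simp only [hg]
    rw [e3, ← e2]
    linarith
  have hform : ∀ n : ℕ, blockEntropy μ (n + 1) = blockEntropy μ 1 + n * κ := by
    intro n
    induction n with
    | zero => simp
    | succ n ih => rw [hstep, ih]; push_cast; ring
  refine ⟨κ, (tendsto_add_atTop_iff_nat 1).1 ?_⟩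
  have h1 : Tendsto (fun n : ℕ => (blockEntropy μ 1 - κ) / ((n : ℝ) + 1) + κ) atTop (𝓝 (0 + κ)) := by
    refine Tendsto.add_const _ ?_
    refine tendsto_const_nhds.div_atTop ?_
    exact tendsto_atTop_add_const_right _ _ tendsto_natCast_atTop_atTop
  rw [zero_add] at h1
  refine h1.congr fun n => ?_
  rw [hform n]
  push_cast
  have : (n : ℝ) + 1 ≠ 0 := by positivity
  field_simp
  ring

/-- Prescribing the occurrences of `a` prescribes only the lengths of the blocks: `real_matches`
with every set equal to `univ`. With singletons instead, the next lemma treats a prescribed word. -/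
lemma real_matches_univ (hμ : IsAperiodicMarkov μ) {x : ℤ → A} {α : ℤ} {N : ℕ} (hα : x α = a) :
    μ.real {y | y α = a ∧ y (α + N) = a ∧ hatList a (seg y α N) = hatList a (seg x α N)} =
      μ.real {x | x 0 = a} *
        ((blocks a (seg x α N)).map fun b => blockProbSet μ a b.length Set.univ).prod := by
  have h := hμ.real_matches (a := a) α
    ((blocks a (seg x α N)).map fun b => (b.length, Set.univ))
  rw [List.map_map] at h
  rw [show ((blocks a (seg x α N)).map fun b => blockProbSet μ a b.length Set.univ) =
    ((blocks a (seg x α N)).map ((fun s : ℕ × Set (List A) => blockProbSet μ a s.1 s.2) ∘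
      fun b => (b.length, Set.univ))) from rfl, ← h]
  congr 1
  ext y
  rw [mem_matches_iff_hatList (x := x) (N := N) hα (by simp [List.map_map, Function.comp_def]),
    Set.mem_ofPred_eq]
  refine ⟨fun h => ⟨h, ?_⟩, fun h => h.1⟩
  have hl := (length_blocks_of_hatList_eq h.2.2).1
  rw [List.forall₂_map_right_iff]
  have hl' := congrArg List.length hl
  simp only [List.length_map] at hl'
  exact List.forall₂_iff_get.2 ⟨hl', fun _ _ _ => trivial⟩

lemma real_matches_singleton (hμ : IsAperiodicMarkov μ) {x : ℤ → A} {α : ℤ} {N : ℕ}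
    (hα : x α = a) :
    μ.real {y | y α = a ∧ y (α + N) = a ∧ seg y α N = seg x α N} =
      μ.real {x | x 0 = a} * ((blocks a (seg x α N)).map (blockProb μ a)).prod := by
  have h := hμ.real_matches (a := a) α ((blocks a (seg x α N)).map fun b => (b.length, {b}))
  rw [List.map_map] at h
  rw [show ((blocks a (seg x α N)).map (blockProb μ a)) =
    ((blocks a (seg x α N)).map ((fun s : ℕ × Set (List A) => blockProbSet μ a s.1 s.2) ∘
      fun b => (b.length, {b}))) from rfl, ← h]
  congr 1
  ext y
  rw [mem_matches_iff_hatList (x := x) (N := N) hα (by simp [List.map_map, Function.comp_def]),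
    Set.mem_ofPred_eq, List.forall₂_map_right_iff]
  constructor
  · rintro ⟨h1, h2, h3⟩
    refine ⟨⟨h1, h2, by rw [h3]⟩, ?_⟩
    rw [h3]
    exact List.forall₂_same.2 fun b _ => rfl
  · rintro ⟨⟨h1, h2, -⟩, h3⟩
    refine ⟨h1, h2, eq_of_blocks_eq (starts_seg (.inr h1)) (starts_seg (.inr hα)) ?_⟩
    exact List.forall₂_eq_eq_eq ▸ (h3.imp fun _ _ h => h)

/-- Independence of three successive parts that are separated by occurrences of `a`. -/
lemma real_inter_three (hμ : IsAperiodicMarkov μ) {s t n : ℕ} (hst : s ≤ t) (htn : t ≤ n)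
    {F G H : Set (ℤ → A)} (hF : DependsOnIcc F 0 s) (hG : DependsOnIcc G s t)
    (hH : DependsOnIcc H t n) :
    μ.real (F ∩ {x | x s = a} ∩ ({x | x s = a} ∩ G ∩ {x | x t = a} ∩ ({x | x t = a} ∩ H))) *
        μ.real {x | x 0 = a} ^ 2 =
      μ.real (F ∩ {x | x s = a}) * μ.real ({x | x s = a} ∩ G ∩ {x | x t = a}) *
        μ.real ({x | x t = a} ∩ H) := by
  have h1 := hμ.real_inter s s (n - s) a (F := F) (G := G ∩ {x | x t = a} ∩ H)
    (by simpa using hF) (fun x y h hx => by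
      refine ⟨⟨hG x y (fun i h1 h2 => h i h1 (by omega)) hx.1.1, ?_⟩,
        hH x y (fun i h1 h2 => h i (by omega) (by omega)) hx.2⟩
      rw [Set.mem_ofPred_eq, ← h t (by omega) (by omega)]
      exact hx.1.2)
  have h2 := hμ.real_inter t (t - s) (n - t) a (F := {x | x s = a} ∩ G) (G := H)
    (fun x y h hx => by
      refine ⟨?_, hG x y (fun i h1 h2 => h i (by omega) h2) hx.2⟩
      rw [Set.mem_ofPred_eq, ← h s (by omega) (by omega)]
      exact hx.1)
    (fun x y h hx => hH x y (fun i h1 h2 => h i h1 (by omega)) hx)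
  have e1 : F ∩ {x | x s = a} ∩ ({x | x s = a} ∩ G ∩ {x | x t = a} ∩ ({x | x t = a} ∩ H)) =
      F ∩ {x | x s = a} ∩ (G ∩ {x | x t = a} ∩ H) := by
    ext x; simp only [Set.mem_inter_iff]; tauto
  have e2 : {x : ℤ → A | x s = a} ∩ (G ∩ {x | x t = a} ∩ H) =
      {x | x s = a} ∩ G ∩ {x | x t = a} ∩ H := by
    ext x; simp only [Set.mem_inter_iff]; tauto
  rw [e1, sq, ← mul_assoc, h1, e2, mul_assoc, h2, mul_assoc]

end IsAperiodicMarkov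

end Entropy

/-! ### Identification of the conditional entropy -/

section EntropyRate

variable {A : Type*} [MeasurableSpace A] [MeasurableSingletonClass A] [Fintype A] [DecidableEq A]
  {μ : Measure (ℤ → A)} {a : A}

lemma log_sub_log_bounds {p q c : ℝ} {k : ℕ} (hc : 0 < c) (hp : c ^ k ≤ p) (hpq : p ≤ q)
    (hq : q ≤ 1) : 0 ≤ Real.log q - Real.log p ∧ Real.log q - Real.log p ≤ k * -Real.log c := by
  have hck : 0 < c ^ k := pow_pos hc k
  have h1 := Real.log_le_log (hck.trans_le hp) hpq
  have h2 := Real.log_le_log hck hp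
  have h3 := Real.log_nonpos ((hck.trans_le hp).le.trans hpq) hq
  rw [Real.log_pow] at h2
  constructor
  · linarith
  · linarith

namespace IsAperiodicMarkov

lemma log_prod_sub_log_prod (hμ : IsAperiodicMarkov μ) {L : List (List A)}
    (hL : ∀ b ∈ L, 0 < blockProb μ a b) :
    0 < (L.map (blockProb μ a)).prod ∧
    0 < (L.map fun b => blockProbSet μ a b.length Set.univ).prod ∧
    Real.log (L.map fun b => blockProbSet μ a b.length Set.univ).prod -
      Real.log (L.map (blockProb μ a)).prod = (L.map (cost μ a)).sum := by
  induction L with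
  | nil => simp
  | cons b L ih =>
    obtain ⟨h1, h2, h3⟩ := ih fun b hb => hL b (List.mem_cons_of_mem _ hb)
    have hb := hL b List.mem_cons_self
    have hu := hμ.univ_pos hb
    simp only [List.map_cons, List.prod_cons, List.sum_cons]
    refine ⟨by positivity, by positivity, ?_⟩
    rw [Real.log_mul hu.ne' h2.ne', Real.log_mul hb.ne' h1.ne', ← h3, cost, norm_eq_self hb,
      condProb, Real.log_div hb.ne' hu.ne']
    ring

/-- Almost surely, all blocks that occur are possible. -/
lemma blockProb_pos_of_mem (hμ : IsAperiodicMarkov μ) {x : ℤ → A}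
    (hx : ∀ (α : ℤ) (n : ℕ), 0 < μ.real {y | seg y α n = seg x α n}) {α : ℤ} {N : ℕ}
    (h1 : x α = a) (h2 : x (α + N) = a) :
    ∀ b ∈ blocks a (seg x α N), 0 < blockProb μ a b := by
  have hp : 0 < μ.real {y | y α = a ∧ y (α + N) = a ∧ seg y α N = seg x α N} := by
    convert hx α (N + 1) using 2
    ext y
    simp only [Set.mem_ofPred_eq, seg_eq_seg_iff]
    constructor
    · rintro ⟨h3, h4, h5⟩ i hi hi'
      by_cases hN : i < α + N
      · exact h5 i hi hN
      · rw [show i = α + N by push_cast at hi'; omega, h2, h4]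
    · intro h
      exact ⟨(h _ le_rfl (by omega)).trans h1, (h _ (by omega) (by push_cast; omega)).trans h2,
        fun i hi hi' => h i hi (by push_cast; omega)⟩
  rw [hμ.real_matches_singleton h1] at hp
  have hne := (pos_of_mul_pos_right hp measureReal_nonneg).ne'
  intro b hb
  refine lt_of_le_of_ne (blockProb_nonneg b) fun h0 => hne ?_
  exact List.prod_eq_zero (List.mem_map.2 ⟨b, hb, h0.symm⟩)

/-- The conditional information of a word, given the occurrences of `a`, differs from that of its
complete blocks by a boundary term. -/
lemma abs_information_sub_le (hμ : IsAperiodicMarkov μ) {c : ℝ} (hc0 : 0 < c)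
    (hc : ∀ (α : ℤ) (n : ℕ) (u : List A), 0 < μ.real {x | seg x α n = u} →
      c ^ n ≤ μ.real {x | seg x α n = u}) {x : ℤ → A}
    (hx : ∀ (α : ℤ) (n : ℕ), 0 < μ.real {y | seg y α n = seg x α n}) {s t n : ℕ} (hst : s ≤ t)
    (htn : t < n) (hs : x s = a) (ht : x t = a) :
    0 ≤ Real.log (μ.real {y | hatList a (seg y 0 n) = hatList a (seg x 0 n)}) -
        Real.log (μ.real {y | seg y 0 n = seg x 0 n}) -
        ((blocks a (seg x s (t - s))).map (cost μ a)).sum ∧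
    Real.log (μ.real {y | hatList a (seg y 0 n) = hatList a (seg x 0 n)}) -
        Real.log (μ.real {y | seg y 0 n = seg x 0 n}) -
        ((blocks a (seg x s (t - s))).map (cost μ a)).sum ≤ (s + 1 + (n - t)) * -Real.log c := by
  have := hμ.isProbabilityMeasure
  have hcast : ((t - s : ℕ) : ℤ) = t - s := by omega
  have hcast' : ((n - t : ℕ) : ℤ) = n - t := by omega
  -- The word and its hat word factorise at s and t in the same way, with the same power of the
  -- probability of `a`. So the difference of logarithms is a sum over three parts. The middle one
  -- is the total cost of the complete blocks; the outer ones are nonnegative and at most -log c per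
  -- letter.
  have k1 := hμ.real_inter_three (a := a) hst htn.le (F := {y | seg y 0 s = seg x 0 s})
    (G := {y | seg y s (t - s) = seg x s (t - s)}) (H := {y | seg y t (n - t) = seg x t (n - t)})
    (dependsOnIcc_seg 0 s (· = _) le_rfl (by omega))
    (dependsOnIcc_seg s (t - s) (· = _) le_rfl (by omega))
    (dependsOnIcc_seg t (n - t) (· = _) le_rfl (by omega))
  have k2 := hμ.real_inter_three (a := a) hst htn.le
    (F := {y | hatList a (seg y 0 s) = hatList a (seg x 0 s)})
    (G := {y | hatList a (seg y s (t - s)) = hatList a (seg x s (t - s))})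
    (H := {y | hatList a (seg y t (n - t)) = hatList a (seg x t (n - t))})
    (dependsOnIcc_seg 0 s (hatList a · = _) le_rfl (by omega))
    (dependsOnIcc_seg s (t - s) (hatList a · = _) le_rfl (by omega))
    (dependsOnIcc_seg t (n - t) (hatList a · = _) le_rfl (by omega))
  have e1 : {y | seg y 0 s = seg x 0 s} ∩ {y | y s = a} ∩
      ({y | y s = a} ∩ {y | seg y s (t - s) = seg x s (t - s)} ∩ {y | y t = a} ∩
        ({y | y t = a} ∩ {y | seg y t (n - t) = seg x t (n - t)})) =
      {y | seg y 0 n = seg x 0 n} := by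
    ext y
    simp only [Set.mem_inter_iff, Set.mem_ofPred_eq, seg_eq_seg_iff, hcast, hcast']
    constructor
    · rintro ⟨⟨h1, -⟩, ⟨⟨-, h2⟩, -⟩, -, h3⟩ i hi hi'
      by_cases his : i < s
      · exact h1 i hi (by omega)
      · by_cases hit : i < t
        · exact h2 i (by omega) (by omega)
        · exact h3 i (by omega) (by omega)
    · intro h
      have hys := (h s (by omega) (by omega)).trans hs
      have hyt := (h t (by omega) (by omega)).trans ht
      exact ⟨⟨fun i h1 h2 => h i h1 (by omega), hys⟩,
        ⟨⟨hys, fun i h1 h2 => h i (by omega) (by omega)⟩, hyt⟩, hyt,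
        fun i h1 h2 => h i (by omega) (by omega)⟩
  have e2 : {y | hatList a (seg y 0 s) = hatList a (seg x 0 s)} ∩ {y | y s = a} ∩
      ({y | y s = a} ∩ {y | hatList a (seg y s (t - s)) = hatList a (seg x s (t - s))} ∩
        {y | y t = a} ∩
        ({y | y t = a} ∩ {y | hatList a (seg y t (n - t)) = hatList a (seg x t (n - t))})) =
      {y | hatList a (seg y 0 n) = hatList a (seg x 0 n)} := by
    ext y
    simp only [Set.mem_inter_iff, Set.mem_ofPred_eq, hatList_seg, seg_eq_seg_iff, hcast, hcast']
    constructor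
    · rintro ⟨⟨h1, -⟩, ⟨⟨-, h2⟩, -⟩, -, h3⟩ i hi hi'
      by_cases his : i < s
      · exact h1 i hi (by omega)
      · by_cases hit : i < t
        · exact h2 i (by omega) (by omega)
        · exact h3 i (by omega) (by omega)
    · intro h
      have hys : y s = a := (decide_eq_decide.1 (h s (by omega) (by omega))).2 hs
      have hyt : y t = a := (decide_eq_decide.1 (h t (by omega) (by omega))).2 ht
      exact ⟨⟨fun i h1 h2 => h i h1 (by omega), hys⟩,
        ⟨⟨hys, fun i h1 h2 => h i (by omega) (by omega)⟩, hyt⟩, hyt,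
        fun i h1 h2 => h i (by omega) (by omega)⟩
  rw [e1] at k1
  rw [e2] at k2
  have f1 : {y | seg y 0 s = seg x 0 s} ∩ {y | y s = a} =
      {y | seg y 0 (s + 1) = seg x 0 (s + 1)} := by
    ext y
    simp only [Set.mem_inter_iff, Set.mem_ofPred_eq, seg_eq_seg_iff]
    constructor
    · rintro ⟨h1, h2⟩ i hi hi'
      by_cases his : i < s
      · exact h1 i hi (by omega)
      · rw [show i = s by push_cast at hi'; omega, h2, hs]
    · intro h
      exact ⟨fun i h1 h2 => h i h1 (by push_cast; omega),
        (h s (by omega) (by push_cast; omega)).trans hs⟩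
  have f3 : {y | y t = a} ∩ {y | seg y t (n - t) = seg x t (n - t)} =
      {y | seg y t (n - t) = seg x t (n - t)} := by
    refine Set.inter_eq_right.2 fun y hy => ?_
    rw [Set.mem_ofPred_eq, seg_eq_seg_iff] at hy
    exact (hy t le_rfl (by omega)).trans ht
  have hend : ∀ y : ℤ → A, y t = y ((s : ℤ) + (t - s : ℕ)) := fun y => by
    congr 1; omega
  have f2 : {y | y s = a} ∩ {y | seg y s (t - s) = seg x s (t - s)} ∩ {y | y t = a} =
      {y | y s = a ∧ y ((s : ℤ) + (t - s : ℕ)) = a ∧ seg y s (t - s) = seg x s (t - s)} := by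
    ext y
    simp only [Set.mem_inter_iff, Set.mem_ofPred_eq, hend y]
    tauto
  have f2' : {y | y s = a} ∩ {y | hatList a (seg y s (t - s)) = hatList a (seg x s (t - s))} ∩
      {y | y t = a} = {y | y s = a ∧ y ((s : ℤ) + (t - s : ℕ)) = a ∧
        hatList a (seg y s (t - s)) = hatList a (seg x s (t - s))} := by
    ext y
    simp only [Set.mem_inter_iff, Set.mem_ofPred_eq, hend y]
    tauto
  obtain ⟨g1, g2, g3⟩ := hμ.log_prod_sub_log_prod
    (hμ.blockProb_pos_of_mem hx hs ((hend x).symm.trans ht))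
  have hπ := hμ.pos_coord a
  have q1 := hc 0 (s + 1) _ (hx 0 (s + 1))
  have q3 := hc t (n - t) _ (hx t (n - t))
  have m1 : μ.real ({y | seg y 0 s = seg x 0 s} ∩ {y | y s = a}) ≤
      μ.real ({y | hatList a (seg y 0 s) = hatList a (seg x 0 s)} ∩ {y | y s = a}) :=
    measureReal_mono fun y hy => ⟨congrArg (hatList a) hy.1, hy.2⟩
  have m3 : μ.real ({y | y t = a} ∩ {y | seg y t (n - t) = seg x t (n - t)}) ≤
      μ.real ({y | y t = a} ∩ {y | hatList a (seg y t (n - t)) = hatList a (seg x t (n - t))}) :=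
    measureReal_mono fun y hy => ⟨hy.1, congrArg (hatList a) hy.2⟩
  rw [← f1] at q1
  rw [← f3] at q3
  have b1 := log_sub_log_bounds hc0 q1 m1 measureReal_le_one
  have b3 := log_sub_log_bounds hc0 q3 m3 measureReal_le_one
  have p1 := (pow_pos hc0 _).trans_le q1
  have p3 := (pow_pos hc0 _).trans_le q3
  have p1' := p1.trans_le m1
  have p3' := p3.trans_le m3
  have p2 : 0 < μ.real ({y | y s = a} ∩ {y | seg y s (t - s) = seg x s (t - s)} ∩ {y | y t = a}) := by
    rw [f2, hμ.real_matches_singleton hs]; positivity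
  have p2' : 0 < μ.real ({y | y s = a} ∩
      {y | hatList a (seg y s (t - s)) = hatList a (seg x s (t - s))} ∩ {y | y t = a}) := by
    rw [f2', hμ.real_matches_univ hs]; positivity
  have b2 : Real.log (μ.real ({y | y s = a} ∩
      {y | hatList a (seg y s (t - s)) = hatList a (seg x s (t - s))} ∩ {y | y t = a})) -
      Real.log (μ.real ({y | y s = a} ∩ {y | seg y s (t - s) = seg x s (t - s)} ∩ {y | y t = a})) =
      ((blocks a (seg x s (t - s))).map (cost μ a)).sum := by
    rw [f2, f2', hμ.real_matches_singleton hs, hμ.real_matches_univ hs, Real.log_mul hπ.ne' g1.ne',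
      Real.log_mul hπ.ne' g2.ne', ← g3]
    ring
  have pn := hx 0 n
  have pn' : 0 < μ.real {y | hatList a (seg y 0 n) = hatList a (seg x 0 n)} :=
    pn.trans_le (measureReal_mono fun y hy => congrArg (hatList a) hy)
  have l1 := congrArg Real.log k1
  have l2 := congrArg Real.log k2
  rw [Real.log_mul pn.ne' (by positivity), Real.log_mul (by positivity) p3.ne',
    Real.log_mul p1.ne' p2.ne'] at l1
  rw [Real.log_mul pn'.ne' (by positivity), Real.log_mul (by positivity) p3'.ne',
    Real.log_mul p1'.ne' p2'.ne'] at l2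
  push_cast [Nat.cast_sub htn.le] at b1 b3
  constructor
  · linarith
  · linarith

/-- The exceptional set in the ergodic theorem for the conditional information. -/
lemma exists_bad_set (hμ : IsAperiodicMarkov μ) (a : A) :
    ∃ (E : ℕ → Set (ℤ → A)) (M : ℝ), 0 ≤ M ∧ (∀ n, MeasurableSet (E n)) ∧
      Tendsto (fun n => μ.real (E n)) atTop (𝓝 0) ∧
      ∀ᵐ x ∂μ, ∀ n : ℕ, 4 ≤ n → x ∉ E n →
        |Real.log (μ.real {y | hatList a (seg y 0 n) = hatList a (seg x 0 n)}) -
          Real.log (μ.real {y | seg y 0 n = seg x 0 n}) - n * infoRate μ a| ≤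
          M * √n + √√n * √n := by
  have := hμ.isProbabilityMeasure
  obtain ⟨C, θ, hC, hθ0, hθ1, htail⟩ := hμ.exists_tail_bound a
  obtain ⟨K, t₁, hK, ht₁, hdev⟩ := hμ.exists_deviation_bound a
  obtain ⟨c, hc0, hc1, hc⟩ := hμ.exists_lower_bound
  have hlog : 0 ≤ -Real.log c := neg_nonneg.2 (Real.log_nonpos hc0.le hc1)
  -- Deviations by n^(1/4) √N between occurrences of `a` at s and s + N. There are at most n² pairs
  -- (s, N), each event has probability at most K exp(-t₁ n^(1/4)), and the deviation that remains
  -- allowed is o(n).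
  set B : ℕ → ℕ → ℕ → Set (ℤ → A) := fun n s N => {x | x s = a ∧ x ((s : ℤ) + N) = a ∧
    √√n * √N ≤ |((blocks a (seg x s N)).map (cost μ a)).sum - N * infoRate μ a|} with hB
  have hBm : ∀ n s N, MeasurableSet (B n s N) := by
    intro n s N
    refine DependsOnIcc.measurableSet (s := s) (t := s + N) fun x y h hx => ?_
    simp only [hB, Set.mem_ofPred_eq] at hx ⊢
    rwa [← h _ le_rfl (by omega), ← h _ (by omega) le_rfl,
      ← seg_congr (x := x) fun i h1 h2 => h i (by omega) (by omega)]
  set E : ℕ → Set (ℤ → A) := fun n => {x | a ∉ seg x 0 n.sqrt} ∪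
    {x | a ∉ seg x ((n : ℤ) - n.sqrt) n.sqrt} ∪
    ⋃ s ∈ Finset.range n, ⋃ N ∈ Finset.Icc 1 n, B n s N with hE
  refine ⟨E, 2 * -Real.log c + 2 * |infoRate μ a|, by positivity, fun n => ?_, ?_, ?_⟩
  · refine MeasurableSet.union (MeasurableSet.union ?_ ?_) ?_
    · exact (dependsOnIcc_seg 0 n.sqrt (a ∉ ·) le_rfl (show _ ≤ (n.sqrt : ℤ) + 1 by omega)).measurableSet
    · exact (dependsOnIcc_seg (n - n.sqrt) n.sqrt (a ∉ ·) le_rfl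
        (show _ ≤ (n : ℤ) + 1 by omega)).measurableSet
    · exact Finset.measurableSet_biUnion _ fun s _ => Finset.measurableSet_biUnion _ fun N _ =>
        hBm n s N
  · have hbound : ∀ n, μ.real (E n) ≤ 2 * C * θ ^ n.sqrt +
        K * ((√√n) ^ 8 * Real.exp (-(t₁ * √√n))) := by
      intro n
      have h8 : (√√(n : ℝ)) ^ 8 = (n : ℝ) * n := by
        rw [show 8 = 2 * 4 by norm_num, pow_mul, Real.sq_sqrt (Real.sqrt_nonneg _),
          show 4 = 2 * 2 by norm_num, pow_mul, Real.sq_sqrt (Nat.cast_nonneg n)]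
        ring
      have h3 : μ.real (⋃ s ∈ Finset.range n, ⋃ N ∈ Finset.Icc 1 n, B n s N) ≤
          K * ((√√n) ^ 8 * Real.exp (-(t₁ * √√n))) := by
        refine (measureReal_biUnion_finset_le _ _).trans ?_
        have hs : ∀ s ∈ Finset.range n, μ.real (⋃ N ∈ Finset.Icc 1 n, B n s N) ≤
            n * (K * Real.exp (-(t₁ * √√n))) := by
          intro s _
          refine (measureReal_biUnion_finset_le _ _).trans ?_
          refine (Finset.sum_le_card_nsmul _ _ (K * Real.exp (-(t₁ * √√n))) fun N hN => ?_).trans_eq ?_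
          · exact hdev N s (√√n) (Finset.mem_Icc.1 hN).1
          · simp
        refine (Finset.sum_le_card_nsmul _ _ _ hs).trans_eq ?_
        rw [h8]
        simp only [Finset.card_range, nsmul_eq_mul]
        ring
      refine (measureReal_union_le _ _).trans (add_le_add ((measureReal_union_le _ _).trans ?_) h3)
      have := htail 0 n.sqrt
      have := htail (n - n.sqrt) n.sqrt
      linarith
    have hlim : Tendsto (fun n : ℕ => 2 * C * θ ^ n.sqrt +
        K * ((√√n) ^ 8 * Real.exp (-(t₁ * √√n)))) atTop (𝓝 (2 * C * 0 + K * (1 / t₁ ^ 8 * 0))) := by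
      have hsqrt : Tendsto Nat.sqrt atTop atTop :=
        tendsto_atTop_mono' _ (Eventually.of_forall fun n => le_rfl)
          (tendsto_atTop.2 fun b => (eventually_ge_atTop (b * b)).mono fun n hn =>
            Nat.le_sqrt.2 hn)
      refine Tendsto.add (Tendsto.const_mul _
        ((tendsto_pow_atTop_nhds_zero_of_lt_one hθ0.le hθ1).comp hsqrt)) (Tendsto.const_mul _ ?_)
      have hss : Tendsto (fun n : ℕ => t₁ * √√(n : ℝ)) atTop atTop :=
        Tendsto.const_mul_atTop ht₁ (Real.tendsto_sqrt_atTop.comp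
          (Real.tendsto_sqrt_atTop.comp tendsto_natCast_atTop_atTop))
      have := ((Real.tendsto_pow_mul_exp_neg_atTop_nhds_zero 8).comp hss).const_mul (1 / t₁ ^ 8)
      refine this.congr fun n => ?_
      simp only [Function.comp]
      field_simp
    simp only [mul_zero, add_zero] at hlim
    exact squeeze_zero (fun n => measureReal_nonneg) hbound hlim
  · filter_upwards [ae_seg_pos μ] with x hx n hn hxE
    simp only [hE, Set.mem_union, Set.mem_iUnion, not_or, not_exists, Set.mem_ofPred_eq,
      not_not, Finset.mem_range, Finset.mem_Icc, and_imp] at hxE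
    obtain ⟨⟨h1, h2⟩, h3⟩ := hxE
    rw [mem_seg_iff] at h1 h2
    obtain ⟨i, hi0, hi1, hi⟩ := h1
    obtain ⟨j, hj0, hj1, hj⟩ := h2
    have hm : 2 * n.sqrt ≤ n := by
      have : n.sqrt * n.sqrt ≤ n := Nat.sqrt_le n
      have h2 : 2 ≤ n.sqrt := Nat.le_sqrt.2 (by omega)
      nlinarith
    set m := n.sqrt with hmdef
    obtain ⟨s, rfl⟩ := Int.eq_ofNat_of_zero_le hi0
    obtain ⟨t, rfl⟩ := Int.eq_ofNat_of_zero_le (show 0 ≤ j by omega)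
    have hst : s < t := by omega
    have htn : t < n := by omega
    obtain ⟨g1, g2⟩ := hμ.abs_information_sub_le hc0 hc hx hst.le htn hi hj
    have h4 := h3 s (by omega) (t - s) (by omega) (by omega)
    simp only [hB, Set.mem_ofPred_eq, not_and, not_le] at h4
    have h5 := h4 hi (by rw [← hj]; congr 1; omega)
    have hmr : (m : ℝ) ≤ √n := by
      rw [hmdef]; exact Real.nat_sqrt_le_real_sqrt
    have hts : ((t - s : ℕ) : ℝ) = t - s := Nat.cast_sub hst.le
    have h6 : √√n * √((t - s : ℕ) : ℝ) ≤ √√n * √n := by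
      refine mul_le_mul_of_nonneg_left (Real.sqrt_le_sqrt ?_) (Real.sqrt_nonneg _)
      exact_mod_cast (by omega : t - s ≤ n)
    have h7 := abs_lt.1 (h5.trans_le h6)
    have hs' : (s : ℝ) + 1 ≤ m := by exact_mod_cast (show s + 1 ≤ m by omega)
    have ht' : (n : ℝ) - t ≤ m := by
      have : (n : ℝ) ≤ t + m := by exact_mod_cast (show n ≤ t + m by omega)
      linarith
    have ht'' : (t : ℝ) ≤ n := by exact_mod_cast htn.le
    have hs0 : (0 : ℝ) ≤ s := Nat.cast_nonneg s
    have hbd : (s + 1 + (n - t)) * -Real.log c ≤ 2 * √n * -Real.log c :=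
      mul_le_mul_of_nonneg_right (by linarith) hlog
    have hη : |((t - s : ℕ) : ℝ) * infoRate μ a - n * infoRate μ a| ≤ 2 * √n * |infoRate μ a| := by
      rw [← sub_mul, abs_mul]
      refine mul_le_mul_of_nonneg_right ?_ (abs_nonneg _)
      rw [hts, abs_le]
      constructor <;> linarith
    have hη' := abs_le.1 hη
    have hnn : 0 ≤ 2 * √n * -Real.log c := by positivity
    rw [abs_le]
    constructor <;> linarith

/-- The conditional entropy of the process, given the occurrences of `a`, is the mean information
of the blocks per unit of time. -/
theorem condEntropy_eq (hμ : IsAperiodicMarkov μ) (a : A) : condEntropy μ a = infoRate μ a := by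
  have := hμ.isProbabilityMeasure
  obtain ⟨E, M, hM, hE, hE0, hbad⟩ := hμ.exists_bad_set a
  obtain ⟨c, hc0, hc1, hc⟩ := hμ.exists_lower_bound
  have hlog : 0 ≤ -Real.log c := neg_nonneg.2 (Real.log_nonpos hc0.le hc1)
  set η := infoRate μ a with hη
  set R : ℝ := -Real.log c + |η| with hR
  set D : ℕ → (ℤ → A) → ℝ := fun n x =>
    Real.log (μ.real {y | hatList a (seg y 0 n) = hatList a (seg x 0 n)}) -
      Real.log (μ.real {y | seg y 0 n = seg x 0 n}) with hD
  have hDint : ∀ n, Integrable (D n) μ := fun n =>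
    (integrable_comp_seg μ (fun u => Real.log (μ.real {y | hatList a (seg y 0 n) = hatList a u})) 0 n).sub
      (integrable_comp_seg μ (fun u => Real.log (μ.real {y | seg y 0 n = u})) 0 n)
  have hdiff : ∀ n, blockEntropy μ n - blockEntropy (hatLaw μ a) n = ∫ x, D n x ∂μ := by
    intro n
    rw [blockEntropy_eq_integral, blockEntropy_hatLaw, hD, integral_sub
      (integrable_comp_seg μ (fun u => Real.log (μ.real {y | hatList a (seg y 0 n) = hatList a u})) 0 n)
      (integrable_comp_seg μ (fun u => Real.log (μ.real {y | seg y 0 n = u})) 0 n)]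
    ring
  have hbound : ∀ n : ℕ, 4 ≤ n → |∫ x, D n x ∂μ - n * η| ≤
      M * √n + √√n * √n + n * R * μ.real (E n) := by
    intro n hn
    have e : ∫ x, D n x ∂μ - n * η = ∫ x, (D n x - n * η) ∂μ := by
      rw [integral_sub (hDint n) (integrable_const _)]; simp
    rw [e]
    refine (abs_integral_le_integral_abs).trans ?_
    have hi : Integrable (fun x => M * √n + √√n * √n + (E n).indicator (fun _ => n * R) x) μ :=
      (integrable_const _).add ((integrable_const _).indicator (hE n))
    have hR0 : 0 ≤ n * R := by positivity
    refine (integral_mono_ae ((hDint n).sub (integrable_const _)).abs hi ?_).trans_eq ?_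
    · filter_upwards [hbad, ae_seg_pos μ] with x hx hpos
      -- On the exceptional set the deviation is at most nR, because words of length n that occur
      -- have probability at least c^n; elsewhere the bound is o(n).
      by_cases hxE : x ∈ E n
      · rw [Set.indicator_of_mem hxE]
        have q := hc 0 n _ (hpos 0 n)
        have b := log_sub_log_bounds (q := μ.real {y | hatList a (seg y 0 n) = hatList a (seg x 0 n)})
          hc0 q (measureReal_mono fun y hy => congrArg (hatList a) hy) measureReal_le_one
        have h1 : |D n x - n * η| ≤ |D n x| + |n * η| := abs_sub _ _
        have h2 : |D n x| ≤ n * -Real.log c := by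
          rw [abs_of_nonneg b.1]; exact b.2
        have h3 : |(n : ℝ) * η| = n * |η| := by rw [abs_mul, Nat.abs_cast]
        have h4 : 0 ≤ M * √n + √√n * √n := by positivity
        change |D n x - n * η| ≤ M * √n + √√n * √n + n * R
        rw [hR, mul_add]
        linarith
      · rw [Set.indicator_of_notMem hxE, add_zero]
        exact hx n hn hxE
    · rw [integral_add (integrable_const _) ((integrable_const _).indicator (hE n)),
        integral_indicator_const _ (hE n)]
      simp [mul_comm]
  have hlim : Tendsto (fun n : ℕ => (blockEntropy μ n - blockEntropy (hatLaw μ a) n) / n) atTop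
      (𝓝 η) := by
    rw [tendsto_iff_norm_sub_tendsto_zero]
    have hup : Tendsto (fun n : ℕ => M / √(n : ℝ) + 1 / √√(n : ℝ) + R * μ.real (E n)) atTop
        (𝓝 (0 + 0 + R * 0)) := by
      have hs : Tendsto (fun n : ℕ => √(n : ℝ)) atTop atTop :=
        Real.tendsto_sqrt_atTop.comp tendsto_natCast_atTop_atTop
      refine Tendsto.add (Tendsto.add (tendsto_const_nhds.div_atTop hs)
        (tendsto_const_nhds.div_atTop (Real.tendsto_sqrt_atTop.comp hs))) (hE0.const_mul R)
    simp only [mul_zero, add_zero] at hup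
    refine squeeze_zero' (Eventually.of_forall fun n => norm_nonneg _) ?_ hup
    filter_upwards [eventually_ge_atTop 4] with n hn
    have hn0 : (0 : ℝ) < n := by positivity
    have h1 := hbound n hn
    rw [← hdiff] at h1
    have e : (blockEntropy μ n - blockEntropy (hatLaw μ a) n) / n - η =
        (blockEntropy μ n - blockEntropy (hatLaw μ a) n - n * η) / n := by
      field_simp
    rw [Real.norm_eq_abs, e, abs_div, Nat.abs_cast, div_le_iff₀ hn0]
    refine h1.trans_eq ?_
    have hs : 0 < √(n : ℝ) := Real.sqrt_pos.2 hn0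
    have hss : 0 < √√(n : ℝ) := Real.sqrt_pos.2 hs
    have e1 : (n : ℝ) = √n * √n := (Real.mul_self_sqrt hn0.le).symm
    have e2 : √(n : ℝ) = √√n * √√n := (Real.mul_self_sqrt hs.le).symm
    have e3 : M / √(n : ℝ) * n = M * √n := by
      nth_rewrite 2 [e1]; field_simp
    have e4 : 1 / √√(n : ℝ) * n = √√n * √n := by
      nth_rewrite 2 [e1]; nth_rewrite 2 [e2]; field_simp
    rw [add_mul, add_mul, e3, e4]
    ring
  -- The entropies of X and the differences both converge, hence so do the entropies of the factor,
  -- and both `limUnder` are true limits.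
  obtain ⟨h, hh⟩ := hμ.exists_tendsto_blockEntropy
  have hh' : Tendsto (fun n : ℕ => blockEntropy (hatLaw μ a) n / n) atTop (𝓝 (h - η)) := by
    refine (hh.sub hlim).congr fun n => ?_
    rw [sub_div]; ring
  rw [condEntropy, entropyRate, entropyRate, hh.limUnder_eq, hh'.limUnder_eq]
  ring

end IsAperiodicMarkov

end EntropyRate

/-! ### The ends of `S_r` and their measurability -/

section Ends

lemma leftEnd_spec {m : ℤ → ℕ} {r : ℕ} (h : ∃ i ≤ 0, r ≤ m i) :
    leftEnd m r ≤ 0 ∧ r ≤ m (leftEnd m r) ∧ ∀ i, leftEnd m r < i → i ≤ 0 → m i < r := by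
  have hb : BddAbove {i : ℤ | i ≤ 0 ∧ r ≤ m i} := ⟨0, fun i hi => hi.1⟩
  obtain ⟨i, hi⟩ := h
  have hmem := Int.csSup_mem ⟨i, hi⟩ hb
  refine ⟨hmem.1, hmem.2, fun j h1 h2 => ?_⟩
  by_contra! h3
  exact absurd (le_csSup hb ⟨h2, h3⟩) (not_le.2 h1)

lemma rightEnd_spec {m : ℤ → ℕ} {r : ℕ} (h : ∃ i > 0, r ≤ m i) :
    0 < rightEnd m r ∧ r ≤ m (rightEnd m r) ∧ ∀ i, 0 < i → i < rightEnd m r → m i < r := by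
  have hb : BddBelow {i : ℤ | 0 < i ∧ r ≤ m i} := ⟨0, fun i hi => hi.1.le⟩
  obtain ⟨i, hi⟩ := h
  have hmem := Int.csInf_mem ⟨i, hi⟩ hb
  refine ⟨hmem.1, hmem.2, fun j h1 h2 => ?_⟩
  by_contra! h3
  exact absurd (csInf_le hb ⟨h1, h3⟩) (not_le.2 h2)

/-- The second alternative is the default value: the supremum of the empty set of integers is 0. -/
lemma leftEnd_eq_iff {m : ℤ → ℕ} {r : ℕ} {l : ℤ} :
    leftEnd m r = l ↔ (l ≤ 0 ∧ r ≤ m l ∧ ∀ i, l < i → i ≤ 0 → m i < r) ∨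
      (l = 0 ∧ ∀ i, i ≤ 0 → m i < r) := by
  by_cases h : ∃ i ≤ 0, r ≤ m i
  · obtain ⟨h1, h2, h3⟩ := leftEnd_spec h
    constructor
    · rintro rfl
      exact .inl ⟨h1, h2, h3⟩
    · rintro (⟨g1, g2, g3⟩ | ⟨-, g⟩)
      · rcases lt_trichotomy (leftEnd m r) l with hl | hl | hl
        · exact absurd (h3 l hl g1) (not_lt.2 g2)
        · exact hl
        · exact absurd (g3 _ hl h1) (not_lt.2 h2)
      · obtain ⟨i, hi, hi'⟩ := h
        exact absurd (g i hi) (not_lt.2 hi')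
  · push Not at h
    have he : leftEnd m r = 0 := by
      have : {i : ℤ | i ≤ 0 ∧ r ≤ m i} = ∅ := by
        ext i
        simpa using h i
      rw [leftEnd, this, Int.csSup_empty]
    constructor
    · rintro rfl
      exact .inr ⟨he, h⟩
    · rintro (⟨g1, g2, -⟩ | ⟨rfl, -⟩)
      · exact absurd (h l g1) (not_lt.2 g2)
      · exact he

lemma rightEnd_eq_iff {m : ℤ → ℕ} {r : ℕ} {l : ℤ} :
    rightEnd m r = l ↔ (0 < l ∧ r ≤ m l ∧ ∀ i, 0 < i → i < l → m i < r) ∨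
      (l = 0 ∧ ∀ i, 0 < i → m i < r) := by
  by_cases h : ∃ i > 0, r ≤ m i
  · obtain ⟨h1, h2, h3⟩ := rightEnd_spec h
    constructor
    · rintro rfl
      exact .inl ⟨h1, h2, h3⟩
    · rintro (⟨g1, g2, g3⟩ | ⟨-, g⟩)
      · rcases lt_trichotomy (rightEnd m r) l with hl | hl | hl
        · exact absurd (g3 _ h1 hl) (not_lt.2 h2)
        · exact hl
        · exact absurd (h3 l g1 hl) (not_lt.2 g2)
      · obtain ⟨i, hi, hi'⟩ := h
        exact absurd (g i hi) (not_lt.2 hi')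
  · push Not at h
    have he : rightEnd m r = 0 := by
      have : {i : ℤ | 0 < i ∧ r ≤ m i} = ∅ := by
        ext i
        simpa using h i
      rw [rightEnd, this, Int.csInf_empty]
    constructor
    · rintro rfl
      exact .inr ⟨he, h⟩
    · rintro (⟨g1, g2, -⟩ | ⟨rfl, -⟩)
      · exact absurd (h l g1) (not_lt.2 g2)
      · exact he

lemma measurableSet_mark_lt (r : ℕ) (i : ℤ) : MeasurableSet {m : ℤ → ℕ | m i < r} :=
  (measurableSet_lt (measurable_pi_apply i) measurable_const)

lemma measurable_leftEnd (r : ℕ) : Measurable fun m : ℤ → ℕ => leftEnd m r := by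
  refine measurable_to_countable' fun l => ?_
  have : (fun m : ℤ → ℕ => leftEnd m r) ⁻¹' {l} =
      ({m | l ≤ 0} ∩ ({m | m l < r}ᶜ ∩ ⋂ i, {m | l < i → i ≤ 0 → m i < r})) ∪
        ({m | l = 0} ∩ ⋂ i, {m | i ≤ 0 → m i < r}) := by
    ext m
    simp [leftEnd_eq_iff]
  rw [this]
  refine MeasurableSet.union (MeasurableSet.inter (.const _)
    ((measurableSet_mark_lt r l).compl.inter (.iInter fun i => ?_)))
    (MeasurableSet.inter (.const _) (.iInter fun i => ?_))
  · by_cases h : l < i ∧ i ≤ 0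
    · simpa [h.1, h.2] using measurableSet_mark_lt r i
    · convert MeasurableSet.univ using 1
      ext m; simp only [Set.mem_ofPred_eq, Set.mem_univ, iff_true]; tauto
  · by_cases h : i ≤ 0
    · simpa [h] using measurableSet_mark_lt r i
    · simp [h]

lemma measurable_rightEnd (r : ℕ) : Measurable fun m : ℤ → ℕ => rightEnd m r := by
  refine measurable_to_countable' fun l => ?_
  have : (fun m : ℤ → ℕ => rightEnd m r) ⁻¹' {l} =
      ({m | 0 < l} ∩ ({m | m l < r}ᶜ ∩ ⋂ i, {m | 0 < i → i < l → m i < r})) ∪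
        ({m | l = 0} ∩ ⋂ i, {m | 0 < i → m i < r}) := by
    ext m
    simp [rightEnd_eq_iff]
  rw [this]
  refine MeasurableSet.union (MeasurableSet.inter (.const _)
    ((measurableSet_mark_lt r l).compl.inter (.iInter fun i => ?_)))
    (MeasurableSet.inter (.const _) (.iInter fun i => ?_))
  · by_cases h : 0 < i ∧ i < l
    · simpa [h.1, h.2] using measurableSet_mark_lt r i
    · convert MeasurableSet.univ using 1
      ext m; simp only [Set.mem_ofPred_eq, Set.mem_univ, iff_true]; tauto
  · by_cases h : 0 < i
    · simpa [h] using measurableSet_mark_lt r i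
    · simp [h]

end Ends

/-! ### Almost sure properties of the marks -/

section Typical

variable {A : Type*} [MeasurableSpace A] [MeasurableSingletonClass A] [Fintype A] [DecidableEq A]
  {μ : Measure (ℤ → A)} {a : A} {ξ : (ℤ → Bool) → (ℤ → ℕ)}

/-- The almost sure properties of a sample and its marks that are used. -/
structure IsTypical (μ : Measure (ℤ → A)) (a : A) (ξ : (ℤ → Bool) → (ℤ → ℕ)) (x : ℤ → A) :
    Prop where
  pos : ∀ (α : ℤ) (n : ℕ), 0 < μ.real {y | seg y α n = seg x α n}
  marks : ∀ i, 0 < ξ (hat a x) i → x i = a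
  recurrent : ∀ r, (∃ i, r ≤ ξ (hat a x) i) →
    (∃ i ≤ 0, r ≤ ξ (hat a x) i) ∧ ∃ i > 0, r ≤ ξ (hat a x) i

/-- Since ξ commutes with the shift almost surely, the events at neighbouring places are shifts of
each other up to null sets, and stationarity makes them equally likely. -/
lemma IsMarkerFactor.ae_of_shift {ν : Measure (ℤ → Bool)} [IsProbabilityMeasure ν]
    (hν : MeasurePreserving (shift : (ℤ → Bool) → (ℤ → Bool)) ν ν) (hξ : IsMarkerFactor ν ξ)
    {P : ℤ → (ℤ → Bool) → (ℤ → ℕ) → Prop}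
    (hP : ∀ i ω m, P i (shift ω) (shift m) ↔ P (i + 1) ω m)
    (hm : ∀ i, MeasurableSet {ω | P i ω (ξ ω)}) (i : ℤ) :
    ν {ω | P i ω (ξ ω)} = ν {ω | P 0 ω (ξ ω)} := by
  refine measure_eq_of_shift hν (E := fun i => {ω | P i ω (ξ ω)})
    (fun i => (hm i).nullMeasurableSet) (fun i => ?_) i
  filter_upwards [hξ.stationary] with ω hω
  refine propext ?_
  change P (i + 1) ω (ξ ω) ↔ P i (shift ω) (ξ (shift ω))
  rw [hω, hP]

lemma IsMarkerFactor.ae_marks {ν : Measure (ℤ → Bool)} [IsProbabilityMeasure ν]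
    (hν : MeasurePreserving (shift : (ℤ → Bool) → (ℤ → Bool)) ν ν) (hξ : IsMarkerFactor ν ξ) :
    ∀ᵐ ω ∂ν, ∀ i, 0 < ξ ω i → ω i = true := by
  rw [ae_all_iff]
  intro i
  rw [ae_iff]
  have h0 := hξ.marks
  rw [ae_iff] at h0
  rw [← h0]
  refine hξ.ae_of_shift hν (P := fun i ω m => ¬ (0 < m i → ω i = true)) (fun i ω m => Iff.rfl)
    (fun i => ?_) i
  have h1 : MeasurableSet {ω : ℤ → Bool | 0 < ξ ω i} :=
    measurableSet_lt measurable_const ((measurable_pi_apply i).comp hξ.measurable)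
  have h2 := (measurableSet_coord i true).compl
  convert h1.inter h2 using 1
  ext ω
  simp

lemma measure_eq_zero_of_disjoint {Ω : Type*} [MeasurableSpace Ω] {ν : Measure Ω}
    [IsProbabilityMeasure ν] {E : ℤ → Set Ω} (hm : ∀ i, MeasurableSet (E i))
    (hd : Pairwise (Function.onFun Disjoint E)) (he : ∀ i, ν (E i) = ν (E 0)) (i : ℤ) :
    ν (E i) = 0 := by
  rw [he]
  by_contra h
  have h1 := measure_iUnion hd hm (μ := ν)
  simp only [he] at h1
  rw [ENNReal.tsum_const_eq_top_of_ne_zero h] at h1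
  exact measure_ne_top ν _ h1

/-- At most one place is the last one with mark at least r. These disjoint events are equally likely
for all places, hence null; the same holds for the first place. So large marks, if any occur, occur
on both sides of 0. -/
lemma IsMarkerFactor.ae_recurrent {ν : Measure (ℤ → Bool)} [IsProbabilityMeasure ν]
    (hν : MeasurePreserving (shift : (ℤ → Bool) → (ℤ → Bool)) ν ν) (hξ : IsMarkerFactor ν ξ) :
    ∀ᵐ ω ∂ν, ∀ r, (∃ i, r ≤ ξ ω i) → (∃ i ≤ 0, r ≤ ξ ω i) ∧ ∃ i > 0, r ≤ ξ ω i := by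
  rw [ae_all_iff]
  intro r
  have hmeas : ∀ i, MeasurableSet {ω : ℤ → Bool | ξ ω i < r} := fun i =>
    hξ.measurable (measurableSet_mark_lt r i)
  have hlast : ∀ i, ν {ω | r ≤ ξ ω i ∧ ∀ j, i < j → ξ ω j < r} = 0 := by
    have hm : ∀ i, MeasurableSet {ω | r ≤ ξ ω i ∧ ∀ j, i < j → ξ ω j < r} := by
      intro i
      have : {ω | r ≤ ξ ω i ∧ ∀ j, i < j → ξ ω j < r} =
          {ω | ξ ω i < r}ᶜ ∩ ⋂ j, {ω | i < j → ξ ω j < r} := by ext ω; simp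
      rw [this]
      refine (hmeas i).compl.inter (.iInter fun j => ?_)
      by_cases h : i < j
      · simpa [h] using hmeas j
      · simp [h]
    refine measure_eq_zero_of_disjoint hm (fun i j hij => Set.disjoint_left.2 fun ω h1 h2 => ?_)
      (hξ.ae_of_shift hν (P := fun i _ m => r ≤ m i ∧ ∀ j, i < j → m j < r) (fun i _ m => ?_) hm)
    · rcases lt_or_gt_of_ne hij with h | h
      · exact absurd (h1.2 j h) (not_lt.2 h2.1)
      · exact absurd (h2.2 i h) (not_lt.2 h1.1)
    · refine and_congr Iff.rfl ⟨fun h j hj => ?_, fun h j hj => h (j + 1) (by omega)⟩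
      simpa [shift] using h (j - 1) (by omega)
  have hfirst : ∀ i, ν {ω | r ≤ ξ ω i ∧ ∀ j, j < i → ξ ω j < r} = 0 := by
    have hm : ∀ i, MeasurableSet {ω | r ≤ ξ ω i ∧ ∀ j, j < i → ξ ω j < r} := by
      intro i
      have : {ω | r ≤ ξ ω i ∧ ∀ j, j < i → ξ ω j < r} =
          {ω | ξ ω i < r}ᶜ ∩ ⋂ j, {ω | j < i → ξ ω j < r} := by ext ω; simp
      rw [this]
      refine (hmeas i).compl.inter (.iInter fun j => ?_)
      by_cases h : j < i
      · simpa [h] using hmeas j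
      · simp [h]
    refine measure_eq_zero_of_disjoint hm (fun i j hij => Set.disjoint_left.2 fun ω h1 h2 => ?_)
      (hξ.ae_of_shift hν (P := fun i _ m => r ≤ m i ∧ ∀ j, j < i → m j < r) (fun i _ m => ?_) hm)
    · rcases lt_or_gt_of_ne hij with h | h
      · exact absurd (h2.2 i h) (not_lt.2 h1.1)
      · exact absurd (h1.2 j h) (not_lt.2 h2.1)
    · refine and_congr Iff.rfl ⟨fun h j hj => ?_, fun h j hj => h (j + 1) (by omega)⟩
      simpa [shift] using h (j - 1) (by omega)
  have h1 : ∀ᵐ ω ∂ν, ∀ i, ¬ (r ≤ ξ ω i ∧ ∀ j, i < j → ξ ω j < r) := by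
    rw [ae_all_iff]; intro i; rw [ae_iff]; simpa using hlast i
  have h2 : ∀ᵐ ω ∂ν, ∀ i, ¬ (r ≤ ξ ω i ∧ ∀ j, j < i → ξ ω j < r) := by
    rw [ae_all_iff]; intro i; rw [ae_iff]; simpa using hfirst i
  filter_upwards [h1, h2] with ω h1 h2 hex
  obtain ⟨i, hi⟩ := hex
  constructor
  · by_contra! hc
    obtain ⟨i₀, hi₀, hmin⟩ := Int.exists_least_of_bdd (P := fun j => r ≤ ξ ω j)
      ⟨0, fun z hz => not_lt.1 fun hlt => absurd (hc z hlt.le) (not_lt.2 hz)⟩ ⟨i, hi⟩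
    refine h2 i₀ ⟨hi₀, fun j hj => ?_⟩
    by_contra! h
    exact absurd (hmin j h) (not_le.2 hj)
  · by_contra! hc
    obtain ⟨i₀, hi₀, hmax⟩ := Int.exists_greatest_of_bdd (P := fun j => r ≤ ξ ω j)
      ⟨0, fun z hz => not_lt.1 fun hlt => absurd (hc z hlt) (not_lt.2 hz)⟩ ⟨i, hi⟩
    refine h1 i₀ ⟨hi₀, fun j hj => ?_⟩
    by_contra! h
    exact absurd (hmax j h) (not_le.2 hj)

lemma IsAperiodicMarkov.isProbabilityMeasure_hatLaw (hμ : IsAperiodicMarkov μ) (a : A) :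
    IsProbabilityMeasure (hatLaw μ a) := by
  have := hμ.isProbabilityMeasure
  exact Measure.isProbabilityMeasure_map (measurable_hat a).aemeasurable

lemma IsAperiodicMarkov.measurePreserving_hatLaw (hμ : IsAperiodicMarkov μ) (a : A) :
    MeasurePreserving (shift : (ℤ → Bool) → (ℤ → Bool)) (hatLaw μ a) (hatLaw μ a) := by
  have hs : Measurable (shift : (ℤ → Bool) → (ℤ → Bool)) := measurable_shiftBy 1
  have hs' : Measurable (shift : (ℤ → A) → (ℤ → A)) := measurable_shiftBy 1
  refine ⟨hs, ?_⟩
  rw [hatLaw, Measure.map_map hs (measurable_hat a)]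
  conv_rhs => rw [← hμ.stationary.map_eq, Measure.map_map (measurable_hat a) hs']
  rfl

lemma IsAperiodicMarkov.ae_isTypical (hμ : IsAperiodicMarkov μ)
    (hξ : IsMarkerFactor (hatLaw μ a) ξ) : ∀ᵐ x ∂μ, IsTypical μ a ξ x := by
  have := hμ.isProbabilityMeasure
  have := hμ.isProbabilityMeasure_hatLaw a
  have e1 := hξ.ae_marks (hμ.measurePreserving_hatLaw a)
  have e2 := hξ.ae_recurrent (hμ.measurePreserving_hatLaw a)
  rw [hatLaw] at e1 e2
  have h1 := ae_of_ae_map (measurable_hat a).aemeasurable e1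
  have h2 := ae_of_ae_map (measurable_hat a).aemeasurable e2
  filter_upwards [ae_seg_pos μ, h1, h2] with x h0 h1 h2
  exact ⟨h0, fun i hi => by simpa [hat] using h1 i hi, h2⟩

/-- The interval covered by a nondegenerate `S_r`. -/
lemma IsTypical.size_spec {x : ℤ → A} (hx : IsTypical μ a ξ x) {r : ℕ} (hr : 0 < r)
    (hs : 0 < size ξ a r x) :
    leftEnd (ξ (hat a x)) r ≤ 0 ∧
    rightEnd (ξ (hat a x)) r = leftEnd (ξ (hat a x)) r + size ξ a r x ∧
    0 < rightEnd (ξ (hat a x)) r ∧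
    x (leftEnd (ξ (hat a x)) r) = a ∧ x (leftEnd (ξ (hat a x)) r + size ξ a r x) = a := by
  have hex : ∃ i, r ≤ ξ (hat a x) i := by
    by_contra! h
    have h1 : leftEnd (ξ (hat a x)) r = 0 := leftEnd_eq_iff.2 (.inr ⟨rfl, fun i _ => h i⟩)
    have h2 : rightEnd (ξ (hat a x)) r = 0 := rightEnd_eq_iff.2 (.inr ⟨rfl, fun i _ => h i⟩)
    rw [size, h1, h2] at hs
    simp at hs
  obtain ⟨h1, h2⟩ := hx.recurrent r hex
  obtain ⟨l1, l2, -⟩ := leftEnd_spec h1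
  obtain ⟨r1, r2, -⟩ := rightEnd_spec h2
  have he : rightEnd (ξ (hat a x)) r = leftEnd (ξ (hat a x)) r + size ξ a r x := by
    rw [size]; omega
  refine ⟨l1, he, r1, hx.marks _ (hr.trans_le l2), hx.marks _ (hr.trans_le ?_)⟩
  rw [← he]
  exact r2

end Typical

/-! ### Measurability of the determined fraction -/

section Measurability

variable {A : Type*} [MeasurableSpace A] [MeasurableSingletonClass A] [Fintype A] [DecidableEq A]
  {μ : Measure (ℤ → A)} {a : A} {ξ : (ℤ → Bool) → (ℤ → ℕ)}

lemma measurable_of_factor {Ω Z β : Type*} [MeasurableSpace Ω] [Countable Z] [MeasurableSpace β]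
    {g : Ω → Z} (hg : ∀ z, MeasurableSet (g ⁻¹' {z})) {f : Ω → β}
    (hf : ∀ x y, g x = g y → f x = f y) : Measurable f := by
  intro T _
  have : f ⁻¹' T = ⋃ z ∈ g '' (f ⁻¹' T), g ⁻¹' {z} := by
    ext x
    simp only [Set.mem_preimage, Set.mem_iUnion, Set.mem_image, Set.mem_singleton_iff, exists_prop]
    constructor
    · intro hx
      exact ⟨g x, ⟨x, hx, rfl⟩, rfl⟩
    · rintro ⟨z, ⟨y, hy, rfl⟩, hz⟩
      rwa [hf x y hz]
  rw [this]
  exact MeasurableSet.biUnion (Set.to_countable _) fun z _ => hg z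

variable (a ξ) in
/-- The interval covered by `S_r`, with the sample and the marks on it. -/
def sampleOnSkel (r : ℕ) (x : ℤ → A) : ℤ × ℤ × Σ n : ℕ, (Fin n → A) × (Fin n → ℕ) :=
  (leftEnd (ξ (hat a x)) r, rightEnd (ξ (hat a x)) r, ⟨size ξ a r x,
    fun j => x (leftEnd (ξ (hat a x)) r + (j : ℕ)),
    fun j => ξ (hat a x) (leftEnd (ξ (hat a x)) r + (j : ℕ))⟩)

lemma measurableSet_sampleOnSkel (hξ : Measurable ξ) (r : ℕ)
    (z : ℤ × ℤ × Σ n : ℕ, (Fin n → A) × (Fin n → ℕ)) :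
    MeasurableSet (sampleOnSkel a ξ r ⁻¹' {z}) := by
  obtain ⟨l, r', n, u, m⟩ := z
  have hm : Measurable fun x : ℤ → A => ξ (hat a x) := hξ.comp (measurable_hat a)
  have hl := ((measurable_leftEnd r).comp hm) (measurableSet_singleton l)
  have hr := ((measurable_rightEnd r).comp hm) (measurableSet_singleton r')
  have hw : MeasurableSet (⋂ j : Fin n, ({x : ℤ → A | x (l + (j : ℕ)) = u j} ∩
      {x | ξ (hat a x) (l + (j : ℕ)) = m j})) :=
    .iInter fun j => (measurableSet_coord _ _).inter (hm (measurableSet_coord _ _))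
  by_cases hn : (r' - l).toNat = n
  · convert hl.inter (hr.inter hw) using 1
    ext x
    simp only [sampleOnSkel, Set.mem_preimage, Set.mem_singleton_iff, Prod.mk.injEq,
      Set.mem_inter_iff, Function.comp, Set.mem_iInter, Set.mem_ofPred_eq]
    constructor
    · rintro ⟨h1, h2, h3⟩
      refine ⟨h1, h2, ?_⟩
      rw [Sigma.mk.injEq] at h3
      obtain ⟨h3, h4⟩ := h3
      subst h3
      have h5 := eq_of_heq h4
      rw [Prod.mk.injEq] at h5
      intro j
      exact ⟨by rw [← h5.1, h1], by rw [← h5.2, h1]⟩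
    · rintro ⟨h1, h2, h3⟩
      refine ⟨h1, h2, ?_⟩
      have hs : size ξ a r x = n := by rw [size, h1, h2, hn]
      subst hs
      rw [h1]
      congr 2
      · funext j; exact (h3 j).1
      · funext j; exact (h3 j).2
  · convert MeasurableSet.empty using 1
    ext x
    simp only [sampleOnSkel, Set.mem_preimage, Set.mem_singleton_iff, Prod.mk.injEq,
      Set.mem_empty_iff_false, iff_false]
    rintro ⟨h1, h2, h3⟩
    rw [Sigma.mk.injEq] at h3
    exact hn (by rw [← h1, ← h2]; exact h3.1)

/-- The skeleton with given start, word and marks, with the class of the word. -/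
def classOf (R : FillerRelations a) (l : ℤ) (s : Σ n : ℕ, (Fin n → A) × (Fin n → ℕ)) :
    Σ S : Skel, Quotient (R S) :=
  ⟨⟨l, s.1, fun j => decide (s.2.1 j = a), s.2.2⟩, Quotient.mk (R _) ⟨s.2.1, fun _ => rfl⟩⟩

lemma randomClass_eq_classOf (R : FillerRelations a) (r : ℕ) (x : ℤ → A) :
    R.randomClass ξ r x = classOf R (sampleOnSkel a ξ r x).1 (sampleOnSkel a ξ r x).2.2 := rfl

/-- The fraction is a function of the countably valued sample on `S_r`: membership in `Determines`
depends on x only through its class and the letter concerned. Measurability serves the integral in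
the definition of a SOF. -/
lemma measurable_determinedFraction (hξ : Measurable ξ) (R : FillerRelations a) (r : ℕ) :
    Measurable (R.determinedFraction μ ξ r) := by
  refine measurable_of_factor (g := sampleOnSkel a ξ r) (measurableSet_sampleOnSkel hξ r) ?_
  intro x y h
  have hl : leftEnd (ξ (hat a x)) r = leftEnd (ξ (hat a y)) r := congrArg Prod.fst h
  have hr : rightEnd (ξ (hat a x)) r = rightEnd (ξ (hat a y)) r :=
    congrArg (fun z => z.2.1) h
  have hs : size ξ a r x = size ξ a r y := by rw [size, size, hl, hr]
  have hc : R.randomClass ξ r x = R.randomClass ξ r y := by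
    rw [randomClass_eq_classOf, randomClass_eq_classOf, h]
  have hw : ∀ i, leftEnd (ξ (hat a y)) r ≤ i → i < rightEnd (ξ (hat a y)) r → x i = y i := by
    intro i h1 h2
    have h3 := congrArg (fun z => z.2.2) h
    simp only [sampleOnSkel] at h3
    have h4 : seg x (leftEnd (ξ (hat a y)) r) (size ξ a r y) =
        seg y (leftEnd (ξ (hat a y)) r) (size ξ a r y) := by
      have := congrArg (fun s : Σ n : ℕ, (Fin n → A) × (Fin n → ℕ) => List.ofFn s.2.1) h3
      simp only [hl] at this
      rw [← hs]
      conv_rhs => rw [hs]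
      exact this
    rw [seg_eq_seg_iff] at h4
    refine h4 i h1 ?_
    rw [size]; omega
  rw [FillerRelations.determinedFraction, FillerRelations.determinedFraction, hs, hl, hr]
  congr 1
  refine Finset.sum_congr rfl fun i hi => ?_
  rw [Finset.mem_Ico] at hi
  have hi' := hw i hi.1 hi.2
  have hiff : x ∈ Determines μ (R.randomClass ξ r) (fun y => y i) ↔
      y ∈ Determines μ (R.randomClass ξ r) (fun y => y i) := by
    simp only [Determines, Set.mem_ofPred_eq, hc, hi']
  by_cases hx : x ∈ Determines μ (R.randomClass ξ r) (fun y => y i)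
  · rw [Set.indicator_of_mem hx, Set.indicator_of_mem (hiff.1 hx)]
  · rw [Set.indicator_of_notMem hx, Set.indicator_of_notMem (mt hiff.2 hx)]

end Measurability

/-! ### The budget -/

section Budget

/-- The amount of information that is revealed of a skeleton of length `n`. -/
def budget (h : ℝ) (n : ℕ) : ℝ := max 0 (n * h - √n)

lemma budget_nonneg (h : ℝ) (n : ℕ) : 0 ≤ budget h n := le_max_left _ _

/-- Where mh > √m one has h √m ≥ 1, and so √(m+n) ≤ √m + nh: the untruncated budget does not
decrease from there on, which settles the case of one positive term. For two positive terms,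
subadditivity of the square root suffices. -/
lemma budget_add {h : ℝ} (hh : 0 ≤ h) (m n : ℕ) :
    budget h m + budget h n ≤ budget h (m + n) := by
  have key : ∀ m n : ℕ, 0 < (m : ℝ) * h - √m →
      (m : ℝ) * h - √m ≤ ((m : ℝ) + n) * h - √((m : ℝ) + n) := by
    intro m n hm
    have h1 : √(m : ℝ) * √m = m := Real.mul_self_sqrt (by positivity)
    have h2 : 1 ≤ √(m : ℝ) * h := by
      by_contra! hc
      nlinarith [Real.sqrt_nonneg (m : ℝ)]
    have h3 : √((m : ℝ) + n) ≤ √m + n * h := by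
      refine Real.sqrt_le_iff.2 ⟨by positivity, ?_⟩
      have : (n : ℝ) * 1 ≤ n * (√m * h) := by gcongr
      nlinarith [sq_nonneg ((n : ℝ) * h), (Nat.cast_nonneg n : (0 : ℝ) ≤ n)]
    linarith
  unfold budget
  push_cast
  rcases le_or_gt ((m : ℝ) * h - √m) 0 with hm | hm
  · rcases le_or_gt ((n : ℝ) * h - √n) 0 with hn | hn
    · rw [max_eq_left hm, max_eq_left hn, add_zero]
      exact le_max_left _ _
    · rw [max_eq_left hm, max_eq_right hn.le, zero_add, add_comm (m : ℝ)]
      exact (key n m hn).trans (le_max_right _ _)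
  · rcases le_or_gt ((n : ℝ) * h - √n) 0 with hn | hn
    · rw [max_eq_left hn, max_eq_right hm.le, add_zero]
      exact (key m n hm).trans (le_max_right _ _)
    · rw [max_eq_right hn.le, max_eq_right hm.le]
      refine le_trans ?_ (le_max_right _ _)
      have : √((m : ℝ) + n) ≤ √m + √n := by
        refine Real.sqrt_le_iff.2 ⟨by positivity, ?_⟩
        nlinarith [Real.sq_sqrt (Nat.cast_nonneg m : (0 : ℝ) ≤ m),
          Real.sq_sqrt (Nat.cast_nonneg n : (0 : ℝ) ≤ n), Real.sqrt_nonneg (m : ℝ),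
          Real.sqrt_nonneg (n : ℝ)]
      linarith

/-- From n = 1/h² on, the truncation at 0 is inactive. -/
lemma budget_eq {h : ℝ} (hh : 0 < h) {n : ℕ} (hn : 1 / h ^ 2 ≤ n) :
    budget h n = n * h - Lam 0 (1 / 2) n := by
  have h1 : Lam 0 (1 / 2) (n : ℝ) = √n := by
    rw [Lam, Real.rpow_zero, mul_one, Real.sqrt_eq_rpow]
  rw [h1, budget, max_eq_right]
  rw [sub_nonneg]
  refine Real.sqrt_le_iff.2 ⟨by positivity, ?_⟩
  have h2 : 1 ≤ n * h ^ 2 := by rwa [div_le_iff₀ (by positivity)] at hn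
  nlinarith [(Nat.cast_nonneg n : (0 : ℝ) ≤ n)]

end Budget

/-! ### Classes as specifications of blocks -/

section Spec

variable {A : Type*} [MeasurableSpace A] [MeasurableSingletonClass A] [Fintype A] [DecidableEq A]
  {μ : Measure (ℤ → A)} {a : A}

variable (μ a) in
/-- The constraints on the blocks that the revealed items impose. -/
def spec (fl : List Bool) (l : List (ℕ × List A)) : List (ℕ × Set (List A)) :=
  List.zipWith (fun f i => (i.2.length, {b | f = true → norm μ a b = i.2})) fl l

lemma map_fst_spec {fl : List Bool} {l : List (ℕ × List A)} (h : fl.length = l.length) :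
    (spec μ a fl l).map Prod.fst = (l.map Prod.snd).map List.length := by
  induction fl generalizing l with
  | nil => rw [List.length_eq_zero_iff.1 h.symm]; rfl
  | cons f fl ih =>
    rcases l with _ | ⟨i, l⟩
    · simp at h
    · simp only [spec, List.zipWith_cons_cons, List.map_cons, List.length_cons,
        Nat.add_right_cancel_iff] at ih h ⊢
      rw [ih h]

/-- With the flags fixed, looking alike is one condition per block: a revealed block has a
prescribed normal form, a hidden one is free. -/
lemma mask_eq_iff_spec {fl : List Bool} {l l' : List (ℕ × List A)} {bs : List (List A)}
    (h : fl.length = l.length) (hs : l.map shape = l'.map shape)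
    (hbs : l'.map Prod.snd = bs.map (norm μ a)) :
    mask fl l = mask fl l' ↔ List.Forall₂ (fun b s => b ∈ s.2) bs (spec μ a fl l) := by
  induction fl generalizing l l' bs with
  | nil =>
    obtain rfl := List.length_eq_zero_iff.1 h.symm
    have : l' = [] := by simpa using hs.symm
    subst this
    have : bs = [] := by simpa using hbs.symm
    subst this
    simp [mask, spec]
  | cons f fl ih =>
    rcases l with _ | ⟨i, l⟩
    · simp at h
    rcases l' with _ | ⟨i', l'⟩
    · simp at hs
    rcases bs with _ | ⟨b, bs⟩
    · simp at hbs
    simp only [List.map_cons, List.cons.injEq, List.length_cons, Nat.add_right_cancel_iff]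
      at h hs hbs
    have := ih h hs.2 hbs.2
    simp only [mask, spec, List.zipWith_cons_cons, List.cons.injEq, List.forall₂_cons] at this ⊢
    rw [this]
    refine and_congr ?_ Iff.rfl
    have hs1 := hs.1
    simp only [shape, Prod.mk.injEq] at hs1
    obtain ⟨h1, h2⟩ := hs1
    rw [Set.mem_ofPred_eq, ← hbs.1]
    rcases f with _ | _
    · simp [view, h1, h2]
    · simp only [view, Sum.inl.injEq, true_imp_iff, Prod.ext_iff, h1, true_and]
      exact eq_comm

/-- The other blocks with normal form c are impossible and add no probability. -/
lemma IsAperiodicMarkov.blockProbSet_norm_eq (hμ : IsAperiodicMarkov μ) {c : List A}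
    (hc : 0 < blockProb μ a c) :
    blockProbSet μ a c.length {b | norm μ a b = c} = blockProb μ a c := by
  classical
  rw [hμ.blockProbSet_eq_sum]
  rw [Finset.sum_eq_single c]
  · intro b hb hbc
    by_contra h
    have hpos := (blockProb_nonneg b).lt_of_ne' h
    rw [Finset.mem_filter, Set.mem_ofPred_eq, norm_eq_self hpos] at hb
    exact hbc hb.2
  · intro h
    refine absurd ?_ h
    rw [Finset.mem_filter]
    exact ⟨mem_words.2 rfl, norm_eq_self hc⟩

/-- Relative to the probability of its length, a revealed block contributes its conditional
probability exp(-cost), and a hidden one contributes 1. -/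
lemma IsAperiodicMarkov.prod_spec (hμ : IsAperiodicMarkov μ) {fl : List Bool}
    {l : List (ℕ × List A)} (h : fl.length = l.length) (hl : ∀ i ∈ l, 0 < blockProb μ a i.2) :
    ((spec μ a fl l).map fun s => blockProbSet μ a s.1 s.2).prod =
      ((l.map Prod.snd).map fun b => blockProbSet μ a b.length Set.univ).prod *
        Real.exp (-total (cost μ a) fl l) := by
  induction fl generalizing l with
  | nil =>
    obtain rfl := List.length_eq_zero_iff.1 h.symm
    simp [spec, total]
  | cons f fl ih =>
    rcases l with _ | ⟨i, l⟩
    · simp at h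
    simp only [List.length_cons, Nat.add_right_cancel_iff] at h
    have := ih h fun j hj => hl j (List.mem_cons_of_mem _ hj)
    simp only [spec, total, List.zipWith_cons_cons, List.map_cons, List.prod_cons,
      List.sum_cons] at this ⊢
    rw [this, neg_add, Real.exp_add]
    have hi := hl i List.mem_cons_self
    have hu := hμ.univ_pos hi
    have hhead : blockProbSet μ a i.2.length {b | f = true → norm μ a b = i.2} =
        blockProbSet μ a i.2.length Set.univ *
          Real.exp (-(if f = true then cost μ a i.2 else 0)) := by
      rcases f with _ | _
      · have : {b | (false = true) → norm μ a b = i.2} = Set.univ := by ext; simp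
        rw [this]; simp
      · simp only [true_imp_iff, if_true]
        rw [hμ.blockProbSet_norm_eq hi, cost, norm_eq_self hi, neg_neg,
          Real.exp_log (hμ.condProb_pos hi), condProb]
        field_simp
    rw [hhead]
    ring

end Spec

/-! ### The equivalence relation on fillers -/

section Relation

variable {A : Type*} [MeasurableSpace A] [MeasurableSingletonClass A] [Fintype A] [DecidableEq A]
  {μ : Measure (ℤ → A)} {a : A} {ξ : (ℤ → Bool) → (ℤ → ℕ)}

/-- The word of a filler, with the marks of the skeleton. -/
def Filler.marked {S : Skel} (w : Filler a S.hatWord) : List (A × ℕ) :=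
  List.ofFn fun j => (w.1 j, S.markWord j)

lemma Filler.map_fst_marked {S : Skel} (w : Filler a S.hatWord) :
    w.marked.map Prod.fst = List.ofFn w.1 := by
  rw [Filler.marked, List.map_ofFn]; rfl

lemma Filler.length_marked {S : Skel} (w : Filler a S.hatWord) : w.marked.length = S.len := by
  simp [Filler.marked]

lemma Filler.forall₂_marked {S : Skel} (w w' : Filler a S.hatWord) :
    List.Forall₂ (fun p q => (p.1 = a ↔ q.1 = a) ∧ p.2 = q.2) w.marked w'.marked := by
  rw [List.forall₂_iff_get]
  refine ⟨by simp [Filler.length_marked], fun i h1 h2 => ?_⟩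
  simp only [Filler.marked, List.get_eq_getElem, List.getElem_ofFn, and_true]
  rw [← decide_eq_decide, w.2, w'.2]

variable (μ) in
/-- The possible blocks of a filler, with their marks. -/
def Filler.items {S : Skel} (w : Filler a S.hatWord) : List (ℕ × List A) :=
  MarkedProc.items a (norm μ a) w.marked

variable (μ) in
/-- The flags of the revealed blocks of a filler. -/
def Filler.flags (C : ℝ) {S : Skel} (w : Filler a S.hatWord) : List Bool :=
  rev (cost μ a) (cap μ a C) (budget (condEntropy μ a)) (w.items μ)

variable (μ a) in
/-- Two fillers are equivalent if the same is revealed of them. -/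
abbrev revealRel (C : ℝ) : FillerRelations a := fun _ =>
  Setoid.ker fun w => revealed a (norm μ a) (cost μ a) (cap μ a C) (budget (condEntropy μ a))
    w.marked

lemma Filler.map_shape_items {S : Skel} (w w' : Filler a S.hatWord) :
    (w.items μ).map shape = (w'.items μ).map shape :=
  shape_items_congr (length_norm (μ := μ) (a := a)) (w.forall₂_marked w')

lemma Filler.map_snd_items {S : Skel} (w : Filler a S.hatWord) :
    (w.items μ).map Prod.snd = (blocks a (List.ofFn w.1)).map (norm μ a) := by
  rw [Filler.items, MarkedProc.map_snd_items, w.map_fst_marked]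

lemma Filler.length_flags (C : ℝ) {S : Skel} (w : Filler a S.hatWord) :
    (w.flags μ C).length = (w.items μ).length := length_rev _

lemma revealRel_iff {C : ℝ} {S : Skel} (w w' : Filler a S.hatWord) :
    (revealRel μ a C S).r w w' ↔
      mask (w.flags μ C) (w.items μ) = mask (w.flags μ C) (w'.items μ) := by
  have hlen : (w.items μ).length = (w'.items μ).length := by
    have := congrArg List.length (w.map_shape_items (μ := μ) w')
    simpa using this
  exact revealed_eq_iff hlen

variable (μ) in
/-- The information that is revealed of a filler. -/
def Filler.revealedCost (C : ℝ) {S : Skel} (w : Filler a S.hatWord) : ℝ :=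
  total (cost μ a) (w.flags μ C) (w.items μ)

lemma Filler.weight_items {S : Skel} (w : Filler a S.hatWord)
    (h : ∀ h0 : 0 < S.len, S.hatWord ⟨0, h0⟩ = true) : weight (w.items μ) = S.len := by
  rw [Filler.items, MarkedProc.weight_items (length_norm (μ := μ) (a := a)), w.length_marked]
  rw [w.map_fst_marked]
  rcases S with ⟨s, n, u, m⟩
  rcases n with _ | n
  · simp [starts_nil]
  · rw [List.ofFn_succ]
    have : w.1 0 = a := by
      have := (w.2 0).trans (h n.succ_pos)
      exact of_decide_eq_true this
    rw [this]
    exact starts_cons a _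

lemma Filler.revealedCost_spec (hμ : IsAperiodicMarkov μ) (hh : 0 ≤ condEntropy μ a) {C : ℝ}
    (hC : ∀ b : List A, cost μ a b ≤ C * (b.length + 1)) {S : Skel} (w : Filler a S.hatWord)
    (h : ∀ h0 : 0 < S.len, S.hatWord ⟨0, h0⟩ = true) :
    w.revealedCost μ C ≤ budget (condEntropy μ a) S.len ∧
    ∀ p ∈ List.zip (w.flags μ C) (w.items μ), p.1 = false →
      budget (condEntropy μ a) S.len < w.revealedCost μ C + cap μ a C p.2.2.length := by
  have := rev_spec (cost := cost μ a) (cap := cap μ a C) (F := budget (condEntropy μ a))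
    (fun i => hμ.cost_le_cap hC i.2) hμ.cost_nonneg (budget_nonneg _) (budget_add hh) (w.items μ)
  rwa [w.weight_items h] at this

end Relation

/-! ### Refinement of the product relation -/

section Product

variable {A : Type*} [MeasurableSpace A] [MeasurableSingletonClass A] [Fintype A] [DecidableEq A]
  {μ : Measure (ℤ → A)} {a : A} {ξ : (ℤ → Bool) → (ℤ → ℕ)}

lemma Filler.marked_sub {S : Skel} (w : Filler a S.hatWord) (k l : ℕ) (h : k + l ≤ S.len) :
    (w.sub k l h).marked = (w.marked.drop k).take l := by
  refine List.ext_getElem ?_ fun i h1 h2 => ?_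
  · rw [List.length_take, List.length_drop, Filler.length_marked, Filler.length_marked]
    simp only [Skel.sub]
    omega
  · simp [Filler.marked, Filler.sub, Skel.sub]

/-- The relation on a skeleton refines the product of the relations on its parts. -/
lemma revealRel_sub {C : ℝ} {ω : ℤ → Bool} (hω : ∀ i, 0 < ξ ω i → ω i = true) {α : ℤ} {n k l : ℕ}
    (hs : IsSkeleton (ξ ω) (α + k) l)
    (w w' : Filler a (skelOf ξ ω α n).hatWord) (hw : (revealRel μ a C (skelOf ξ ω α n)).r w w')
    (h : k + l ≤ (skelOf ξ ω α n).len) :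
    (revealRel μ a C ((skelOf ξ ω α n).sub k l h)).r (w.sub k l h) (w'.sub k l h) := by
  change revealed a (norm μ a) _ _ _ (w.sub k l h).marked =
    revealed a (norm μ a) _ _ _ (w'.sub k l h).marked
  change revealed a (norm μ a) _ _ _ w.marked = revealed a (norm μ a) _ _ _ w'.marked at hw
  have hsplit : ∀ w : Filler a (skelOf ξ ω α n).hatWord,
      w.marked = w.marked.take k ++ ((w.marked.drop k).take l ++ w.marked.drop (k + l)) := by
    intro w
    rw [← List.drop_drop, List.take_append_drop, List.take_append_drop]
  have hf := w.forall₂_marked w'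
  obtain ⟨hl, r, hr, hr1, hr2, hr3⟩ := hs
  have hlen := w.length_marked
  have hkl : k + l ≤ n := h
  have hget : ∀ i (hi : i < w.marked.length), w.marked[i] =
      (w.1 ⟨i, by rwa [w.length_marked] at hi⟩, ξ ω (α + (i : ℕ))) := by
    intro i hi
    simp [Filler.marked, skelOf]
  -- A positive mark sits on an occurrence of `a`, so the skeleton forces the letter `a` at the
  -- start of the part and just after it.
  have hmark : ∀ i (hi : i < w.marked.length), r ≤ ξ ω (α + (i : ℕ)) →
      w.marked[i] = (a, ξ ω (α + (i : ℕ))) := by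
    intro i hi hri
    rw [hget]
    congr 1
    have h1 := w.2 ⟨i, by rwa [w.length_marked] at hi⟩
    rw [show (skelOf ξ ω α n).hatWord ⟨i, _⟩ = ω (α + (i : ℕ)) from rfl, hω _ (by omega)] at h1
    exact of_decide_eq_true h1
  rw [w.marked_sub, w'.marked_sub]
  rw [hsplit w, hsplit w'] at hw
  refine revealed_part r hr (length_norm (μ := μ) (a := a)) (List.forall₂_take _ hf)
    (List.forall₂_take _ (List.forall₂_drop _ hf)) (List.forall₂_drop _ hf) ?_ ?_ hw
  · have hk : k < w.marked.length := by
      rw [hlen]; change k < n; omega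
    refine ⟨ξ ω (α + k), (w.marked.drop (k + 1)).take (l - 1), ?_, fun _ => hr1, ?_⟩
    · rw [List.drop_eq_getElem_cons hk, hmark k hk hr1]
      obtain ⟨l, rfl⟩ := Nat.exists_eq_succ_of_ne_zero hl.ne'
      rfl
    · intro p hp
      obtain ⟨i, hi, rfl⟩ := List.mem_iff_getElem.1 hp
      rw [List.getElem_take, List.getElem_drop, hget]
      simp only [List.length_take, List.length_drop, lt_min_iff] at hi
      refine hr3 _ ?_ ?_ <;> push_cast <;> omega
  · rcases hkl.lt_or_eq with hlt | heq
    · right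
      have hk : k + l < w.marked.length := by
        rw [hlen]; exact hlt
      have hr2' : r ≤ ξ ω (α + ((k + l : ℕ) : ℤ)) := by
        rw [show α + ((k + l : ℕ) : ℤ) = α + k + l by push_cast; ring]; exact hr2
      exact ⟨_, _, by rw [List.drop_eq_getElem_cons hk, hmark _ hk hr2'], hr2'⟩
    · left
      rw [List.drop_eq_nil_iff, hlen]
      exact heq.ge

end Product

/-! ### Information of the classes -/

section Information

variable {A : Type*} [MeasurableSpace A] [MeasurableSingletonClass A] [Fintype A] [DecidableEq A]
  {μ : Measure (ℤ → A)} {a : A} {ξ : (ℤ → Bool) → (ℤ → ℕ)}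

lemma Filler.hatList_ofFn {S : Skel} (w : Filler a S.hatWord) :
    hatList a (List.ofFn w.1) = List.ofFn S.hatWord := by
  rw [hatList, List.map_ofFn]
  congr 1
  funext j
  exact w.2 j

lemma Filler.blockProb_pos (hμ : IsAperiodicMarkov μ) {x : ℤ → A}
    (hx : ∀ (α : ℤ) (n : ℕ), 0 < μ.real {y | seg y α n = seg x α n}) {S : Skel}
    (h1 : x S.start = a) (h2 : x (S.start + S.len) = a)
    (hS : ∀ j : Fin S.len, S.hatWord j = hat a x (S.start + (j : ℕ))) (w : Filler a S.hatWord) :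
    (blocks a (List.ofFn w.1)).map List.length =
      (blocks a (seg x S.start S.len)).map List.length ∧
    ∀ i ∈ w.items μ, 0 < blockProb μ a i.2 := by
  have he : hatList a (List.ofFn w.1) = hatList a (seg x S.start S.len) := by
    rw [w.hatList_ofFn, hatList_seg, seg]
    congr 1
    funext j
    exact hS j
  have hb := (length_blocks_of_hatList_eq he).1
  refine ⟨hb, fun i hi => ?_⟩
  have h3 : i.2 ∈ (w.items μ).map Prod.snd := List.mem_map_of_mem hi
  rw [w.map_snd_items, List.mem_map] at h3
  obtain ⟨b, hbm, hbi⟩ := h3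
  rw [← hbi]
  refine hμ.blockProb_norm_pos ?_
  have h4 : b.length ∈ (blocks a (List.ofFn w.1)).map List.length := List.mem_map_of_mem hbm
  rw [hb, List.mem_map] at h4
  obtain ⟨c, hc, hcb⟩ := h4
  rw [← hcb]
  exact hμ.univ_pos (hμ.blockProb_pos_of_mem hx h1 h2 c hc)

/-- The information of the class of a filler. -/
lemma information_cls (hμ : IsAperiodicMarkov μ) {C : ℝ} {x : ℤ → A}
    (hx : ∀ (α : ℤ) (n : ℕ), 0 < μ.real {y | seg y α n = seg x α n}) {S : Skel} (hn : 0 < S.len)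
    (h1 : x S.start = a) (h2 : x (S.start + S.len) = a)
    (hS : ∀ j : Fin S.len, S.hatWord j = hat a x (S.start + (j : ℕ))) (w : Filler a S.hatWord) :
    information (fillerProb μ a S ((revealRel μ a C).cls S w)) =
      ((w.revealedCost μ C : ℝ) : EReal) := by
  have hprob := hμ.isProbabilityMeasure
  obtain ⟨hlen, hpos⟩ := w.blockProb_pos hμ hx h1 h2 hS
  set E : Set (ℤ → A) := {y | (∀ j : Fin S.len, hat a y (S.start + (j : ℕ)) = S.hatWord j) ∧
      y (S.start + S.len) = a} with hE
  set T : Set (ℤ → A) := {y | ∃ w' ∈ (revealRel μ a C).cls S w,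
    ∀ j : Fin S.len, y (S.start + (j : ℕ)) = w'.1 j} with hT
  have hEmem : ∀ y, y ∈ E ↔ y S.start = a ∧ y (S.start + S.len) = a ∧
      hatList a (seg y S.start S.len) = hatList a (seg x S.start S.len) := by
    intro y
    have : hatList a (seg y S.start S.len) = hatList a (seg x S.start S.len) ↔
        ∀ j : Fin S.len, hat a y (S.start + (j : ℕ)) = S.hatWord j := by
      rw [hatList_seg, hatList_seg, seg, seg, List.ofFn_inj, funext_iff]
      exact forall_congr' fun j => by rw [hS j]
    rw [hE, Set.mem_ofPred_eq, this]
    constructor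
    · rintro ⟨g1, g2⟩
      refine ⟨?_, g2, g1⟩
      have := g1 ⟨0, hn⟩
      rw [hS] at this
      simpa [hat, h1] using this
    · rintro ⟨-, g2, g1⟩
      exact ⟨g1, g2⟩
  have hsp : (spec μ a (w.flags μ C) (w.items μ)).map Prod.fst =
      (blocks a (seg x S.start S.len)).map List.length := by
    rw [map_fst_spec (w.length_flags C), w.map_snd_items, ← hlen, List.map_map]
    exact List.map_congr_left fun b _ => length_norm b
  -- Given the occurrences of `a`, the class is the event that the blocks match the specification
  -- read off the revealed blocks of w. Its probability follows from the independence of blocks.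
  have hET : E ∩ T = Matches a S.start (spec μ a (w.flags μ C) (w.items μ)) := by
    ext y
    rw [mem_matches_iff_hatList h1 hsp, ← hEmem, Set.mem_inter_iff]
    refine and_congr_right fun hy => ?_
    set v : Filler a S.hatWord := ⟨fun j => y (S.start + (j : ℕ)), hy.1⟩ with hv
    have hT' : y ∈ T ↔ (revealRel μ a C S).r w v := by
      rw [hT, Set.mem_ofPred_eq]
      constructor
      · rintro ⟨w', hw', he⟩
        have : w' = v := Subtype.ext (funext fun j => (he j).symm)
        rw [← this]
        exact hw'
      · intro hr
        exact ⟨v, hr, fun j => rfl⟩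
    rw [hT', revealRel_iff]
    exact mask_eq_iff_spec (w.length_flags C) (w.map_shape_items v) v.map_snd_items
  have hEset : E = {y | y S.start = a ∧ y (S.start + S.len) = a ∧
      hatList a (seg y S.start S.len) = hatList a (seg x S.start S.len)} := by
    ext y; exact hEmem y
  have hEm : MeasurableSet E := by
    have : E = Matches a S.start
        ((blocks a (seg x S.start S.len)).map fun b => (b.length, Set.univ)) := by
      ext y
      rw [mem_matches_iff_hatList h1 (by rw [List.map_map]; rfl), ← hEmem]
      refine ⟨fun hy => ⟨hy, ?_⟩, fun hy => hy.1⟩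
      have hl := (length_blocks_of_hatList_eq ((hEmem y).1 hy).2.2).1
      have hl' := congrArg List.length hl
      rw [List.length_map, List.length_map] at hl'
      rw [List.forall₂_iff_get]
      refine ⟨by rw [List.length_map, hl'], fun i _ _ => by simp⟩
    rw [this]
    exact (dependsOnIcc_matches _ _).measurableSet
  have hEreal : μ.real E = μ.real {x | x 0 = a} *
      ((blocks a (seg x S.start S.len)).map fun b => blockProbSet μ a b.length Set.univ).prod := by
    rw [hEset, hμ.real_matches_univ h1]
  have hprodeq : (((w.items μ).map Prod.snd).map fun b => blockProbSet μ a b.length Set.univ).prod =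
      ((blocks a (seg x S.start S.len)).map fun b => blockProbSet μ a b.length Set.univ).prod := by
    have : ((w.items μ).map Prod.snd).map List.length =
        (blocks a (seg x S.start S.len)).map List.length := by
      rw [← map_fst_spec (μ := μ) (a := a) (w.length_flags C), hsp]
    have := congrArg (List.map fun n => blockProbSet μ a n Set.univ) this
    rw [List.map_map, List.map_map (l := blocks a _)] at this
    exact congrArg List.prod this
  have hETreal : μ.real (E ∩ T) = μ.real E * Real.exp (-w.revealedCost μ C) := by
    rw [hET, hμ.real_matches, hμ.prod_spec (w.length_flags C) hpos, hprodeq, hEreal,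
      Filler.revealedCost]
    ring
  have hEpos : 0 < μ.real E := by
    rw [hEreal]
    refine mul_pos (hμ.pos_coord a) (List.prod_pos fun q hq => ?_)
    rw [List.mem_map] at hq
    obtain ⟨b, hb, rfl⟩ := hq
    exact hμ.univ_pos (hμ.blockProb_pos_of_mem hx h1 h2 b hb)
  have hfill : fillerProb μ a S ((revealRel μ a C).cls S w) =
      ENNReal.ofReal (Real.exp (-w.revealedCost μ C)) := by
    rw [fillerProb, cond_apply hEm]
    rw [← ofReal_measureReal (s := E), ← ofReal_measureReal (s := E ∩ T), hETreal,
      ← ENNReal.ofReal_inv_of_pos hEpos, ← ENNReal.ofReal_mul (by positivity)]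
    congr 1
    field_simp
  rw [hfill, information, ENNReal.log_ofReal_of_pos (Real.exp_pos _), Real.log_exp]
  simp

/-- Condition 1 is about points ω of the factor, whereas `information_cls` starts from a sample all
of whose words have positive probability. Almost every sample is such, so one of them lies over the
given window. -/
lemma exists_of_hatLaw_pos (hμ : IsAperiodicMarkov μ) {ω : ℤ → Bool} {α : ℤ} {n : ℕ}
    (h : 0 < (hatLaw μ a).real {ω' | seg ω' α n = seg ω α n}) :
    ∃ x : ℤ → A, (∀ (α : ℤ) (n : ℕ), 0 < μ.real {y | seg y α n = seg x α n}) ∧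
      seg (hat a x) α n = seg ω α n := by
  have hprob := hμ.isProbabilityMeasure
  by_contra! hc
  refine h.ne' ?_
  rw [hatLaw, map_measureReal_apply (measurable_hat a) (measurableSet_seg _ _ _),
    measureReal_eq_zero_iff]
  have := ae_seg_pos μ
  rw [ae_iff] at this
  refine measure_mono_null (fun x hx => ?_) this
  exact fun hp => hc x hp hx

/-- The upper bound on the information of the classes. -/
lemma information_cls_le (hμ : IsAperiodicMarkov μ) (hξ : IsMarkerFactor (hatLaw μ a) ξ)
    (hh : 0 < condEntropy μ a) {C : ℝ}
    (hC : ∀ b : List A, cost μ a b ≤ C * (b.length + 1)) :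
    ∃ N : ℕ, ∀ᵐ ω ∂(hatLaw μ a), ∀ (α : ℤ) (n : ℕ), IsSkeleton (ξ ω) α n → N ≤ n →
      ∀ w : Filler a (skelOf ξ ω α n).hatWord,
        information (fillerProb μ a (skelOf ξ ω α n)
          ((revealRel μ a C).cls (skelOf ξ ω α n) w)) ≤
            ((n * condEntropy μ a - Lam 0 (1 / 2) n : ℝ) : EReal) := by
  have := hμ.isProbabilityMeasure_hatLaw a
  refine ⟨⌈1 / condEntropy μ a ^ 2⌉₊, ?_⟩
  filter_upwards [ae_seg_pos (hatLaw μ a), hξ.ae_marks (hμ.measurePreserving_hatLaw a)]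
    with ω hω hm α n hs hN w
  -- The window has n + 1 letters, so as to include the `a` that closes the last block.
  obtain ⟨x, hx, hxω⟩ := exists_of_hatLaw_pos hμ (hω α (n + 1))
  obtain ⟨hn, r, hr, hr1, hr2, -⟩ := hs
  have he : ∀ i, α ≤ i → i ≤ α + n → hat a x i = ω i := by
    intro i g1 g2
    exact seg_eq_seg_iff.1 hxω i g1 (by push_cast; omega)
  have h1 : x α = a := by
    have := he α le_rfl (by omega)
    rw [hm α (by omega)] at this
    exact of_decide_eq_true this
  have h2 : x (α + n) = a := by
    have := he (α + n) (by omega) le_rfl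
    rw [hm (α + n) (by omega)] at this
    exact of_decide_eq_true this
  rw [information_cls hμ hx (S := skelOf ξ ω α n) hn h1 h2
    (fun j => (he _ (by omega) (by have := j.2; simp only [skelOf] at this ⊢; omega)).symm) w]
  rw [EReal.coe_le_coe_iff]
  refine (w.revealedCost_spec hμ hh.le hC (fun h0 => ?_)).1.trans
    (budget_eq hh (Nat.ceil_le.1 hN)).le
  change ω (α + ((0 : ℕ) : ℤ)) = true
  rw [Nat.cast_zero, add_zero]
  exact hm α (by omega)

end Information

/-! ### Hidden blocks and determined coordinates -/

section Hidden

variable {A : Type*}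

/-- The sum of a function over the hidden items. -/
def hidden (g : List A → ℝ) (fl : List Bool) (l : List (ℕ × List A)) : ℝ :=
  (List.zipWith (fun f i => if f = true then 0 else g i.2) fl l).sum

lemma total_add_hidden (g : List A → ℝ) {fl : List Bool} {l : List (ℕ × List A)}
    (h : fl.length = l.length) :
    total g fl l + hidden g fl l = ((l.map Prod.snd).map g).sum := by
  induction fl generalizing l with
  | nil => rw [List.length_eq_zero_iff.1 h.symm]; simp [total, hidden]
  | cons f fl ih =>
    rcases l with _ | ⟨i, l⟩
    · simp at h
    · have := ih (Nat.add_right_cancel_iff.1 h)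
      simp only [total, hidden, List.zipWith_cons_cons, List.sum_cons, List.map_cons] at this ⊢
      rw [← this]
      rcases f with _ | _ <;> simp <;> ring

lemma mul_hidden_le {g g' : List A → ℝ} {κ m : ℝ} {fl : List Bool} {l : List (ℕ × List A)}
    (h : ∀ p ∈ List.zip fl l, p.1 = false → κ * g p.2.2 ≤ m * g' p.2.2) :
    κ * hidden g fl l ≤ m * hidden g' fl l := by
  induction fl generalizing l with
  | nil => simp [hidden]
  | cons f fl ih =>
    rcases l with _ | ⟨i, l⟩
    · simp [hidden]
    · have h1 := ih fun p hp => h p (by rw [List.zip_cons_cons]; exact List.mem_cons_of_mem _ hp)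
      have h2 := h (f, i) (by rw [List.zip_cons_cons]; exact List.mem_cons_self)
      simp only [hidden, List.zipWith_cons_cons, List.sum_cons] at h1 ⊢
      rcases f with _ | _
      · have := h2 rfl
        simp only [Bool.false_eq_true, if_false]
        linarith
      · simpa using h1

lemma hidden_eq_zero {g : List A → ℝ} {fl : List Bool} {l : List (ℕ × List A)}
    (h : ∀ p ∈ List.zip fl l, p.1 ≠ false) : hidden g fl l = 0 := by
  have h1 := mul_hidden_le (g := g) (g' := fun _ => 0) (κ := 1) (m := 0)
    fun p hp e => absurd e (h p hp)
  have h2 := mul_hidden_le (g := g) (g' := fun _ => 0) (κ := -1) (m := 0)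
    fun p hp e => absurd e (h p hp)
  linarith

/-- The positions of a word whose letters are determined by the revealed items. -/
def positions (fl : List Bool) (l : List (ℕ × List A)) : List Bool :=
  (List.zipWith (fun f i => true :: List.replicate i.2.length f) fl l).flatten

lemma count_positions {fl : List Bool} {l : List (ℕ × List A)} (h : fl.length = l.length) :
    (positions fl l).length = weight l ∧
    ((positions fl l).count true : ℝ) = weight l - hidden (fun b => (b.length : ℝ)) fl l := by
  induction fl generalizing l with
  | nil => rw [List.length_eq_zero_iff.1 h.symm]; simp [positions, hidden, weight]
  | cons f fl ih =>
    rcases l with _ | ⟨i, l⟩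
    · simp at h
    · have := ih (Nat.add_right_cancel_iff.1 h)
      simp only [positions, hidden, weight, List.zipWith_cons_cons, List.flatten_cons,
        List.length_append, List.length_cons, List.length_replicate, List.map_cons,
        List.sum_cons, List.count_append, List.count_cons_self] at this ⊢
      refine ⟨by rw [this.1], ?_⟩
      rw [Nat.cast_add, Nat.cast_add, Nat.cast_add, this.2]
      generalize (List.map (fun i : ℕ × List A => i.2.length + 1) l).sum = W
      rcases f with _ | _
      · simp [List.count_replicate]; ring
      · simp; ring

/-- The `a` in front of a block is known from the lengths, and the other letters of a revealed block
from the block itself. Equal lengths keep the two words aligned. -/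
lemma getElem?_eq_of_mask (a : A) {fl : List Bool} {l l' : List (ℕ × List A)}
    (h : fl.length = l.length) (h' : fl.length = l'.length) (hm : mask fl l = mask fl l') (i : ℕ)
    (hi : (positions fl l)[i]? = some true) :
    ((l.map Prod.snd).flatMap (a :: ·))[i]? = ((l'.map Prod.snd).flatMap (a :: ·))[i]? := by
  induction fl generalizing l l' i with
  | nil =>
    rw [List.length_eq_zero_iff.1 h.symm, List.length_eq_zero_iff.1 h'.symm]
  | cons f fl ih =>
    rcases l with _ | ⟨c, l⟩
    · simp at h
    rcases l' with _ | ⟨c', l'⟩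
    · simp at h'
    have hs := shape_eq_of_mask h h' hm
    simp only [List.map_cons, List.cons.injEq, shape, Prod.mk.injEq] at hs
    simp only [mask, List.zipWith_cons_cons, List.cons.injEq] at hm
    have ih' := ih (Nat.add_right_cancel_iff.1 h) (Nat.add_right_cancel_iff.1 h') hm.2
    simp only [List.map_cons, List.flatMap_cons, List.cons_append]
    rcases i with _ | i
    · simp
    simp only [positions, List.zipWith_cons_cons, List.flatten_cons, List.cons_append,
      List.getElem?_cons_succ] at hi ih' ⊢
    rcases lt_or_ge i c.2.length with hlt | hge
    · rw [List.getElem?_append_left (by simpa using hlt)] at hi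
      rw [List.getElem?_append_left hlt, List.getElem?_append_left (hs.1.2 ▸ hlt)]
      rw [List.getElem?_replicate, if_pos hlt] at hi
      obtain rfl : f = true := by simpa using hi
      have : c = c' := by simpa [view] using hm.1
      rw [this]
    · rw [List.getElem?_append_right (by simpa using hge), List.length_replicate] at hi
      rw [List.getElem?_append_right hge, List.getElem?_append_right (hs.1.2 ▸ hge), ← hs.1.2]
      exact ih' _ hi

lemma sum_range_getD (l : List Bool) :
    ∑ j ∈ Finset.range l.length, (if l.getD j false = true then (1 : ℝ) else 0) =
      l.count true := by
  induction l with
  | nil => simp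
  | cons f l ih =>
    rw [List.length_cons, Finset.sum_range_succ']
    simp only [List.getD_cons_succ, ih, List.getD_cons_zero, List.count_cons]
    rcases f with _ | _ <;> simp

lemma sum_Ico_int (g : ℤ → ℝ) (α : ℤ) (n : ℕ) :
    ∑ i ∈ Finset.Ico α (α + n), g i = ∑ j ∈ Finset.range n, g (α + j) := by
  refine Finset.sum_nbij' (fun i => (i - α).toNat) (fun j => α + j) ?_ ?_ ?_ ?_ ?_
  · intro i hi; rw [Finset.mem_Ico] at hi; rw [Finset.mem_range]; omega
  · intro j hj; rw [Finset.mem_range] at hj; rw [Finset.mem_Ico]; omega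
  · intro i hi; rw [Finset.mem_Ico] at hi; omega
  · intro j hj; omega
  · intro i hi; rw [Finset.mem_Ico] at hi; congr 1; omega

end Hidden

/-! ### Information and determined fraction on `S_r` -/

section Determined

variable {A : Type*} [MeasurableSpace A] [MeasurableSingletonClass A] [Fintype A] [DecidableEq A]
  {μ : Measure (ℤ → A)} {a : A} {ξ : (ℤ → Bool) → (ℤ → ℕ)}

lemma eq_flatMap_blocks {l : List A} (h : Starts a l) : l = (blocks a l).flatMap (a :: ·) := by
  have := initial_append_flatMap_blocks a l
  rw [h, List.nil_append] at this
  exact this.symm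

lemma getElem?_seg (x : ℤ → A) (α : ℤ) {n j : ℕ} (h : j < n) :
    (seg x α n)[j]? = some (x (α + j)) := by
  rw [List.getElem?_eq_getElem (by simpa using h)]
  simp [seg]

variable (μ a ξ) in
/-- The marked and normed blocks of `S_r`. -/
def itemsAt (r : ℕ) (x : ℤ → A) : List (ℕ × List A) :=
  (fillerOf ξ a x (leftEnd (ξ (hat a x)) r) (size ξ a r x)).items μ

variable (μ a ξ) in
/-- The revelation flags of the blocks of `S_r`. -/
def flagsAt (C : ℝ) (r : ℕ) (x : ℤ → A) : List Bool :=
  (fillerOf ξ a x (leftEnd (ξ (hat a x)) r) (size ξ a r x)).flags μ C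

lemma length_flagsAt (C : ℝ) (r : ℕ) (x : ℤ → A) :
    (flagsAt μ a ξ C r x).length = (itemsAt μ a ξ r x).length :=
  Filler.length_flags C _

lemma IsTypical.map_snd_itemsAt (hμ : IsAperiodicMarkov μ) {x : ℤ → A}
    (hx : IsTypical μ a ξ x) {r : ℕ} (hr : 0 < r) (hs : 0 < size ξ a r x) :
    (itemsAt μ a ξ r x).map Prod.snd =
      blocks a (seg x (leftEnd (ξ (hat a x)) r) (size ξ a r x)) := by
  obtain ⟨-, -, -, h1, h2⟩ := hx.size_spec hr hs
  rw [itemsAt, Filler.map_snd_items]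
  change (blocks a (seg x _ _)).map _ = _
  conv_rhs => rw [← List.map_id (blocks a (seg x _ _))]
  refine List.map_congr_left fun b hb => ?_
  exact norm_eq_self (hμ.blockProb_pos_of_mem hx.pos h1 h2 b hb)

/-- The data that an equivalence class retains. -/
def classData (C : ℝ) (c : Σ S : Skel, Quotient (revealRel μ a C S)) :
    ℤ × ℕ × List ((ℕ × List A) ⊕ (ℕ × ℕ)) :=
  (c.1.start, c.1.len, c.2.lift (fun w => revealed a (norm μ a) (cost μ a) (cap μ a C)
    (budget (condEntropy μ a)) w.marked) fun _ _ h => h)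

/-- The random class lives in a sigma type over skeletons. Passing to `classData` avoids
transporting fillers along an equality of skeletons; the flags are then recovered from the mask. -/
lemma randomClass_eq {C : ℝ} {r : ℕ} {x y : ℤ → A}
    (h : (revealRel μ a C).randomClass ξ r y = (revealRel μ a C).randomClass ξ r x) :
    leftEnd (ξ (hat a y)) r = leftEnd (ξ (hat a x)) r ∧ size ξ a r y = size ξ a r x ∧
    (flagsAt μ a ξ C r x).length = (itemsAt μ a ξ r y).length ∧
    mask (flagsAt μ a ξ C r x) (itemsAt μ a ξ r x) =
      mask (flagsAt μ a ξ C r x) (itemsAt μ a ξ r y) := by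
  have h' := congrArg (classData (μ := μ) C) h
  have h1 := congrArg Prod.fst h'
  have h2 := congrArg (fun z => z.2.1) h'
  have h3 : mask (flagsAt μ a ξ C r y) (itemsAt μ a ξ r y) =
    mask (flagsAt μ a ξ C r x) (itemsAt μ a ξ r x) := congrArg (fun z => z.2.2) h'
  have h4 := flags_eq_of_mask (length_flagsAt C r y) (length_flagsAt C r x) h3
  refine ⟨h1, h2, by rw [← h4, length_flagsAt], ?_⟩
  rw [← h3, h4]

/-- The atypical y form a null set. A typical y has only possible blocks, which `norm` leaves
unchanged, so equal revealed data mean equal letters. -/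
lemma mem_determines (hμ : IsAperiodicMarkov μ) (hξ : IsMarkerFactor (hatLaw μ a) ξ) {C : ℝ}
    {x : ℤ → A} (hx : IsTypical μ a ξ x) {r : ℕ} (hr : 0 < r) (hs : 0 < size ξ a r x) {j : ℕ}
    (hj : j < size ξ a r x)
    (hp : (positions (flagsAt μ a ξ C r x) (itemsAt μ a ξ r x))[j]? = some true) :
    x ∈ Determines μ ((revealRel μ a C).randomClass ξ r)
      (fun y => y (leftEnd (ξ (hat a x)) r + j)) := by
  have hnull := hμ.ae_isTypical hξ
  rw [ae_iff] at hnull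
  refine measure_mono_null ?_ hnull
  intro y hy hty
  obtain ⟨hy1, hy2⟩ := hy
  obtain ⟨e1, e2, e3, e4⟩ := randomClass_eq hy1
  refine hy2 ?_
  have key := getElem?_eq_of_mask a (length_flagsAt C r x) e3 e4 j hp
  have hs' : 0 < size ξ a r y := e2 ▸ hs
  rw [hx.map_snd_itemsAt hμ hr hs, hty.map_snd_itemsAt hμ hr hs', e1, e2] at key
  have hx1 := (hx.size_spec hr hs).2.2.2.1
  have hy1 := (hty.size_spec hr hs').2.2.2.1
  rw [e1] at hy1
  rw [← eq_flatMap_blocks (starts_seg (.inr hx1)), ← eq_flatMap_blocks (starts_seg (.inr hy1)),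
    getElem?_seg _ _ hj, getElem?_seg _ _ hj] at key
  exact (Option.some_injective _ key).symm

lemma weight_itemsAt {x : ℤ → A} (hx : IsTypical μ a ξ x) {r : ℕ} (hr : 0 < r)
    (hs : 0 < size ξ a r x) : weight (itemsAt μ a ξ r x) = size ξ a r x := by
  refine Filler.weight_items _ fun h0 => ?_
  change decide (x (_ + ((0 : ℕ) : ℤ)) = a) = true
  rw [Nat.cast_zero, add_zero]
  exact decide_eq_true (hx.size_spec hr hs).2.2.2.1

lemma le_determinedFraction (hμ : IsAperiodicMarkov μ) (hξ : IsMarkerFactor (hatLaw μ a) ξ)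
    {C : ℝ} {x : ℤ → A} (hx : IsTypical μ a ξ x) {r : ℕ} (hr : 0 < r) (hs : 0 < size ξ a r x) :
    1 - hidden (fun b => (b.length : ℝ)) (flagsAt μ a ξ C r x) (itemsAt μ a ξ r x) /
        size ξ a r x ≤
      (revealRel μ a C).determinedFraction μ ξ r x := by
  obtain ⟨h1, h2⟩ := count_positions (length_flagsAt (μ := μ) (a := a) (ξ := ξ) C r x)
  rw [weight_itemsAt hx hr hs] at h1 h2
  rw [FillerRelations.determinedFraction, (hx.size_spec hr hs).2.1, sum_Ico_int]
  have hle : (size ξ a r x : ℝ) -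
      hidden (fun b => (b.length : ℝ)) (flagsAt μ a ξ C r x) (itemsAt μ a ξ r x) ≤
      ∑ j ∈ Finset.range (size ξ a r x), (Determines μ ((revealRel μ a C).randomClass ξ r)
        (fun y => y (leftEnd (ξ (hat a x)) r + j))).indicator (fun _ => (1 : ℝ)) x := by
    rw [← h2, ← sum_range_getD, h1]
    refine Finset.sum_le_sum fun j hj => ?_
    rw [Finset.mem_range] at hj
    split_ifs with hp
    · rw [Set.indicator_of_mem (mem_determines hμ hξ hx hr hs hj ?_)]
      rw [List.getD_eq_getElem _ _ (by omega)] at hp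
      rw [List.getElem?_eq_getElem (by omega), hp]
    · exact Set.indicator_nonneg (fun _ _ => zero_le_one) _
  have hs' : (0 : ℝ) < size ξ a r x := by exact_mod_cast hs
  rw [one_div, inv_mul_eq_div, le_div_iff₀ hs', sub_mul, one_mul, div_mul_cancel₀ _ hs'.ne']
  exact hle

variable (μ a) in
/-- The information of the blocks is close to its mean, and there are no long blocks. -/
structure IsRegular (ℓ : ℝ) (x : ℤ → A) (α : ℤ) (n : ℕ) : Prop where
  deviation : |((blocks a (seg x α n)).map (cost μ a)).sum - n * condEntropy μ a| ≤ ℓ * √n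
  length_le : ∀ b ∈ blocks a (seg x α n), (b.length : ℝ) + 1 ≤ ℓ

lemma IsRegular.mono {ℓ ℓ' : ℝ} {x : ℤ → A} {α : ℤ} {n : ℕ} (h : IsRegular μ a ℓ x α n)
    (hl : ℓ ≤ ℓ') : IsRegular μ a ℓ' x α n :=
  ⟨h.deviation.trans (by gcongr), fun b hb => (h.length_le b hb).trans hl⟩

lemma randomInformation_eq (hμ : IsAperiodicMarkov μ) {C : ℝ} {x : ℤ → A}
    (hx : IsTypical μ a ξ x) {r : ℕ} (hr : 0 < r) (hs : 0 < size ξ a r x) :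
    (revealRel μ a C).randomInformation μ ξ r x =
      ((total (cost μ a) (flagsAt μ a ξ C r x) (itemsAt μ a ξ r x) : ℝ) : EReal) := by
  obtain ⟨-, -, -, h1, h2⟩ := hx.size_spec hr hs
  exact information_cls hμ hx.pos (S := skelAt ξ a r x) hs h1 h2 (fun _ => rfl) _

lemma cap_le {C : ℝ} (hC : 0 < C) (n : ℕ) : cap μ a C n ≤ C * (n + 1) := by
  rw [cap]
  split_ifs
  · positivity
  · exact le_rfl

/-- Put ℓ = log² n. If some block is hidden, its cap, at most Cℓ, did not fit, and the revealed cost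
exceeds nh - √n - Cℓ; if none is hidden, it is the total cost, at least nh - ℓ√n. So the hidden
blocks cost at most 2ℓ√n in all. Each costs at least κ and is at most ℓ long, so they have at most
2ℓ²√n/κ letters; one further logarithm absorbs 2/κ, whence the exponent 5 = 4 + 1. -/
lemma information_and_fraction (hμ : IsAperiodicMarkov μ) (hξ : IsMarkerFactor (hatLaw μ a) ξ)
    (hred : ProbabilityReduction μ a) (hh : 0 < condEntropy μ a) {C : ℝ} (hC0 : 0 < C)
    (hC : ∀ b : List A, cost μ a b ≤ C * (b.length + 1)) :
    ∃ N : ℕ, ∀ (r : ℕ) (x : ℤ → A), 0 < r → IsTypical μ a ξ x → N ≤ size ξ a r x →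
      IsRegular μ a (Real.log (size ξ a r x) ^ 2) x (leftEnd (ξ (hat a x)) r) (size ξ a r x) →
      ((size ξ a r x * condEntropy μ a - Lam 2 (1 / 2) (size ξ a r x) : ℝ) : EReal) ≤
        (revealRel μ a C).randomInformation μ ξ r x ∧
      1 - Lam 5 (-(1 / 2)) (size ξ a r x) ≤ (revealRel μ a C).determinedFraction μ ξ r x := by
  obtain ⟨κ, hκ, hcost⟩ := hμ.exists_le_cost hred
  -- The first and third bounds give √n ≤ ℓ√n/2 and Cℓ ≤ ℓ√n/2; the second absorbs the factor 2/κ.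
  have e1 : ∀ᶠ n : ℕ in atTop, 2 ≤ Real.log n ∧ 2 / κ ≤ Real.log n ∧ 2 * C ≤ √n := by
    have hl := Real.tendsto_log_atTop.comp tendsto_natCast_atTop_atTop
    have hq := Real.tendsto_sqrt_atTop.comp tendsto_natCast_atTop_atTop
    filter_upwards [hl.eventually_ge_atTop 2, hl.eventually_ge_atTop (2 / κ),
      hq.eventually_ge_atTop (2 * C)] with n h1 h2 h3 using ⟨h1, h2, h3⟩
  obtain ⟨N, hN⟩ := eventually_atTop.1 (e1.and (eventually_ge_atTop 1))
  refine ⟨N, fun r x hr hx hNx hreg => ?_⟩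
  obtain ⟨⟨hlog, hlogκ, hsqrt⟩, hn1⟩ := hN _ hNx
  have hs : 0 < size ξ a r x := hn1
  have hmap := hx.map_snd_itemsAt hμ hr hs
  have hinfo := randomInformation_eq (C := C) hμ hx hr hs
  have hfrac := le_determinedFraction (C := C) hμ hξ hx hr hs
  have hspec := Filler.revealedCost_spec hμ hh.le hC
    (fillerOf ξ a x (leftEnd (ξ (hat a x)) r) (size ξ a r x)) (fun h0 => by
      change decide (x (_ + ((0 : ℕ) : ℤ)) = a) = true
      rw [Nat.cast_zero, add_zero]
      exact decide_eq_true (hx.size_spec hr hs).2.2.2.1)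
  change total _ (flagsAt μ a ξ C r x) (itemsAt μ a ξ r x) ≤ budget _ (size ξ a r x) ∧
    ∀ p ∈ List.zip (flagsAt μ a ξ C r x) (itemsAt μ a ξ r x), p.1 = false →
      budget _ (size ξ a r x) < total _ (flagsAt μ a ξ C r x) (itemsAt μ a ξ r x) + _ at hspec
  have hsum := total_add_hidden (cost μ a) (length_flagsAt (μ := μ) (a := a) (ξ := ξ) C r x)
  rw [hmap] at hsum
  have hbp := hμ.blockProb_pos_of_mem hx.pos (hx.size_spec hr hs).2.2.2.1
    (hx.size_spec hr hs).2.2.2.2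
  have hmem : ∀ p ∈ List.zip (flagsAt μ a ξ C r x) (itemsAt μ a ξ r x),
      p.2.2 ∈ blocks a (seg x (leftEnd (ξ (hat a x)) r) (size ξ a r x)) := by
    intro p hp
    rw [← hmap]
    exact List.mem_map_of_mem (List.of_mem_zip (a := p.1) (b := p.2) hp).2
  rw [hinfo, EReal.coe_le_coe_iff]
  set n := size ξ a r x
  set T := total (cost μ a) (flagsAt μ a ξ C r x) (itemsAt μ a ξ r x)
  set H := hidden (cost μ a) (flagsAt μ a ξ C r x) (itemsAt μ a ξ r x)
  set D := hidden (fun b => (b.length : ℝ)) (flagsAt μ a ξ C r x) (itemsAt μ a ξ r x)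
  have hdev := abs_le.1 hreg.deviation
  rw [← hsum] at hdev
  set ℓ := Real.log (n : ℝ) ^ 2 with hℓ
  have hℓ2 : 2 ≤ ℓ := by rw [hℓ]; nlinarith
  have hn0 : (0 : ℝ) < n := by exact_mod_cast hs
  have hbud : n * condEntropy μ a - √n ≤ budget (condEntropy μ a) n := le_max_right _ _
  have hT : n * condEntropy μ a - ℓ * √n ≤ T ∧ κ * D ≤ ℓ * H := by
    refine ⟨?_, mul_hidden_le fun p hp hf => ?_⟩
    · by_cases hex : ∃ p ∈ List.zip (flagsAt μ a ξ C r x) (itemsAt μ a ξ r x), p.1 = false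
      · obtain ⟨p, hp, hf⟩ := hex
        have g1 := hspec.2 p hp hf
        have g2 := cap_le (μ := μ) (a := a) hC0 p.2.2.length
        have g3 : C * ((p.2.2.length : ℝ) + 1) ≤ C * ℓ := by
          gcongr
          exact hreg.length_le _ (hmem p hp)
        have g4 : 2 * C * ℓ ≤ √n * ℓ := by gcongr
        have g5 : 2 * √(n : ℝ) ≤ ℓ * √n := by gcongr
        linarith
      · push Not at hex
        have : H = 0 := hidden_eq_zero hex
        rw [this] at hdev
        linarith [hdev.1]
    · have g1 := hspec.2 p hp hf
      -- A block with cap 0 would have fitted into the budget, so a hidden block is not determined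
      -- by its length and costs at least κ.
      have g2 := hcost C p.2.2 (hμ.univ_pos (hbp _ (hmem p hp))) (fun h0 => by
        rw [h0] at g1; linarith [hspec.1])
      have g3 := hreg.length_le _ (hmem p hp)
      calc κ * (p.2.2.length : ℝ) ≤ κ * ℓ := by gcongr; linarith
        _ ≤ cost μ a p.2.2 * ℓ := by gcongr
        _ = ℓ * cost μ a p.2.2 := mul_comm _ _
  have hr2 : Lam 2 (1 / 2) (n : ℝ) = ℓ * √n := by
    rw [Lam, Real.rpow_ofNat, ← Real.sqrt_eq_rpow, mul_comm]
  have hr5 : Lam 5 (-(1 / 2)) (n : ℝ) = Real.log n * ℓ ^ 2 * √n / n := by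
    rw [Lam, Real.rpow_ofNat, Real.rpow_neg hn0.le, ← Real.sqrt_eq_rpow, hℓ]
    have hq : √(n : ℝ) * √n = n := Real.mul_self_sqrt hn0.le
    have hq0 : √(n : ℝ) ≠ 0 := (Real.sqrt_pos.2 hn0).ne'
    rw [eq_div_iff hn0.ne']
    nth_rw 3 [← hq]
    field_simp
  refine ⟨by rw [hr2]; exact hT.1, le_trans ?_ hfrac⟩
  rw [hr5]
  have hHle : H ≤ 2 * (ℓ * √n) := by linarith [hT.1, hdev.2]
  have hDle : D ≤ Real.log n * ℓ ^ 2 * √n := by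
    have g1 : κ * D ≤ 2 * (ℓ ^ 2 * √n) := by
      refine hT.2.trans ?_
      calc ℓ * H ≤ ℓ * (2 * (ℓ * √n)) := by gcongr
        _ = 2 * (ℓ ^ 2 * √n) := by ring
    have g2 : 2 * (ℓ ^ 2 * √n) ≤ κ * (Real.log n * ℓ ^ 2 * √n) := by
      have : 2 ≤ κ * Real.log n := by rwa [div_le_iff₀' hκ] at hlogκ
      calc 2 * (ℓ ^ 2 * √(n : ℝ)) ≤ κ * Real.log n * (ℓ ^ 2 * √n) := by gcongr
        _ = _ := by ring
    exact le_of_mul_le_mul_left (g1.trans g2) hκ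
  gcongr

end Determined

/-! ### Superpolynomial decay -/

section Delta

variable {L : ℕ → ℝ}

lemma IsDelta.of_le {f g : ℕ → ℝ} (hg : IsDelta g L) (h0 : ∀ r, 0 ≤ f r)
    (h : ∀ᶠ r in atTop, f r ≤ g r) : IsDelta f L := fun k hk => by
  refine (IsBigO.of_bound 1 ?_).trans (hg k hk)
  filter_upwards [h] with r hr
  rw [one_mul, Real.norm_of_nonneg (h0 r)]
  exact hr.trans (le_abs_self _)

lemma IsDelta.add {f g : ℕ → ℝ} (hf : IsDelta f L) (hg : IsDelta g L) :
    IsDelta (fun r => f r + g r) L := fun k hk => (hf k hk).add (hg k hk)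

lemma IsDelta.tendsto_zero {f : ℕ → ℝ} (hf : IsDelta f L) (hL : Tendsto L atTop atTop) :
    Tendsto f atTop (𝓝 0) := by
  refine (hf 1 le_rfl).trans_tendsto ?_
  simpa [Function.comp_def] using tendsto_inv_atTop_zero.comp hL

/-- Superpolynomial decay of `exp (-t (log L)²)`. -/
lemma isDelta_exp (hL : Tendsto L atTop atTop) (B : ℝ) {t : ℝ} (ht : 0 < t) :
    IsDelta (fun r => B * (L r + 1) ^ 2 * Real.exp (-(t * (Real.log (L r) / 2) ^ 2))) L := by
  intro k _
  refine IsBigO.of_bound (|B| * 4) ?_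
  filter_upwards [hL.eventually_ge_atTop 1,
    (Real.tendsto_log_atTop.comp hL).eventually_ge_atTop (4 * (k + 2) / t)] with r h1 h2
  have hpos : 0 < L r := by linarith
  -- Two of the k + 2 powers pay for the factor (L + 1)².
  have hexp : Real.exp (-(t * (Real.log (L r) / 2) ^ 2)) ≤ (L r ^ (k + 2))⁻¹ := by
    rw [← Real.exp_log (pow_pos hpos (k + 2)), ← Real.exp_neg, Real.log_pow, Real.exp_le_exp,
      neg_le_neg_iff]
    have h3 : 4 * ((k : ℝ) + 2) ≤ Real.log (L r) * t := by
      rwa [Function.comp, div_le_iff₀ ht] at h2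
    have h4 : 0 ≤ Real.log (L r) := Real.log_nonneg h1
    push_cast
    nlinarith
  rw [norm_mul, norm_mul, Real.norm_eq_abs, Real.norm_of_nonneg (Real.exp_pos _).le,
    Real.norm_of_nonneg (sq_nonneg _), Real.norm_of_nonneg (by positivity)]
  calc |B| * (L r + 1) ^ 2 * Real.exp (-(t * (Real.log (L r) / 2) ^ 2))
      ≤ |B| * (2 * L r) ^ 2 * (L r ^ (k + 2))⁻¹ := by gcongr; linarith
    _ = |B| * 4 * (L r ^ k)⁻¹ := by field_simp; ring

end Delta

/-! ### Regularity of `S_r` -/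

section Regular

variable {A : Type*} [MeasurableSpace A] [MeasurableSingletonClass A] [Fintype A] [DecidableEq A]
  {μ : Measure (ℤ → A)} {a : A} {ξ : (ℤ → Bool) → (ℤ → ℕ)}

lemma exists_seg_of_mem_blocks {x : ℤ → A} {α : ℤ} {n : ℕ} {b : List A}
    (hb : b ∈ blocks a (seg x α n)) :
    ∃ β, α ≤ β ∧ β ≤ α + n ∧ a ∉ seg x β b.length := by
  have hab := notMem_of_mem_blocks a hb
  obtain ⟨B₁, B₂, hB⟩ := List.append_of_mem hb
  have h := initial_append_flatMap_blocks a (seg x α n)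
  rw [hB, List.flatMap_append, List.flatMap_cons, List.cons_append] at h
  set p := initial a (seg x α n) ++ (B₁.flatMap (a :: ·) ++ [a]) with hp
  set s := B₂.flatMap (a :: ·) with hs
  have h' : seg x α n = p ++ (b ++ s) := by
    rw [← h, hp]; simp
  have hn : n = p.length + (b.length + s.length) := by
    have := congrArg List.length h'
    simpa using this
  refine ⟨α + p.length, by omega, by omega, ?_⟩
  rw [hn, seg_add, seg_add] at h'
  have h1 := (List.append_inj h' (by simp)).2
  have h2 := (List.append_inj h1 (by simp)).1
  rwa [h2]

/-- Irregular intervals are unlikely. -/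
lemma IsAperiodicMarkov.exists_irregular_bound (hμ : IsAperiodicMarkov μ) (a : A) :
    ∃ B t : ℝ, 0 < B ∧ 0 < t ∧ ∀ (M : ℕ) (ℓ : ℝ), 0 ≤ ℓ →
      μ.real {x | ∃ (α : ℤ) (n : ℕ), -M ≤ α ∧ α ≤ 0 ∧ 0 < n ∧ n ≤ M ∧ x α = a ∧ x (α + n) = a ∧
        ¬ IsRegular μ a ℓ x α n} ≤ B * (M + 1) ^ 2 * Real.exp (-(t * ℓ)) := by
  have hprob := hμ.isProbabilityMeasure
  obtain ⟨K, t₁, hK, ht₁, hdev⟩ := hμ.exists_deviation_bound a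
  obtain ⟨C, θ, hC, hθ0, hθ1, htail⟩ := hμ.exists_tail_bound a
  have hlogθ : Real.log θ < 0 := Real.log_neg hθ0 hθ1
  refine ⟨K + 2 * (C * θ⁻¹), min t₁ (-Real.log θ), by positivity,
    lt_min ht₁ (neg_pos.2 hlogθ), fun M ℓ hℓ => ?_⟩
  set t := min t₁ (-Real.log θ)
  set D : ℤ → ℕ → Set (ℤ → A) := fun α n => {x | x α = a ∧ x (α + n) = a ∧
    ℓ * √n ≤ |((blocks a (seg x α n)).map (cost μ a)).sum - n * infoRate μ a|}
  set G : ℤ → Set (ℤ → A) := fun β => {x | a ∉ seg x β ⌊ℓ⌋₊}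
  -- All candidate intervals are treated at once: M(M + 1) deviation events, and 2M + 1 events of an
  -- `a`-free segment of length ⌊ℓ⌋, one of which occurs if a block is too long.
  have hsub : {x | ∃ (α : ℤ) (n : ℕ), -M ≤ α ∧ α ≤ 0 ∧ 0 < n ∧ n ≤ M ∧ x α = a ∧ x (α + n) = a ∧
        ¬ IsRegular μ a ℓ x α n} ⊆
      (⋃ p ∈ Finset.Icc (-M : ℤ) 0 ×ˢ Finset.Icc 1 M, D p.1 p.2) ∪
        ⋃ β ∈ Finset.Icc (-M : ℤ) M, G β := by
    rintro x ⟨α, n, h1, h2, h3, h4, h5, h6, h7⟩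
    by_contra hc
    simp only [Set.mem_union, Set.mem_iUnion, not_or, not_exists] at hc
    refine h7 ⟨?_, fun b hb => ?_⟩
    · by_contra! hlt
      rw [hμ.condEntropy_eq] at hlt
      refine hc.1 (α, n) ?_ ⟨h5, h6, hlt.le⟩
      simp only [Finset.mem_product, Finset.mem_Icc]
      omega
    · by_contra! hlt
      obtain ⟨β, g1, g2, g3⟩ := exists_seg_of_mem_blocks hb
      refine hc.2 β (Finset.mem_Icc.2 ⟨by omega, by omega⟩) fun hmem => g3 ?_
      rw [mem_seg_iff] at hmem ⊢
      obtain ⟨i, hi1, hi2, hi3⟩ := hmem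
      refine ⟨i, hi1, hi2.trans_le ?_, hi3⟩
      have : ⌊ℓ⌋₊ ≤ b.length := by
        have h8 := Nat.floor_le hℓ
        have h9 : (⌊ℓ⌋₊ : ℝ) < b.length + 1 := h8.trans_lt hlt
        exact Nat.lt_succ_iff.1 (by exact_mod_cast h9)
      omega
  have hD : ∀ p ∈ Finset.Icc (-M : ℤ) 0 ×ˢ Finset.Icc 1 M,
      μ.real (D p.1 p.2) ≤ K * Real.exp (-(t * ℓ)) := by
    intro p hp
    simp only [Finset.mem_product, Finset.mem_Icc] at hp
    refine (hdev p.2 p.1 ℓ (by omega)).trans ?_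
    gcongr
    exact min_le_left _ _
  have hG : ∀ β ∈ Finset.Icc (-M : ℤ) M, μ.real (G β) ≤ C * θ⁻¹ * Real.exp (-(t * ℓ)) := by
    intro β _
    refine (htail β _).trans ?_
    rw [mul_assoc]
    gcongr
    rw [← Real.exp_log (pow_pos hθ0 _), Real.log_pow]
    have hinv : θ⁻¹ = Real.exp (-Real.log θ) := by rw [Real.exp_neg, Real.exp_log hθ0]
    rw [hinv, ← Real.exp_add, Real.exp_le_exp]
    have h1 : t * ℓ ≤ -Real.log θ * ℓ := by gcongr; exact min_le_right _ _
    have h2 := Nat.lt_floor_add_one ℓ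
    nlinarith
  refine (measureReal_mono hsub).trans ((measureReal_union_le _ _).trans ?_)
  have hsum1 := (measureReal_biUnion_finset_le (μ := μ) (Finset.Icc (-M : ℤ) 0 ×ˢ Finset.Icc 1 M)
    (fun p => D p.1 p.2)).trans (Finset.sum_le_card_nsmul _ _ _ hD)
  have hsum2 := (measureReal_biUnion_finset_le (μ := μ) (Finset.Icc (-M : ℤ) M) G).trans
    (Finset.sum_le_card_nsmul _ _ _ hG)
  have hc1 : (Finset.Icc (-M : ℤ) 0 ×ˢ Finset.Icc 1 M).card = (M + 1) * M := by
    rw [Finset.card_product, Int.card_Icc, Nat.card_Icc]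
    congr 1
    omega
  have hc2 : (Finset.Icc (-M : ℤ) M).card = 2 * M + 1 := by
    rw [Int.card_Icc]; omega
  rw [hc1, nsmul_eq_mul] at hsum1
  rw [hc2, nsmul_eq_mul] at hsum2
  push_cast at hsum1 hsum2
  have hM : (0 : ℝ) ≤ M := Nat.cast_nonneg M
  have hb1 : ((M : ℝ) + 1) * M * (K * Real.exp (-(t * ℓ))) ≤
      (M + 1) ^ 2 * (K * Real.exp (-(t * ℓ))) := by
    gcongr
    nlinarith
  have hb2 : (2 * (M : ℝ) + 1) * (C * θ⁻¹ * Real.exp (-(t * ℓ))) ≤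
      2 * (M + 1) ^ 2 * (C * θ⁻¹ * Real.exp (-(t * ℓ))) := by
    gcongr
    nlinarith
  calc _ ≤ (M + 1) ^ 2 * (K * Real.exp (-(t * ℓ))) +
        2 * (M + 1) ^ 2 * (C * θ⁻¹ * Real.exp (-(t * ℓ))) :=
        add_le_add (hsum1.trans hb1) (hsum2.trans hb2)
    _ = _ := by ring

lemma eventually_sqrt_le {c : ℝ} : ∀ᶠ y : ℝ in atTop, √y ≤ y / Real.log y ^ c := by
  have h1 := (isLittleO_log_rpow_rpow_atTop c (s := 1 / 2) (by norm_num)).bound one_pos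
  filter_upwards [h1, eventually_gt_atTop (Real.exp 1)] with y hy he
  have hy0 : 0 < y := (Real.exp_pos 1).trans he
  have hlog : 0 < Real.log y := Real.log_pos ((Real.one_lt_exp_iff.2 one_pos).trans he)
  rw [one_mul, Real.norm_of_nonneg (by positivity), Real.norm_of_nonneg (by positivity),
    ← Real.sqrt_eq_rpow] at hy
  rw [le_div_iff₀ (by positivity)]
  calc √y * Real.log y ^ c ≤ √y * √y := by gcongr
    _ = y := Real.mul_self_sqrt hy0.le

/-- Up to a negligible probability, `S_r` is a long and regular interval of a typical sample. -/
lemma exists_good_event (hμ : IsAperiodicMarkov μ) (hξ : IsMarkerFactor (hatLaw μ a) ξ)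
    {L : ℕ → ℝ} (hL : IsLengthsSequence μ a ξ L) :
    ∃ G : ℕ → Set (ℤ → A), OneSubDelta μ G L ∧ ∀ᶠ r in atTop, ∀ x ∈ G r,
      IsTypical μ a ξ x ∧ √(L r) ≤ size ξ a r x ∧
      IsRegular μ a (Real.log (size ξ a r x) ^ 2) x (leftEnd (ξ (hat a x)) r) (size ξ a r x) := by
  have hprob := hμ.isProbabilityMeasure
  obtain ⟨c, -, hsize⟩ := hL.size_bounds
  obtain ⟨B, t, hB, ht, hirr⟩ := hμ.exists_irregular_bound a
  set E : ℕ → Set (ℤ → A) := fun r =>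
    {x | L r / Real.log (L r) ^ c ≤ (size ξ a r x : ℝ) ∧ (size ξ a r x : ℝ) ≤ L r}
  -- The regularity constant must not be random: (log L / 2)² = log² √L serves, since |S_r| ≥ L /
  -- log^c L ≥ √L makes it at most log² |S_r|.
  set I : ℕ → Set (ℤ → A) := fun r => {x | ∃ (α : ℤ) (n : ℕ), -⌊L r⌋₊ ≤ α ∧ α ≤ 0 ∧ 0 < n ∧
    n ≤ ⌊L r⌋₊ ∧ x α = a ∧ x (α + n) = a ∧ ¬ IsRegular μ a ((Real.log (L r) / 2) ^ 2) x α n}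
  have hnull : μ.real {x | IsTypical μ a ξ x}ᶜ = 0 := by
    have := hμ.ae_isTypical hξ
    rw [ae_iff] at this
    rw [measureReal_eq_zero_iff]
    exact this
  refine ⟨fun r => {x | IsTypical μ a ξ x} ∩ (E r ∩ (I r)ᶜ), ?_, ?_⟩
  · refine IsDelta.of_le (IsDelta.add hsize (isDelta_exp hL.tendsto_atTop B ht))
      (fun r => measureReal_nonneg) ?_
    filter_upwards [hL.tendsto_atTop.eventually_ge_atTop 1] with r hr
    rw [Set.compl_inter, Set.compl_inter, compl_compl]
    refine (measureReal_union_le _ _).trans ?_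
    rw [hnull, zero_add]
    refine (measureReal_union_le _ _).trans ?_
    gcongr
    refine (hirr ⌊L r⌋₊ _ (sq_nonneg _)).trans ?_
    gcongr
    exact Nat.floor_le (by linarith)
  · filter_upwards [hL.tendsto_atTop.eventually eventually_sqrt_le,
      hL.tendsto_atTop.eventually_ge_atTop 1, eventually_gt_atTop 0] with r hs h1 hr x hx
    obtain ⟨hty, ⟨hx1, hx2⟩, hx3⟩ := hx
    have hsq := hs.trans hx1
    have hL0 : 0 < L r := by linarith
    have hn : 0 < size ξ a r x := by
      have : (0 : ℝ) < size ξ a r x := (Real.sqrt_pos.2 hL0).trans_le hsq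
      exact_mod_cast this
    refine ⟨hty, hsq, ?_⟩
    obtain ⟨g1, g2, g3, g4, g5⟩ := hty.size_spec hr hn
    have hfl : size ξ a r x ≤ ⌊L r⌋₊ := Nat.le_floor hx2
    have hreg : IsRegular μ a ((Real.log (L r) / 2) ^ 2) x (leftEnd (ξ (hat a x)) r)
        (size ξ a r x) := by
      by_contra hc
      exact hx3 ⟨_, _, by omega, g1, hn, hfl, g4, g5, hc⟩
    refine hreg.mono ?_
    have h5 := Real.log_nonneg h1
    rw [← Real.log_sqrt hL0.le]
    have h6 : 0 ≤ Real.log √(L r) := by rw [Real.log_sqrt hL0.le]; positivity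
    gcongr

end Regular

/-! ### Convergence of the mean determined fraction -/

section Fraction

variable {A : Type*} [MeasurableSpace A] [MeasurableSingletonClass A] [Fintype A] [DecidableEq A]
  {μ : Measure (ℤ → A)} {a : A} {ξ : (ℤ → Bool) → (ℤ → ℕ)}

lemma determinedFraction_nonneg (R : FillerRelations a) (r : ℕ) (x : ℤ → A) :
    0 ≤ R.determinedFraction μ ξ r x :=
  mul_nonneg (by positivity) (Finset.sum_nonneg fun _ _ =>
    Set.indicator_nonneg (fun _ _ => zero_le_one) _)

lemma determinedFraction_le_one (R : FillerRelations a) (r : ℕ) (x : ℤ → A) :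
    R.determinedFraction μ ξ r x ≤ 1 := by
  have h : ∑ i ∈ Finset.Ico (leftEnd (ξ (hat a x)) r) (rightEnd (ξ (hat a x)) r),
      (Determines μ (R.randomClass ξ r) (fun y => y i)).indicator (fun _ => (1 : ℝ)) x ≤
      (size ξ a r x : ℝ) := by
    refine (Finset.sum_le_card_nsmul _ _ 1 fun i _ => ?_).trans ?_
    · exact Set.indicator_le_self' (fun _ _ => zero_le_one) x
    · rw [Int.card_Ico, nsmul_eq_mul, mul_one]
      exact le_rfl
  rw [FillerRelations.determinedFraction, one_div]
  calc _ ≤ (size ξ a r x : ℝ)⁻¹ * (size ξ a r x : ℝ) := by gcongr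
    _ ≤ 1 := inv_mul_le_one

lemma tendsto_Lam_neg : Tendsto (fun y : ℝ => Lam 5 (-(1 / 2)) y) atTop (𝓝 0) := by
  have h := (isLittleO_log_rpow_rpow_atTop 5 (s := 1 / 2) (by norm_num)).tendsto_div_nhds_zero
  refine h.congr' ?_
  filter_upwards [eventually_gt_atTop 0] with y hy
  rw [Lam, Real.rpow_neg hy.le, div_eq_inv_mul]

lemma tendsto_integral_determinedFraction [IsProbabilityMeasure μ] (hξ : Measurable ξ)
    {R : FillerRelations a} {L : ℕ → ℝ} (hL : Tendsto L atTop atTop) {G : ℕ → Set (ℤ → A)}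
    (hG : OneSubDelta μ G L) (h : ∀ᶠ r in atTop, ∀ x ∈ G r, √(L r) ≤ size ξ a r x ∧
      1 - Lam 5 (-(1 / 2)) (size ξ a r x) ≤ R.determinedFraction μ ξ r x) :
    Tendsto (fun r => ∫ x, R.determinedFraction μ ξ r x ∂μ) atTop (𝓝 1) := by
  have hmeas := fun r => measurable_determinedFraction (μ := μ) (a := a) hξ R r
  have hint : ∀ r, Integrable (R.determinedFraction μ ξ r) μ := fun r =>
    Integrable.of_bound (hmeas r).aestronglyMeasurable 1 (ae_of_all _ fun x => by
      rw [Real.norm_of_nonneg (determinedFraction_nonneg R r x)]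
      exact determinedFraction_le_one R r x)
  have hle : ∀ r, ∫ x, R.determinedFraction μ ξ r x ∂μ ≤ 1 := fun r => by
    calc _ ≤ ∫ _, (1 : ℝ) ∂μ :=
          integral_mono (hint r) (integrable_const _) fun x => determinedFraction_le_one R r x
      _ = 1 := by simp
  rw [tendsto_order]
  refine ⟨fun b hb => ?_, fun b hb => Eventually.of_forall fun r => (hle r).trans_lt hb⟩
  -- One ε for the defect of the fraction off T, one for the probability of T, and one to make the
  -- inequality strict.
  set ε := (1 - b) / 3 with hε
  have hε0 : 0 < ε := by rw [hε]; linarith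
  obtain ⟨N, hN⟩ := eventually_atTop.1 (tendsto_Lam_neg.eventually_lt_const hε0)
  filter_upwards [h, (IsDelta.tendsto_zero hG hL).eventually_lt_const hε0,
    (Real.tendsto_sqrt_atTop.comp hL).eventually_ge_atTop N] with r hr hGr hLr
  set T : Set (ℤ → A) := {x | R.determinedFraction μ ξ r x < 1 - ε}
  have hTm : MeasurableSet T := measurableSet_lt (hmeas r) measurable_const
  have hT : μ.real T ≤ ε := by
    refine (measureReal_mono fun x hx hxG => ?_).trans hGr.le
    obtain ⟨h1, h2⟩ := hr x hxG
    have h3 := hN (size ξ a r x) (hLr.trans h1)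
    have h4 : R.determinedFraction μ ξ r x < 1 - ε := hx
    linarith
  have hlow : ∀ x, 1 - ε - T.indicator (fun _ => (1 : ℝ)) x ≤ R.determinedFraction μ ξ r x := by
    intro x
    by_cases hx : x ∈ T
    · rw [Set.indicator_of_mem hx]
      linarith [determinedFraction_nonneg (μ := μ) (ξ := ξ) R r x]
    · rw [Set.indicator_of_notMem hx, sub_zero]
      exact not_lt.1 hx
  have hI : Integrable (T.indicator fun _ => (1 : ℝ)) μ := (integrable_const _).indicator hTm
  have := integral_mono ((integrable_const (1 - ε)).sub hI) (hint r) hlow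
  rw [integral_sub' (integrable_const _) hI, integral_indicator_const _ hTm] at this
  simp only [integral_const, probReal_univ, smul_eq_mul, mul_one, one_mul] at this
  linarith

lemma isSOF_revealRel (hμ : IsAperiodicMarkov μ) (hξ : IsMarkerFactor (hatLaw μ a) ξ) {C : ℝ}
    (ht : Tendsto (fun r => ∫ x, (revealRel μ a C).determinedFraction μ ξ r x ∂μ) atTop (𝓝 1)) :
    IsSOF μ a ξ (revealRel μ a C) := by
  have := hμ.isProbabilityMeasure_hatLaw a
  -- The relation ignores the start of the skeleton, so translation invariance holds by definition.
  refine ⟨fun S t w w' => Iff.rfl, ?_, ht⟩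
  filter_upwards [hξ.ae_marks (hμ.measurePreserving_hatLaw a)] with ω hω α n _ q k l hd w w' hw i h
  exact revealRel_sub hω (hd.skeleton i) w w' hw h

end Fraction

end

end MarkedProc

/-! ### The proposition -/

theorem mainTheorem5 {A : Type*} [Fintype A] [DecidableEq A] [MeasurableSpace A]
    [MeasurableSingletonClass A] (μ : MeasureTheory.Measure (ℤ → A)) (a : A)
    (hX : MarkedProc.IsMarkedProcess μ a)
    (hpos : 0 < MarkedProc.condEntropy μ a)
    (ξ : (ℤ → Bool) → (ℤ → ℕ))
    (hξ : MarkedProc.IsMarkerFactor (MarkedProc.hatLaw μ a) ξ)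
    (L : ℕ → ℝ) (hL : MarkedProc.IsLengthsSequence μ a ξ L) :
    ∃ R : MarkedProc.FillerRelations a, MarkedProc.IsGoodSOF μ a ξ L R ∧
      ∃ δ : ℝ, 0 < δ ∧ MarkedProc.OneSubDelta μ
        (fun r => {x | 1 - MarkedProc.Lam δ (-(1 / 2)) (MarkedProc.size ξ a r x) ≤
          R.determinedFraction μ ξ r x}) L := by
  have hμ := hX.aperiodicMarkov
  have hprob := hμ.isProbabilityMeasure
  obtain ⟨C, hC0, hC⟩ := hμ.exists_cost_le a
  obtain ⟨N, hN⟩ := MarkedProc.information_and_fraction hμ hξ hX.reduction hpos hC0 hC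
  obtain ⟨G, hG, hGood⟩ := MarkedProc.exists_good_event hμ hξ hL
  have hev : ∀ᶠ r in Filter.atTop, ∀ x ∈ G r, √(L r) ≤ MarkedProc.size ξ a r x ∧
      ((MarkedProc.size ξ a r x * MarkedProc.condEntropy μ a -
        MarkedProc.Lam 2 (1 / 2) (MarkedProc.size ξ a r x) : ℝ) : EReal) ≤
          (MarkedProc.revealRel μ a C).randomInformation μ ξ r x ∧
      1 - MarkedProc.Lam 5 (-(1 / 2)) (MarkedProc.size ξ a r x) ≤
        (MarkedProc.revealRel μ a C).determinedFraction μ ξ r x := by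
    filter_upwards [hGood, Filter.eventually_gt_atTop 0,
      (Real.tendsto_sqrt_atTop.comp hL.tendsto_atTop).eventually_ge_atTop (N : ℝ)]
      with r hr hr0 hLr x hx
    obtain ⟨h1, h2, h3⟩ := hr x hx
    exact ⟨h2, hN r x hr0 h1 (by exact_mod_cast hLr.trans h2) h3⟩
  -- k = 0 since the budget equals nh - √n for large n; K = 2 and δ = 5 come from
  -- `information_and_fraction`, whose hypotheses hold on the good events G r for all large r.
  refine ⟨MarkedProc.revealRel μ a C, ⟨MarkedProc.isSOF_revealRel hμ hξ
    (MarkedProc.tendsto_integral_determinedFraction hξ.measurable hL.tendsto_atTop hG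
      (hev.mono fun r h x hx => ⟨(h x hx).1, (h x hx).2.2⟩)),
    0, 2, by norm_num, MarkedProc.information_cls_le hμ hξ hpos hC, ?_⟩, 5, by norm_num, ?_⟩
  · refine MarkedProc.IsDelta.of_le hG (fun r => MeasureTheory.measureReal_nonneg) ?_
    filter_upwards [hev] with r hr
    exact MeasureTheory.measureReal_mono (Set.compl_subset_compl.2 fun x hx => (hr x hx).2.1)
  · refine MarkedProc.IsDelta.of_le hG (fun r => MeasureTheory.measureReal_nonneg) ?_
    filter_upwards [hev] with r hr
    exact MeasureTheory.measureReal_mono (Set.compl_subset_compl.2 fun x hx => (hr x hx).2.2)
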